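/- Let $\theta_1,\theta_2\in(0,1]$. Let $K=K(x,y)\in\mathbb C$ be defined for $x=(x^1,x^2),\,y=(y^1,y^2)\in\mathbb R^2$ with $x^1\ne y^1$ and $x^2\ne y^2$, and write $$D_{\theta_2}(x,y)=\Big(\frac{|x^1-y^1|}{|x^2-y^2|}+\frac{|x^2-y^2|}{|x^1-y^1|}\Big)^{-\theta_2}.$$ Assume that $K\in CZX(\mathbb R^2)$, i.e. for some constant $C$ and all such $x,y$ one has the size estimate $$|K(x,y)|\le \frac{C}{|x^1-y^1|\,|x^2-y^2|}D_{\theta_2}(x,y),$$ the mixed Hölder and size estimate $$|K(x,y)-K((w^1,x^2),y)|\le C\frac{|x^1-w^1|^{\theta_1}}{|x^1-y^1|^{1+\theta_1}}\frac{1}{|x^2-y^2|}D_{\theta_2}(x,y)\qquad\text{whenever }|x^1-w^1|\le\tfrac12|x^1-y^1|,$$ and the three symmetric estimates for changes of $x^2$, of $y^1$ and of $y^2$. Let $T$ be a bounded linear operator on $L^2(\mathbb R^2)$ associated with $K$, i.e. $$\int_{\mathbb R^2} (Tf)\,g=\iint K(x,y)f(y)g(x)\,dx\,dy$$ for all finite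 linear combinations $f,g$ of indicators of cubes (axis-parallel squares) with $\{f\ne0\}\cap\{g\ne0\}=\varnothing$. Then $T$ extends boundedly 1. from $L^\infty(\mathbb R^2)$ into $\mathrm{BMO}(\mathbb R^2)$ (functions modulo constants, $\|b\|_{\mathrm{BMO}}=\sup_I\frac1{|I|}\int_I|b-\frac1{|I|}\int_I b|$ over cubes $I$): there is a bounded linear map $S\colon L^\infty\to\mathrm{BMO}$ that agrees with $T$ modulo constants on $L^2\cap L^\infty$ and satisfies $\int (Sf)g=\lim_{n\to\infty}\int T(1_{[-n,n)^2}f)\,g$ for every $f\in L^\infty$ and every finite linear combination $g$ of indicators of cubes with $\int g=0$; 2. from $L^1(\mathbb R^2)$ into $L^{1,\infty}(\mathbb R^2)$: there is a linear map $S$ on $L^1$ that agrees with $T$ on $L^1\cap L^2$ and satisfies $\sup_{t>0}t\,|\{|Sf|>t\}|\le C'\|f\|_{L^1}$ for a constant $C'$ and all $f\in L^1$; 3. from $L^p(\mathbb R^2)$ into itself for every $p\in(1,\infty)$: there is a bounded linear operator on $L^p$ that agrees with $T$ on $L^p\cap L^2$. Moreover, $K$ satisfies the Hörmander integral condition in both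 variables: there is a constant $C''$ such that for every cube $J$ with centre $c_J$ and every $x\in J$, $$\int_{(3J)^c}|K(x,y)-K(c_J,y)|\,dy\le C'',\qquad \int_{(3J)^c}|K(y,x)-K(y,c_J)|\,dy\le C''.$$ -/

import Mathlib

open MeasureTheory Filter Topology
open scoped ENNReal NNReal

/-- The half-open square in `ℝ² = ℝ × ℝ` with centre `c` and side length `2 * r`
(empty when `r ≤ 0`). -/
def cube (c : ℝ × ℝ) (r : ℝ) : Set (ℝ × ℝ) :=
  Set.Ico (c.1 - r) (c.1 + r) ×ˢ Set.Ico (c.2 - r) (c.2 + r)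

/-- The decay factor `D_θ(x, y)`. -/
noncomputable def czxDecay (θ : ℝ) (x y : ℝ × ℝ) : ℝ :=
  (|x.1 - y.1| / |x.2 - y.2| + |x.2 - y.2| / |x.1 - y.1|) ^ (-θ)

/-- `K ∈ CZX(ℝ²)` with exponents `θ₁` (regularity) and `θ₂` (decay): the size estimate and the
four mixed Hölder and size estimates, with one constant `C`. Only the values `K x y` with
`x.1 ≠ y.1` and `x.2 ≠ y.2` matter. -/
def IsCZXKernel (θ₁ θ₂ : ℝ) (K : ℝ × ℝ → ℝ × ℝ → ℂ) : Prop :=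
  ∃ C : ℝ, ∀ x y : ℝ × ℝ, x.1 ≠ y.1 → x.2 ≠ y.2 →
    ‖K x y‖ ≤ C * (1 / |x.1 - y.1|) * (1 / |x.2 - y.2|) * czxDecay θ₂ x y ∧
    (∀ w : ℝ, |x.1 - w| ≤ |x.1 - y.1| / 2 →
      ‖K x y - K (w, x.2) y‖ ≤ C * (|x.1 - w| ^ θ₁ / |x.1 - y.1| ^ (1 + θ₁)) *
        (1 / |x.2 - y.2|) * czxDecay θ₂ x y) ∧
    (∀ w : ℝ, |x.2 - w| ≤ |x.2 - y.2| / 2 →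
      ‖K x y - K (x.1, w) y‖ ≤ C * (1 / |x.1 - y.1|) *
        (|x.2 - w| ^ θ₁ / |x.2 - y.2| ^ (1 + θ₁)) * czxDecay θ₂ x y) ∧
    (∀ w : ℝ, |y.1 - w| ≤ |x.1 - y.1| / 2 →
      ‖K x y - K x (w, y.2)‖ ≤ C * (|y.1 - w| ^ θ₁ / |x.1 - y.1| ^ (1 + θ₁)) *
        (1 / |x.2 - y.2|) * czxDecay θ₂ x y) ∧
    (∀ w : ℝ, |y.2 - w| ≤ |x.2 - y.2| / 2 →
      ‖K x y - K x (y.1, w)‖ ≤ C * (1 / |x.1 - y.1|) *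
        (|y.2 - w| ^ θ₁ / |x.2 - y.2| ^ (1 + θ₁)) * czxDecay θ₂ x y)

/-- Finite linear combinations of indicators of cubes. -/
noncomputable def cubeStep : Submodule ℂ (ℝ × ℝ → ℂ) :=
  Submodule.span ℂ
    (Set.range fun q : (ℝ × ℝ) × ℝ => (cube q.1 q.2).indicator (fun _ => (1 : ℂ)))

theorem measurableSet_cube (c : ℝ × ℝ) (r : ℝ) : MeasurableSet (cube c r) :=
  measurableSet_Ico.prod measurableSet_Ico

theorem volume_cube_ne_top (c : ℝ × ℝ) (r : ℝ) : volume (cube c r) ≠ ∞ := by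
  rw [cube, Measure.volume_eq_prod, Measure.prod_prod, Real.volume_Ico, Real.volume_Ico]
  exact ENNReal.mul_ne_top ENNReal.ofReal_ne_top ENNReal.ofReal_ne_top

theorem memLp_of_mem_cubeStep {f : ℝ × ℝ → ℂ} (hf : f ∈ cubeStep) (p : ℝ≥0∞) :
    MemLp f p volume := by
  unfold cubeStep at hf
  induction hf using Submodule.span_induction with
  | mem f hf =>
    obtain ⟨q, rfl⟩ := hf
    exact memLp_indicator_const p (measurableSet_cube _ _) 1 (Or.inr (volume_cube_ne_top _ _))
  | zero => exact MemLp.zero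
  | add f g _ _ hf hg => exact hf.add hg
  | smul a f _ hf => exact hf.const_smul a

/-- The operator `T ∈ L(L²(ℝ²))` is associated with the kernel `K`:
`⟨Tf, g⟩ = ∬ K(x, y) f(y) g(x) dx dy` for all finite linear combinations `f`, `g` of indicators
of cubes such that `{f ≠ 0} ∩ {g ≠ 0} = ∅`. -/
def IsAssociatedKernel (T : Lp ℂ 2 (volume : Measure (ℝ × ℝ)) →L[ℂ] Lp ℂ 2 (volume : Measure (ℝ × ℝ)))
    (K : ℝ × ℝ → ℝ × ℝ → ℂ) : Prop :=
  ∀ (f g : ℝ × ℝ → ℂ) (hf : f ∈ cubeStep), g ∈ cubeStep → {x | f x ≠ 0} ∩ {x | g x ≠ 0} = ∅ →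
    ∫ x, T ((memLp_of_mem_cubeStep hf 2).toLp f) x * g x =
      ∫ z : (ℝ × ℝ) × (ℝ × ℝ), K z.1 z.2 * f z.2 * g z.1

/-- The `BMO(ℝ²)` seminorm (meaningful for locally integrable `b`). -/
noncomputable def bmoSeminorm (b : ℝ × ℝ → ℂ) : ℝ≥0∞ :=
  ⨆ (c : ℝ × ℝ) (r : ℝ) (_ : 0 < r),
    (∫⁻ x in cube c r, ‖b x - ⨍ y in cube c r, b y‖ₑ) / volume (cube c r)

/-- The quasinorm of `L^{1,∞}(ℝ²)`. -/
noncomputable def weakL1Norm (h : ℝ × ℝ → ℂ) : ℝ≥0∞ :=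
  ⨆ t : ℝ≥0, (t : ℝ≥0∞) * volume {x | (t : ℝ≥0∞) < ‖h x‖ₑ}

theorem memLp_truncation (f : Lp ℂ ∞ (volume : Measure (ℝ × ℝ))) (n : ℕ) :
    MemLp ((cube 0 n).indicator f) 2 volume := by
  rw [memLp_indicator_iff_restrict (measurableSet_cube _ _)]
  have : IsFiniteMeasure (volume.restrict (cube 0 (n : ℝ))) :=
    isFiniteMeasure_restrict.2 (volume_cube_ne_top _ _)
  exact ((Lp.memLp f).restrict _).mono_exponent le_top

/-- The truncation `1_{[-n, n)²} f` of a bounded function, as an element of `L²`. -/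
noncomputable def truncation (f : Lp ℂ ∞ (volume : Measure (ℝ × ℝ))) (n : ℕ) :
    Lp ℂ 2 (volume : Measure (ℝ × ℝ)) :=
  (memLp_truncation f n).toLp _

/-- `T` extends to a bounded linear operator from `L^∞(ℝ²)` into `BMO(ℝ²)`. Elements of `BMO` are
functions modulo additive constants; a linear map into them is given by a linear choice `S` of
representatives. Since `L² ∩ L^∞` is not dense in `L^∞`, the last clause records that `S f` is
the usual extension, i.e. the limit of `T (1_{[-n, n)²} f)` when paired with step functions of
integral zero; this determines `S f` up to a constant. -/
def ExtendsLinftyBMO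
    (T : Lp ℂ 2 (volume : Measure (ℝ × ℝ)) →L[ℂ] Lp ℂ 2 (volume : Measure (ℝ × ℝ))) : Prop :=
  ∃ (S : Lp ℂ ∞ (volume : Measure (ℝ × ℝ)) →ₗ[ℂ] (ℝ × ℝ →ₘ[volume] ℂ)) (C : ℝ≥0),
    (∀ f, LocallyIntegrable (S f) volume ∧ bmoSeminorm (S f) ≤ C * ‖f‖ₑ) ∧
    (∀ (f : ℝ × ℝ → ℂ) (h2 : MemLp f 2 volume) (h : MemLp f ∞ volume),
      ∃ a : ℂ, ∀ᵐ x, S (h.toLp f) x = T (h2.toLp f) x + a) ∧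
    (∀ f, ∀ g ∈ cubeStep, ∫ x, g x = 0 →
      Tendsto (fun n : ℕ => ∫ x, T (truncation f n) x * g x) atTop (𝓝 (∫ x, S f x * g x)))

/-- `T` extends to a bounded linear operator from `L¹(ℝ²)` into `L^{1,∞}(ℝ²)`. -/
def ExtendsWeakL1
    (T : Lp ℂ 2 (volume : Measure (ℝ × ℝ)) →L[ℂ] Lp ℂ 2 (volume : Measure (ℝ × ℝ))) : Prop :=
  ∃ (S : Lp ℂ 1 (volume : Measure (ℝ × ℝ)) →ₗ[ℂ] (ℝ × ℝ →ₘ[volume] ℂ)) (C : ℝ≥0),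
    (∀ f, weakL1Norm (S f) ≤ C * ‖f‖ₑ) ∧
    ∀ (f : ℝ × ℝ → ℂ) (h2 : MemLp f 2 volume) (h : MemLp f 1 volume),
      S (h.toLp f) =ᵐ[volume] T (h2.toLp f)

/-- `T` extends to a bounded linear operator from `L^p(ℝ²)` into itself. -/
def ExtendsLp
    (T : Lp ℂ 2 (volume : Measure (ℝ × ℝ)) →L[ℂ] Lp ℂ 2 (volume : Measure (ℝ × ℝ)))
    (p : ℝ≥0∞) [Fact (1 ≤ p)] : Prop :=
  ∃ S : Lp ℂ p (volume : Measure (ℝ × ℝ)) →L[ℂ] Lp ℂ p (volume : Measure (ℝ × ℝ)),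
    ∀ (f : ℝ × ℝ → ℂ) (h2 : MemLp f 2 volume) (h : MemLp f p volume),
      S (h.toLp f) =ᵐ[volume] T (h2.toLp f)

/-- The Hörmander integral condition, in both variables: for every cube `J = cube c r`, with
`3J = cube c (3 * r)`, and every point of `J`. -/
def HormanderCondition (K : ℝ × ℝ → ℝ × ℝ → ℂ) : Prop :=
  ∃ C : ℝ≥0, ∀ (c : ℝ × ℝ) (r : ℝ), ∀ x ∈ cube c r,
    ∫⁻ y in (cube c (3 * r))ᶜ, ‖K x y - K c y‖ₑ ≤ C ∧
    ∫⁻ y in (cube c (3 * r))ᶜ, ‖K y x - K y c‖ₑ ≤ C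

/-! The kernel is singular along both coordinate lines through a point, yet the decay factor makes
it a Calderón–Zygmund kernel in the integrated sense. Off a tripled square 3J of half-side 3r, the
plane splits into a region where both coordinates of y are far from the centre and two strips where
only one is. In the first region the difference of kernels is telescoped one coordinate at a time.
The Hölder factor r^θ₁|x^1-y^1|^(-1-θ₁) is integrable over the far coordinate, and what remains,
D/|x^2-y^2|, has an integral in the other coordinate that is bounded independently of scale
(`lintegral_decay_le`). In the strips no regularity is available, but none is needed. Replacing D by
a suitable one of its two powers makes the size bound a product of two powers, one integrable at the
singularity and the other at infinity, and the scale r cancels. This is the Hörmander condition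
(`IsCZXKernel.exists_hormander`). The hypotheses are symmetric in x and y, so it holds in both
variables.

The rest is Calderón–Zygmund theory. The association with K is given only for step functions with
disjoint supports; Lebesgue differentiation and the bilinear transpose turn it into a pointwise
formula for Tf away from the support of f (`ae_eq_integral_kernel`). Mean-zero functions on a square
then have images integrable off the tripled square (`exists_hasOffDiagonalBound`), and the
Calderón–Zygmund decomposition gives weak type (1,1) (`weak_type_one_one`). Marcinkiewicz
interpolation with L² covers 1 < p < 2 (`strong_type_of_lt_two`). Duality covers p > 2
(`strong_type_dual`), since the transpose satisfies the same hypotheses.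

The extension to L^p is by density. Weak L¹ is not normed, so the extension to L¹ is built from
almost everywhere limits along rapidly convergent sequences (`HasWeakType.ae_summable`). For L^∞,
the images of the truncations converge almost everywhere on each square once constants are
subtracted (`tendsto_truncation_sub_farConst`), and comparison at one common point glues these local
limits (`exists_isBMOLimit`). -/

/-! ### One-dimensional integrals of powers and of the decay factor. -/

theorem lintegral_comp_abs_eq (g : ℝ → ℝ≥0∞) :
    ∫⁻ t, g |t| = 2 * ∫⁻ t in Set.Ioi 0, g t := by
  rw [← lintegral_add_compl (fun t => g |t|) (measurableSet_Ioi (a := (0 : ℝ))), Set.compl_Ioi,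
    setLIntegral_congr Iio_ae_eq_Iic.symm, two_mul]
  have h1 : ∫⁻ t in Set.Ioi (0 : ℝ), g |t| = ∫⁻ t in Set.Ioi 0, g t :=
    setLIntegral_congr_fun measurableSet_Ioi fun t ht => by rw [abs_of_pos ht]
  have h2 := (Measure.measurePreserving_neg (volume : Measure ℝ)).setLIntegral_comp_preimage_emb
    (MeasurableEquiv.neg ℝ).measurableEmbedding g (Set.Ioi 0)
  have h3 : ∫⁻ t in Set.Iio (0 : ℝ), g |t| = ∫⁻ t in Set.Iio 0, g (-t) :=
    setLIntegral_congr_fun measurableSet_Iio fun t ht => by rw [abs_of_neg ht]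
  rw [h1, h3, ← h2]
  congr 3
  ext; simp

theorem lintegral_abs_sub_rpow_near {θ L : ℝ} (hθ : 0 < θ) (hL : 0 ≤ L) (a : ℝ) :
    ∫⁻ t in {t | |a - t| ≤ L}, ENNReal.ofReal (|a - t| ^ (θ - 1)) =
      ENNReal.ofReal (2 * L ^ θ / θ) := by
  set g : ℝ → ℝ≥0∞ := (Set.Iic L).indicator fun s => ENNReal.ofReal (s ^ (θ - 1)) with hg
  have hS : MeasurableSet {t | |a - t| ≤ L} := measurableSet_le (by fun_prop) (by fun_prop)
  have e1 : ∫⁻ t in {t | |a - t| ≤ L}, ENNReal.ofReal (|a - t| ^ (θ - 1)) = ∫⁻ t, g |a - t| := by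
    rw [← lintegral_indicator hS]
    rfl
  have hi : IntervalIntegrable (fun x : ℝ => x ^ (θ - 1)) volume 0 L :=
    intervalIntegral.intervalIntegrable_rpow' (by linarith)
  rw [intervalIntegrable_iff_integrableOn_Ioc_of_le hL] at hi
  rw [e1, lintegral_sub_left_eq_self (fun t => g |t|) a, lintegral_comp_abs_eq, hg,
    setLIntegral_indicator measurableSet_Iic, Set.inter_comm, Set.Ioi_inter_Iic,
    ← ofReal_integral_eq_lintegral_ofReal hi, ← intervalIntegral.integral_of_le hL,
    integral_rpow (Or.inl (by linarith)), ← ENNReal.ofReal_ofNat 2,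
    ← ENNReal.ofReal_mul (by norm_num)]
  · congr 1
    rw [sub_add_cancel, Real.zero_rpow hθ.ne']
    ring
  · filter_upwards [ae_restrict_mem measurableSet_Ioc] with x hx
    exact Real.rpow_nonneg hx.1.le _

theorem lintegral_abs_sub_rpow_far {θ L : ℝ} (hθ : 0 < θ) (hL : 0 < L) (a : ℝ) :
    ∫⁻ t in {t | L ≤ |a - t|}, ENNReal.ofReal (|a - t| ^ (-1 - θ)) =
      ENNReal.ofReal (2 * L ^ (-θ) / θ) := by
  set g : ℝ → ℝ≥0∞ := (Set.Ici L).indicator fun s => ENNReal.ofReal (s ^ (-1 - θ)) with hg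
  have hS : MeasurableSet {t | L ≤ |a - t|} := measurableSet_le (by fun_prop) (by fun_prop)
  have e1 : ∫⁻ t in {t | L ≤ |a - t|}, ENNReal.ofReal (|a - t| ^ (-1 - θ)) = ∫⁻ t, g |a - t| := by
    rw [← lintegral_indicator hS]
    rfl
  have hi : IntegrableOn (fun x : ℝ => x ^ (-1 - θ)) (Set.Ioi L) volume :=
    integrableOn_Ioi_rpow_of_lt (by linarith) hL
  have hLs : Set.Ici L ∩ Set.Ioi 0 = Set.Ici L :=
    Set.inter_eq_left.2 fun x hx => lt_of_lt_of_le hL hx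
  rw [e1, lintegral_sub_left_eq_self (fun t => g |t|) a, lintegral_comp_abs_eq, hg,
    setLIntegral_indicator measurableSet_Ici, hLs, setLIntegral_congr Ioi_ae_eq_Ici.symm,
    ← ofReal_integral_eq_lintegral_ofReal hi, integral_Ioi_rpow_of_lt (by linarith) hL,
    ← ENNReal.ofReal_ofNat 2, ← ENNReal.ofReal_mul (by norm_num)]
  · congr 1
    rw [show -1 - θ + 1 = -θ by ring]
    field_simp
  · filter_upwards [ae_restrict_mem measurableSet_Ioi] with x hx
    exact Real.rpow_nonneg (hL.trans hx).le _

/-- The one-variable form of the decay factor. -/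
theorem add_div_rpow_neg_le {u v θ : ℝ} (hu : 0 < u) (hv : 0 < v) (hθ : 0 ≤ θ) :
    (u / v + v / u) ^ (-θ) ≤ u ^ θ * v ^ (-θ) := by
  have h : (u / v + v / u) ^ (-θ) ≤ (v / u) ^ (-θ) :=
    Real.rpow_le_rpow_of_nonpos (by positivity) (by have := div_pos hu hv; linarith) (by linarith)
  refine h.trans (le_of_eq ?_)
  rw [Real.div_rpow hv.le hu.le, Real.rpow_neg hu.le, div_inv_eq_mul, mul_comm]

theorem add_div_rpow_neg_le' {u v θ : ℝ} (hu : 0 < u) (hv : 0 < v) (hθ : 0 ≤ θ) :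
    (u / v + v / u) ^ (-θ) ≤ v ^ θ * u ^ (-θ) := by
  rw [add_comm]; exact add_div_rpow_neg_le hv hu hθ

theorem ae_ne_of_null (a : ℝ) : ∀ᵐ t : ℝ, t ≠ a := by
  simp [ae_iff]

/-- The measure dt/|a - t| is scale invariant and diverges logarithmically at both ends. With v = |a
- t|, the decay factor contributes (v/u)^θ for v ≤ u and (u/v)^θ for v ≥ u, so each half is at most
2/θ, whatever u is. -/
theorem lintegral_decay_le {θ u : ℝ} (hθ : 0 < θ) (hu : 0 < u) (a : ℝ) :
    ∫⁻ t, ENNReal.ofReal ((1 / |a - t|) * (u / |a - t| + |a - t| / u) ^ (-θ)) ≤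
      ENNReal.ofReal (4 / θ) := by
  have hS : MeasurableSet {t | |a - t| ≤ u} := measurableSet_le (by fun_prop) (by fun_prop)
  have hsub : {t | |a - t| ≤ u}ᶜ ⊆ {t | u ≤ |a - t|} := fun t ht => (not_le.1 (show ¬ |a - t| ≤ u from ht)).le
  rw [← lintegral_add_compl _ hS]
  have h1 : ∫⁻ t in {t | |a - t| ≤ u},
      ENNReal.ofReal ((1 / |a - t|) * (u / |a - t| + |a - t| / u) ^ (-θ)) ≤
      ENNReal.ofReal (2 / θ) := by
    calc _ ≤ ∫⁻ t in {t | |a - t| ≤ u},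
          ENNReal.ofReal (u ^ (-θ)) * ENNReal.ofReal (|a - t| ^ (θ - 1)) := by
          refine lintegral_mono_ae (ae_restrict_of_ae ?_)
          filter_upwards [ae_ne_of_null a] with t ht
          have hv : 0 < |a - t| := abs_pos.2 (sub_ne_zero.2 ht.symm)
          rw [← ENNReal.ofReal_mul (by positivity)]
          refine ENNReal.ofReal_le_ofReal ?_
          calc _ ≤ (1 / |a - t|) * (|a - t| ^ θ * u ^ (-θ)) := by
                gcongr; exact add_div_rpow_neg_le' hu hv hθ.le
            _ = _ := by
                rw [Real.rpow_sub_one hv.ne']; ring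
      _ = _ := by
          rw [lintegral_const_mul' _ _ ENNReal.ofReal_ne_top,
            lintegral_abs_sub_rpow_near hθ hu.le, ← ENNReal.ofReal_mul (by positivity)]
          congr 1
          rw [Real.rpow_neg hu.le]
          field_simp
  have h2 : ∫⁻ t in {t | |a - t| ≤ u}ᶜ,
      ENNReal.ofReal ((1 / |a - t|) * (u / |a - t| + |a - t| / u) ^ (-θ)) ≤
      ENNReal.ofReal (2 / θ) := by
    calc _ ≤ ∫⁻ t in {t | u ≤ |a - t|},
          ENNReal.ofReal ((1 / |a - t|) * (u / |a - t| + |a - t| / u) ^ (-θ)) :=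
          lintegral_mono_set hsub
      _ ≤ ∫⁻ t in {t | u ≤ |a - t|},
          ENNReal.ofReal (u ^ θ) * ENNReal.ofReal (|a - t| ^ (-1 - θ)) := by
          refine lintegral_mono_ae (ae_restrict_of_ae ?_)
          filter_upwards [ae_ne_of_null a] with t ht
          have hv : 0 < |a - t| := abs_pos.2 (sub_ne_zero.2 ht.symm)
          rw [← ENNReal.ofReal_mul (by positivity)]
          refine ENNReal.ofReal_le_ofReal ?_
          calc _ ≤ (1 / |a - t|) * (u ^ θ * |a - t| ^ (-θ)) := by
                gcongr; exact add_div_rpow_neg_le hu hv hθ.le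
            _ = _ := by
                rw [show -1 - θ = -θ - 1 by ring, Real.rpow_sub_one hv.ne']; ring
      _ = _ := by
          rw [lintegral_const_mul' _ _ ENNReal.ofReal_ne_top,
            lintegral_abs_sub_rpow_far hθ hu, ← ENNReal.ofReal_mul (by positivity)]
          congr 1
          rw [Real.rpow_neg hu.le]
          field_simp
  calc _ ≤ ENNReal.ofReal (2 / θ) + ENNReal.ofReal (2 / θ) := add_le_add h1 h2
    _ = _ := by
        rw [← ENNReal.ofReal_add (by positivity) (by positivity)]
        congr 1; ring

/-! ### Symmetry, size bounds and measurability of the kernel. -/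

theorem IsCZXKernel.swap {θ₁ θ₂ : ℝ} {K : ℝ × ℝ → ℝ × ℝ → ℂ} (hK : IsCZXKernel θ₁ θ₂ K) :
    IsCZXKernel θ₁ θ₂ fun x y => K y x := by
  obtain ⟨C, hC⟩ := hK
  refine ⟨C, fun x y h1 h2 => ?_⟩
  obtain ⟨a, b, c, d, e⟩ := hC y x h1.symm h2.symm
  have hD : czxDecay θ₂ y x = czxDecay θ₂ x y := by
    simp only [czxDecay, abs_sub_comm]
  rw [hD] at a b c d e
  rw [abs_sub_comm x.1 y.1, abs_sub_comm x.2 y.2]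
  exact ⟨a, d, e, b, c⟩

/-- The constant in the kernel estimates carries no sign hypothesis; one evaluation where the decay
factor is positive supplies it. -/
theorem nonneg_of_size_estimate {θ₂ : ℝ} {K : ℝ × ℝ → ℝ × ℝ → ℂ} {C : ℝ}
    (hC : ‖K 0 1‖ ≤ C * (1 / |(0 : ℝ × ℝ).1 - (1 : ℝ × ℝ).1|) *
      (1 / |(0 : ℝ × ℝ).2 - (1 : ℝ × ℝ).2|) * czxDecay θ₂ 0 1) : 0 ≤ C := by
  have : 0 < czxDecay θ₂ 0 1 := by
    simp only [czxDecay]; norm_num; positivity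
  norm_num at hC
  exact nonneg_of_mul_nonneg_left ((norm_nonneg _).trans hC) this

/-- Keeping only one of the two quotients in the decay factor separates the variables. Each bound is
locally integrable in one coordinate difference and integrable at infinity in the other, which suits
one of the two kinds of strip. -/
theorem IsCZXKernel.exists_size_le {θ₁ θ₂ : ℝ} {K : ℝ × ℝ → ℝ × ℝ → ℂ}
    (hK : IsCZXKernel θ₁ θ₂ K) (hθ₂ : 0 < θ₂) :
    ∃ C : ℝ, 0 ≤ C ∧ ∀ x y : ℝ × ℝ, x.1 ≠ y.1 → x.2 ≠ y.2 →
      ‖K x y‖ ≤ C * (|x.1 - y.1| ^ (θ₂ - 1) * |x.2 - y.2| ^ (-1 - θ₂)) ∧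
      ‖K x y‖ ≤ C * (|x.1 - y.1| ^ (-1 - θ₂) * |x.2 - y.2| ^ (θ₂ - 1)) := by
  obtain ⟨C, hC⟩ := hK
  have hC0 : 0 ≤ C := nonneg_of_size_estimate (hC 0 1 (by norm_num) (by norm_num)).1
  refine ⟨C, hC0, fun x y h1 h2 => ?_⟩
  have hu : 0 < |x.1 - y.1| := abs_pos.2 (sub_ne_zero.2 h1)
  have hv : 0 < |x.2 - y.2| := abs_pos.2 (sub_ne_zero.2 h2)
  have h := (hC x y h1 h2).1
  rw [czxDecay] at h
  constructor
  · calc _ ≤ _ := h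
      _ ≤ C * (1 / |x.1 - y.1|) * (1 / |x.2 - y.2|) * (|x.1 - y.1| ^ θ₂ * |x.2 - y.2| ^ (-θ₂)) := by
        gcongr; exact add_div_rpow_neg_le hu hv hθ₂.le
      _ = _ := by
        rw [Real.rpow_sub_one hu.ne', show -1 - θ₂ = -θ₂ - 1 by ring, Real.rpow_sub_one hv.ne']
        ring
  · calc _ ≤ _ := h
      _ ≤ C * (1 / |x.1 - y.1|) * (1 / |x.2 - y.2|) * (|x.2 - y.2| ^ θ₂ * |x.1 - y.1| ^ (-θ₂)) := by
        gcongr; exact add_div_rpow_neg_le' hu hv hθ₂.le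
      _ = _ := by
        rw [Real.rpow_sub_one hv.ne', show -1 - θ₂ = -θ₂ - 1 by ring, Real.rpow_sub_one hu.ne']
        ring

theorem ae_prod_ne (x : ℝ × ℝ) : ∀ᵐ y : ℝ × ℝ, x.1 ≠ y.1 ∧ x.2 ≠ y.2 := by
  rw [Measure.volume_eq_prod]
  have h1 : ∀ᵐ y : ℝ × ℝ ∂(volume.prod volume), x.1 ≠ y.1 :=
    Measure.quasiMeasurePreserving_fst.ae ((ae_ne_of_null x.1).mono fun _ h => h.symm)
  have h2 : ∀ᵐ y : ℝ × ℝ ∂(volume.prod volume), x.2 ≠ y.2 :=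
    Measure.quasiMeasurePreserving_snd.ae ((ae_ne_of_null x.2).mono fun _ h => h.symm)
  exact h1.and h2

/-- The set where the size estimate and the Hölder estimates are assumed. -/
def offAxes : Set ((ℝ × ℝ) × (ℝ × ℝ)) := {z | z.1.1 ≠ z.2.1 ∧ z.1.2 ≠ z.2.2}

theorem isOpen_offAxes : IsOpen offAxes :=
  (isOpen_ne_fun (by fun_prop) (by fun_prop)).inter (isOpen_ne_fun (by fun_prop) (by fun_prop))

theorem ae_mem_offAxes : ∀ᵐ z : (ℝ × ℝ) × (ℝ × ℝ), z ∈ offAxes := by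
  rw [Measure.volume_eq_prod, Measure.ae_prod_iff_ae_ae]
  · exact Eventually.of_forall ae_prod_ne
  · exact isOpen_offAxes.measurableSet

theorem tendsto_holder_bound {α : Type*} {l : Filter α} {C θ₁ θ₂ q₀ s₀ : ℝ} {p q s : α → ℝ}
    (hθ₁ : 0 < θ₁) (hq₀ : q₀ ≠ 0) (hs₀ : s₀ ≠ 0) (hp : Tendsto p l (𝓝 0)) (hq : Tendsto q l (𝓝 q₀))
    (hs : Tendsto s l (𝓝 s₀)) :
    Tendsto (fun z => C * (|p z| ^ θ₁ / |q z| ^ (1 + θ₁)) * (1 / |s z|) *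
      (|q z| / |s z| + |s z| / |q z|) ^ (-θ₂)) l (𝓝 0) := by
  have hq' : 0 < |q₀| := abs_pos.2 hq₀
  have hs' : 0 < |s₀| := abs_pos.2 hs₀
  have h1 : Tendsto (fun z => |p z| ^ θ₁) l (𝓝 (|(0 : ℝ)| ^ θ₁)) :=
    hp.abs.rpow_const (Or.inr hθ₁.le)
  have h2 : Tendsto (fun z => |q z| ^ (1 + θ₁)) l (𝓝 (|q₀| ^ (1 + θ₁))) :=
    hq.abs.rpow_const (Or.inl hq'.ne')
  have h3 : Tendsto (fun z => (|q z| / |s z| + |s z| / |q z|) ^ (-θ₂)) l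
      (𝓝 ((|q₀| / |s₀| + |s₀| / |q₀|) ^ (-θ₂))) :=
    ((hq.abs.div hs.abs hs'.ne').add (hs.abs.div hq.abs hq'.ne')).rpow_const
      (Or.inl (by positivity))
  have h := (((h1.div h2 (by positivity)).const_mul C).mul
    (tendsto_const_nhds (x := (1 : ℝ)) |>.div hs.abs hs'.ne')).mul h3
  simpa [Real.zero_rpow hθ₁.ne'] using h

/-- No measurability of the kernel is assumed, and this is its source. Changing the four coordinates
one at a time, each increment is bounded by a Hölder estimate that tends to 0 as long as both
coordinate gaps stay away from 0. The exceptional set is null. -/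
theorem IsCZXKernel.continuousOn {θ₁ θ₂ : ℝ} {K : ℝ × ℝ → ℝ × ℝ → ℂ}
    (hK : IsCZXKernel θ₁ θ₂ K) (hθ₁ : 0 < θ₁) :
    ContinuousOn (Function.uncurry K) offAxes := by
  obtain ⟨C, hC⟩ := hK
  rintro ⟨x₀, y₀⟩ ⟨h1, h2⟩
  refine ContinuousAt.continuousWithinAt ?_
  dsimp only at h1 h2
  set l : Filter ((ℝ × ℝ) × (ℝ × ℝ)) := 𝓝 (x₀, y₀) with hl
  have u0 : x₀.1 - y₀.1 ≠ 0 := sub_ne_zero.2 h1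
  have v0 : x₀.2 - y₀.2 ≠ 0 := sub_ne_zero.2 h2
  have tt : ∀ {f : (ℝ × ℝ) × (ℝ × ℝ) → ℝ}, Continuous f → Tendsto f l (𝓝 (f (x₀, y₀))) :=
    fun hf => hf.tendsto _
  have tp : ∀ {f : (ℝ × ℝ) × (ℝ × ℝ) → ℝ}, Continuous f → f (x₀, y₀) = 0 → Tendsto f l (𝓝 0) :=
    fun hf h => by simpa [h] using hf.tendsto (x₀, y₀)
  have ev : ∀ {f g : (ℝ × ℝ) × (ℝ × ℝ) → ℝ}, Continuous f → Continuous g → f (x₀, y₀) = 0 →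
      g (x₀, y₀) ≠ 0 → ∀ᶠ z in l, g z ≠ 0 ∧ |f z| ≤ |g z| / 2 := by
    intro f g hf hg h0 h1
    refine ((tt hg).eventually_ne h1).and ?_
    have h2 : Tendsto (fun z => |f z|) l (𝓝 0) := by simpa [h0] using (tt hf).abs
    have h3 : Tendsto (fun z => |g z| / 2) l (𝓝 (|g (x₀, y₀)| / 2)) := (tt hg).abs.div_const 2
    exact (h2.eventually_lt h3 (by positivity)).mono fun _ h => h.le
  have c1 : Tendsto (fun z : (ℝ × ℝ) × (ℝ × ℝ) => K z.1 z.2 - K (x₀.1, z.1.2) z.2) l (𝓝 0) := by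
    refine squeeze_zero_norm' ?_ (tendsto_holder_bound (C := C) (θ₂ := θ₂) hθ₁ u0 v0
      (tp (f := fun z => z.1.1 - x₀.1) (by fun_prop) (by simp))
      (tt (f := fun z => z.1.1 - z.2.1) (by fun_prop))
      (tt (f := fun z => z.1.2 - z.2.2) (by fun_prop)))
    filter_upwards [ev (f := fun z => z.1.1 - x₀.1) (g := fun z => z.1.1 - z.2.1) (by fun_prop)
      (by fun_prop) (by simp) u0, ev (f := fun z => z.1.2 - x₀.2) (g := fun z => z.1.2 - z.2.2)
      (by fun_prop) (by fun_prop) (by simp) v0] with z hz hz'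
    exact (hC z.1 z.2 (sub_ne_zero.1 hz.1) (sub_ne_zero.1 hz'.1)).2.1 _ hz.2
  have c2 : Tendsto (fun z : (ℝ × ℝ) × (ℝ × ℝ) => K (x₀.1, z.1.2) z.2 - K x₀ z.2) l (𝓝 0) := by
    refine squeeze_zero_norm' ?_ (tendsto_holder_bound (C := C) (θ₂ := θ₂) hθ₁ v0 u0
      (tp (f := fun z => z.1.2 - x₀.2) (by fun_prop) (by simp))
      (tt (f := fun z => z.1.2 - z.2.2) (by fun_prop))
      (tt (f := fun z => x₀.1 - z.2.1) (by fun_prop)))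
    -- With the zero function as first argument, `ev` only records that the first coordinate gap
    -- stays nonzero.
    filter_upwards [ev (f := fun z => 0) (g := fun z => x₀.1 - z.2.1) (by fun_prop)
      (by fun_prop) (by simp) u0, ev (f := fun z => z.1.2 - x₀.2) (g := fun z => z.1.2 - z.2.2)
      (by fun_prop) (by fun_prop) (by simp) v0] with z hz hz'
    refine ((hC (x₀.1, z.1.2) z.2 (sub_ne_zero.1 hz.1) (sub_ne_zero.1 hz'.1)).2.2.1 x₀.2
      hz'.2).trans (le_of_eq ?_)
    rw [czxDecay, add_comm]; dsimp only; ring_nf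
  have c3 : Tendsto (fun z : (ℝ × ℝ) × (ℝ × ℝ) => K x₀ z.2 - K x₀ (y₀.1, z.2.2)) l (𝓝 0) := by
    refine squeeze_zero_norm' ?_ (tendsto_holder_bound (C := C) (θ₂ := θ₂) hθ₁ u0 v0
      (tp (f := fun z => z.2.1 - y₀.1) (by fun_prop) (by simp))
      (tt (f := fun z => x₀.1 - z.2.1) (by fun_prop))
      (tt (f := fun z => x₀.2 - z.2.2) (by fun_prop)))
    filter_upwards [ev (f := fun z => z.2.1 - y₀.1) (g := fun z => x₀.1 - z.2.1) (by fun_prop)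
      (by fun_prop) (by simp) u0, ev (f := fun z => 0) (g := fun z => x₀.2 - z.2.2)
      (by fun_prop) (by fun_prop) (by simp) v0] with z hz hz'
    exact (hC x₀ z.2 (sub_ne_zero.1 hz.1) (sub_ne_zero.1 hz'.1)).2.2.2.1 _ hz.2
  have c4 : Tendsto (fun z : (ℝ × ℝ) × (ℝ × ℝ) => K x₀ (y₀.1, z.2.2) - K x₀ y₀) l (𝓝 0) := by
    refine squeeze_zero_norm' ?_ (tendsto_holder_bound (C := C) (θ₂ := θ₂) hθ₁ v0 u0
      (tp (f := fun z => z.2.2 - y₀.2) (by fun_prop) (by simp))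
      (tt (f := fun z => x₀.2 - z.2.2) (by fun_prop))
      (tt (f := fun z => x₀.1 - y₀.1) (by fun_prop)))
    filter_upwards [ev (f := fun z => z.2.2 - y₀.2) (g := fun z => x₀.2 - z.2.2)
      (by fun_prop) (by fun_prop) (by simp) v0] with z hz'
    refine ((hC x₀ (y₀.1, z.2.2) h1 (sub_ne_zero.1 hz'.1)).2.2.2.2 y₀.2
      hz'.2).trans (le_of_eq ?_)
    rw [czxDecay, add_comm]; dsimp only; ring_nf
  have := ((c1.add c2).add (c3.add c4)).add_const (K x₀ y₀)
  simp only [add_zero, zero_add] at this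
  refine this.congr fun z => ?_
  simp only [Function.uncurry]
  ring

theorem IsCZXKernel.aestronglyMeasurable {θ₁ θ₂ : ℝ} {K : ℝ × ℝ → ℝ × ℝ → ℂ}
    (hK : IsCZXKernel θ₁ θ₂ K) (hθ₁ : 0 < θ₁) :
    AEStronglyMeasurable (Function.uncurry K) volume := by
  have h := (hK.continuousOn hθ₁).aestronglyMeasurable (μ := volume) isOpen_offAxes.measurableSet
  rwa [Measure.restrict_eq_self_of_ae_mem ae_mem_offAxes] at h

theorem IsCZXKernel.aestronglyMeasurable_right {θ₁ θ₂ : ℝ} {K : ℝ × ℝ → ℝ × ℝ → ℂ}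
    (hK : IsCZXKernel θ₁ θ₂ K) (hθ₁ : 0 < θ₁) (x : ℝ × ℝ) :
    AEStronglyMeasurable (K x) volume := by
  have hc : ContinuousOn (K x) {y | (x, y) ∈ offAxes} :=
    (hK.continuousOn hθ₁).comp (f := fun y => (x, y)) (by fun_prop) fun y hy => hy
  have h := hc.aestronglyMeasurable (μ := volume)
    (isOpen_offAxes.preimage (by fun_prop : Continuous fun y => (x, y))).measurableSet
  rwa [Measure.restrict_eq_self_of_ae_mem (s := {y | (x, y) ∈ offAxes}) (ae_prod_ne x)] at h

/-! ### Integrals over strips and far regions, and the Hörmander condition. -/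

/-- The integral of the size bound over a strip where the second variable is far. -/
theorem lintegral_size_far_snd {θ L M : ℝ} (hθ : 0 < θ) (hL : 0 ≤ L) (hM : 0 < M) (x : ℝ × ℝ) :
    ∫⁻ y in {y : ℝ × ℝ | |x.1 - y.1| ≤ L ∧ M ≤ |x.2 - y.2|},
      ENNReal.ofReal (|x.1 - y.1| ^ (θ - 1) * |x.2 - y.2| ^ (-1 - θ)) ≤
      ENNReal.ofReal ((2 * L ^ θ / θ) * (2 * M ^ (-θ) / θ)) := by
  have e : {y : ℝ × ℝ | |x.1 - y.1| ≤ L ∧ M ≤ |x.2 - y.2|} =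
    {s | |x.1 - s| ≤ L} ×ˢ {t | M ≤ |x.2 - t|} := rfl
  rw [e, Measure.volume_eq_prod, ← Measure.prod_restrict]
  refine (lintegral_prod_le _).trans (le_of_eq ?_)
  have h1 : ∀ s t : ℝ, ENNReal.ofReal (|x.1 - s| ^ (θ - 1) * |x.2 - t| ^ (-1 - θ)) =
    ENNReal.ofReal (|x.1 - s| ^ (θ - 1)) * ENNReal.ofReal (|x.2 - t| ^ (-1 - θ)) :=
    fun s t => ENNReal.ofReal_mul (by positivity)
  simp only [h1]
  simp_rw [lintegral_const_mul' _ _ ENNReal.ofReal_ne_top, lintegral_abs_sub_rpow_far hθ hM]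
  rw [lintegral_mul_const' _ _ ENNReal.ofReal_ne_top, lintegral_abs_sub_rpow_near hθ hL,
    ← ENNReal.ofReal_mul (by positivity)]

theorem lintegral_size_far_fst {θ L M : ℝ} (hθ : 0 < θ) (hL : 0 < L) (hM : 0 ≤ M) (x : ℝ × ℝ) :
    ∫⁻ y in {y : ℝ × ℝ | L ≤ |x.1 - y.1| ∧ |x.2 - y.2| ≤ M},
      ENNReal.ofReal (|x.1 - y.1| ^ (-1 - θ) * |x.2 - y.2| ^ (θ - 1)) ≤
      ENNReal.ofReal ((2 * L ^ (-θ) / θ) * (2 * M ^ θ / θ)) := by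
  have e : {y : ℝ × ℝ | L ≤ |x.1 - y.1| ∧ |x.2 - y.2| ≤ M} =
    {s | L ≤ |x.1 - s|} ×ˢ {t | |x.2 - t| ≤ M} := rfl
  rw [e, Measure.volume_eq_prod, ← Measure.prod_restrict]
  refine (lintegral_prod_le _).trans (le_of_eq ?_)
  have h1 : ∀ s t : ℝ, ENNReal.ofReal (|x.1 - s| ^ (-1 - θ) * |x.2 - t| ^ (θ - 1)) =
    ENNReal.ofReal (|x.1 - s| ^ (-1 - θ)) * ENNReal.ofReal (|x.2 - t| ^ (θ - 1)) :=
    fun s t => ENNReal.ofReal_mul (by positivity)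
  simp only [h1]
  simp_rw [lintegral_const_mul' _ _ ENNReal.ofReal_ne_top, lintegral_abs_sub_rpow_near hθ hM]
  rw [lintegral_mul_const' _ _ ENNReal.ofReal_ne_top, lintegral_abs_sub_rpow_far hθ hL,
    ← ENNReal.ofReal_mul (by positivity)]

/-- The integral of the right-hand side of a Hölder estimate in the first variable over the region
where the first variable is far. -/
theorem lintegral_holder_far_fst {θ₁ θ₂ L : ℝ} (hθ₁ : 0 < θ₁) (hθ₂ : 0 < θ₂) (hL : 0 < L)
    (x : ℝ × ℝ) :
    ∫⁻ y in {y : ℝ × ℝ | L ≤ |x.1 - y.1|}, ENNReal.ofReal (|x.1 - y.1| ^ (-1 - θ₁) *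
      ((1 / |x.2 - y.2|) * (|x.1 - y.1| / |x.2 - y.2| + |x.2 - y.2| / |x.1 - y.1|) ^ (-θ₂))) ≤
      ENNReal.ofReal ((2 * L ^ (-θ₁) / θ₁) * (4 / θ₂)) := by
  have e : {y : ℝ × ℝ | L ≤ |x.1 - y.1|} = {s | L ≤ |x.1 - s|} ×ˢ Set.univ := by
    ext; simp
  rw [e, Measure.volume_eq_prod, ← Measure.prod_restrict, Measure.restrict_univ]
  refine (lintegral_prod_le _).trans ?_
  have hS : MeasurableSet {s | L ≤ |x.1 - s|} := measurableSet_le (by fun_prop) (by fun_prop)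
  calc _ ≤ ∫⁻ s in {s | L ≤ |x.1 - s|},
        ENNReal.ofReal (|x.1 - s| ^ (-1 - θ₁)) * ENNReal.ofReal (4 / θ₂) := by
        refine setLIntegral_mono_ae' hS (Eventually.of_forall fun s hs => ?_)
        have hs' : 0 < |x.1 - s| := hL.trans_le hs
        have h1 : ∀ t : ℝ, ENNReal.ofReal (|x.1 - s| ^ (-1 - θ₁) *
          ((1 / |x.2 - t|) * (|x.1 - s| / |x.2 - t| + |x.2 - t| / |x.1 - s|) ^ (-θ₂))) =
          ENNReal.ofReal (|x.1 - s| ^ (-1 - θ₁)) * ENNReal.ofReal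
          ((1 / |x.2 - t|) * (|x.1 - s| / |x.2 - t| + |x.2 - t| / |x.1 - s|) ^ (-θ₂)) :=
          fun t => ENNReal.ofReal_mul (by positivity)
        simp only [h1]
        rw [lintegral_const_mul' _ _ ENNReal.ofReal_ne_top]
        gcongr
        exact lintegral_decay_le hθ₂ hs' x.2
    _ = _ := by
        rw [lintegral_mul_const' _ _ ENNReal.ofReal_ne_top, lintegral_abs_sub_rpow_far hθ₁ hL,
          ← ENNReal.ofReal_mul (by positivity)]

theorem lintegral_holder_far_snd {θ₁ θ₂ L : ℝ} (hθ₁ : 0 < θ₁) (hθ₂ : 0 < θ₂) (hL : 0 < L)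
    (x : ℝ × ℝ) :
    ∫⁻ y in {y : ℝ × ℝ | L ≤ |x.2 - y.2|}, ENNReal.ofReal (|x.2 - y.2| ^ (-1 - θ₁) *
      ((1 / |x.1 - y.1|) * (|x.1 - y.1| / |x.2 - y.2| + |x.2 - y.2| / |x.1 - y.1|) ^ (-θ₂))) ≤
      ENNReal.ofReal ((2 * L ^ (-θ₁) / θ₁) * (4 / θ₂)) := by
  have h := lintegral_holder_far_fst hθ₁ hθ₂ hL x.swap
  have hm : MeasurePreserving (Prod.swap : ℝ × ℝ → ℝ × ℝ) volume volume :=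
    Measure.measurePreserving_swap
  rw [← hm.setLIntegral_comp_preimage_emb MeasurableEquiv.prodComm.measurableEmbedding] at h
  refine le_trans (le_of_eq ?_) h
  refine lintegral_congr fun y => ?_
  simp only [Prod.fst_swap, Prod.snd_swap]
  rw [add_comm (|x.1 - y.1| / |x.2 - y.2|)]

theorem abs_sub_le_of_mem_cube {c x : ℝ × ℝ} {r : ℝ} (hx : x ∈ cube c r) :
    |x.1 - c.1| ≤ r ∧ |x.2 - c.2| ≤ r := by
  obtain ⟨⟨h1, h2⟩, h3, h4⟩ := hx
  exact ⟨abs_le.2 ⟨by linarith, by linarith⟩, abs_le.2 ⟨by linarith, by linarith⟩⟩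

theorem pos_of_mem_cube {c x : ℝ × ℝ} {r : ℝ} (hx : x ∈ cube c r) : 0 < r := by
  obtain ⟨⟨h1, h2⟩, -⟩ := hx
  linarith

theorem le_abs_sub_of_notMem_cube {c y : ℝ × ℝ} {r : ℝ} (hy : y ∉ cube c r) :
    r ≤ |c.1 - y.1| ∨ r ≤ |c.2 - y.2| := by
  by_contra! h
  obtain ⟨h1, h2⟩ := h
  rw [abs_lt] at h1 h2
  exact hy ⟨⟨by linarith, by linarith⟩, by linarith, by linarith⟩

/-- The split dictates the method: Hölder estimates where both coordinates are far, the size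
estimate alone where only one is. -/
theorem compl_cube_subset {c : ℝ × ℝ} {r : ℝ} : (cube c r)ᶜ ⊆
    {y | r ≤ |c.1 - y.1| ∧ r ≤ |c.2 - y.2|} ∪ ({y | |c.1 - y.1| ≤ r ∧ r ≤ |c.2 - y.2|} ∪
      {y | r ≤ |c.1 - y.1| ∧ |c.2 - y.2| ≤ r}) := by
  intro y hy
  have h := le_abs_sub_of_notMem_cube hy
  simp only [Set.mem_union, Set.mem_ofPred_eq]
  grind

theorem enorm_le_ofReal {z : ℂ} {a : ℝ} (h : ‖z‖ ≤ a) : ‖z‖ₑ ≤ ENNReal.ofReal a := by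
  rw [← ofReal_norm]; exact ENNReal.ofReal_le_ofReal h

/-- On the two strips the near coordinate contributes a multiple of (4r)^θ₂ and the far one a
multiple of (2r)^(-θ₂), so the product does not depend on r. Without decay both factors would
diverge. -/
theorem IsCZXKernel.exists_size_integral_le {θ₁ θ₂ : ℝ} {K : ℝ × ℝ → ℝ × ℝ → ℂ}
    (hK : IsCZXKernel θ₁ θ₂ K) (hθ₂ : 0 < θ₂) :
    ∃ C : ℝ≥0, ∀ (c : ℝ × ℝ) (r : ℝ), ∀ x ∈ cube c r,
      ∫⁻ y in {y | |c.1 - y.1| ≤ 3 * r ∧ 3 * r ≤ |c.2 - y.2|} ∪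
        {y | 3 * r ≤ |c.1 - y.1| ∧ |c.2 - y.2| ≤ 3 * r}, ‖K x y‖ₑ ≤ C := by
  obtain ⟨C, hC0, hC⟩ := hK.exists_size_le hθ₂
  set M : ℝ := C * (4 * 2 ^ θ₂ / θ₂ ^ 2)
  refine ⟨(M + M).toNNReal, fun c r x hx => ?_⟩
  have hr := pos_of_mem_cube hx
  obtain ⟨hx1, hx2⟩ := abs_sub_le_of_mem_cube hx
  rw [abs_le] at hx1 hx2
  have hs : (4 * r) ^ θ₂ * (2 * r) ^ (-θ₂) = 2 ^ θ₂ := by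
    rw [Real.rpow_neg (by positivity), ← div_eq_mul_inv, ← Real.div_rpow (by positivity)
      (by positivity)]
    congr 1; field_simp; norm_num
  have near : ∀ {a b t : ℝ}, -r ≤ a - b → a - b ≤ r → |b - t| ≤ 3 * r → |a - t| ≤ 4 * r := by
    intro a b t h1 h2 h3
    rw [abs_le] at h3 ⊢
    constructor <;> linarith
  have far : ∀ {a b t : ℝ}, -r ≤ a - b → a - b ≤ r → 3 * r ≤ |b - t| → 2 * r ≤ |a - t| := by
    intro a b t h1 h2 h3
    rw [le_abs] at h3 ⊢
    rcases h3 with h3 | h3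
    · left; linarith
    · right; linarith
  have h1 : ∫⁻ y in {y | |c.1 - y.1| ≤ 3 * r ∧ 3 * r ≤ |c.2 - y.2|}, ‖K x y‖ₑ ≤
      ENNReal.ofReal M := by
    calc _ ≤ ∫⁻ y in {y : ℝ × ℝ | |x.1 - y.1| ≤ 4 * r ∧ 2 * r ≤ |x.2 - y.2|}, ‖K x y‖ₑ :=
          lintegral_mono_set fun y hy => ⟨near hx1.1 hx1.2 hy.1, far hx2.1 hx2.2 hy.2⟩
      _ ≤ ∫⁻ y in {y : ℝ × ℝ | |x.1 - y.1| ≤ 4 * r ∧ 2 * r ≤ |x.2 - y.2|}, ENNReal.ofReal C *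
          ENNReal.ofReal (|x.1 - y.1| ^ (θ₂ - 1) * |x.2 - y.2| ^ (-1 - θ₂)) := by
          refine lintegral_mono_ae (ae_restrict_of_ae ?_)
          filter_upwards [ae_prod_ne x] with y hy
          rw [← ENNReal.ofReal_mul hC0]
          exact enorm_le_ofReal (hC x y hy.1 hy.2).1
      _ ≤ _ := by
          rw [lintegral_const_mul' _ _ ENNReal.ofReal_ne_top]
          grw [lintegral_size_far_snd hθ₂ (by positivity) (by positivity) x]
          rw [← ENNReal.ofReal_mul hC0]
          refine ENNReal.ofReal_le_ofReal (le_of_eq ?_)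
          simp only [M]
          rw [← hs]; field_simp; norm_num
  have h2 : ∫⁻ y in {y | 3 * r ≤ |c.1 - y.1| ∧ |c.2 - y.2| ≤ 3 * r}, ‖K x y‖ₑ ≤
      ENNReal.ofReal M := by
    calc _ ≤ ∫⁻ y in {y : ℝ × ℝ | 2 * r ≤ |x.1 - y.1| ∧ |x.2 - y.2| ≤ 4 * r}, ‖K x y‖ₑ :=
          lintegral_mono_set fun y hy => ⟨far hx1.1 hx1.2 hy.1, near hx2.1 hx2.2 hy.2⟩
      _ ≤ ∫⁻ y in {y : ℝ × ℝ | 2 * r ≤ |x.1 - y.1| ∧ |x.2 - y.2| ≤ 4 * r}, ENNReal.ofReal C *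
          ENNReal.ofReal (|x.1 - y.1| ^ (-1 - θ₂) * |x.2 - y.2| ^ (θ₂ - 1)) := by
          refine lintegral_mono_ae (ae_restrict_of_ae ?_)
          filter_upwards [ae_prod_ne x] with y hy
          rw [← ENNReal.ofReal_mul hC0]
          exact enorm_le_ofReal (hC x y hy.1 hy.2).2
      _ ≤ _ := by
          rw [lintegral_const_mul' _ _ ENNReal.ofReal_ne_top]
          grw [lintegral_size_far_fst hθ₂ (by positivity) (by positivity) x]
          rw [← ENNReal.ofReal_mul hC0]
          refine ENNReal.ofReal_le_ofReal (le_of_eq ?_)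
          simp only [M]
          rw [← hs]; field_simp; norm_num
  refine (lintegral_union_le _ _ _).trans ((add_le_add h1 h2).trans ?_)
  rw [← ENNReal.ofReal_add (by positivity) (by positivity)]
  rfl

/-- In either coordinate, y is at distance at least 2r from x while x moves by at most r, which is
exactly what the Hölder estimates allow. Integrating the decay factor over one coordinate costs a
constant, and the other coordinate returns (2r)^(-θ₁), which absorbs the Hölder gain r^θ₁. -/
theorem IsCZXKernel.exists_holder_integral_le {θ₁ θ₂ : ℝ} {K : ℝ × ℝ → ℝ × ℝ → ℂ}
    (hK : IsCZXKernel θ₁ θ₂ K) (hθ₁ : 0 < θ₁) (hθ₂ : 0 < θ₂) :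
    ∃ C : ℝ≥0, ∀ (c : ℝ × ℝ) (r : ℝ), ∀ x ∈ cube c r,
      ∫⁻ y in {y | 3 * r ≤ |c.1 - y.1| ∧ 3 * r ≤ |c.2 - y.2|}, ‖K x y - K c y‖ₑ ≤ C := by
  obtain ⟨C, hC⟩ := hK
  have hC0 : 0 ≤ C := nonneg_of_size_estimate (hC 0 1 (by norm_num) (by norm_num)).1
  set M : ℝ := C * (2 * 2 ^ (-θ₁) / θ₁ * (4 / θ₂))
  refine ⟨(M + M).toNNReal, fun c r x hx => ?_⟩
  have hr := pos_of_mem_cube hx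
  obtain ⟨hx1, hx2⟩ := abs_sub_le_of_mem_cube hx
  have far : ∀ {a b t : ℝ}, |a - b| ≤ r → 3 * r ≤ |b - t| → 2 * r ≤ |a - t| := by
    intro a b t h1 h3
    rw [abs_le] at h1
    rw [le_abs] at h3 ⊢
    rcases h3 with h3 | h3
    · left; linarith
    · right; linarith
  have hs : r ^ θ₁ * (2 * r) ^ (-θ₁) = 2 ^ (-θ₁) := by
    rw [Real.mul_rpow (by norm_num) hr.le, Real.rpow_neg hr.le]
    field_simp
  -- The intermediate point of the passage from x to c: the first coordinate changes first, then the
  -- second.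
  set z : ℝ × ℝ := (c.1, x.2) with hz
  set F : ℝ × ℝ → ℝ × ℝ → ℝ := fun x y => |x.1 - y.1| ^ (-1 - θ₁) *
      ((1 / |x.2 - y.2|) * (|x.1 - y.1| / |x.2 - y.2| + |x.2 - y.2| / |x.1 - y.1|) ^ (-θ₂))
  set G : ℝ × ℝ → ℝ × ℝ → ℝ := fun x y => |x.2 - y.2| ^ (-1 - θ₁) *
      ((1 / |x.1 - y.1|) * (|x.1 - y.1| / |x.2 - y.2| + |x.2 - y.2| / |x.1 - y.1|) ^ (-θ₂))
  have hF : Measurable fun y => ENNReal.ofReal (F x y) := by fun_prop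
  have key : ∀ᵐ y : ℝ × ℝ, 3 * r ≤ |c.1 - y.1| ∧ 3 * r ≤ |c.2 - y.2| → ‖K x y - K c y‖ₑ ≤
      ENNReal.ofReal (C * r ^ θ₁) * (ENNReal.ofReal (F x y) + ENNReal.ofReal (G z y)) := by
    filter_upwards [ae_prod_ne x, ae_prod_ne c] with y hxy hcy hy
    have f1 := far hx1 hy.1
    have f2 := far hx2 hy.2
    have b1 := (hC x y hxy.1 hxy.2).2.1 c.1 (by linarith)
    have b2 := (hC z y hcy.1 hxy.2).2.2.1 c.2 (by dsimp only [z]; linarith)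
    have p1 : 0 < |x.1 - y.1| := by linarith
    have p2 : 0 < |x.2 - y.2| := by linarith
    have p3 : 0 < |c.1 - y.1| := by linarith
    have hrp : ∀ {u : ℝ}, 0 < u → u ^ (-1 - θ₁) = (u ^ (1 + θ₁))⁻¹ := fun hu => by
      rw [← Real.rpow_neg hu.le]; ring_nf
    rw [← ENNReal.ofReal_add (by positivity) (by positivity), ← ENNReal.ofReal_mul (by positivity)]
    refine enorm_le_ofReal ?_
    calc ‖K x y - K c y‖ = ‖(K x y - K z y) + (K z y - K c y)‖ := by ring_nf
      _ ≤ ‖K x y - K z y‖ + ‖K z y - K c y‖ := norm_add_le _ _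
      _ ≤ C * (r ^ θ₁ / |x.1 - y.1| ^ (1 + θ₁)) * (1 / |x.2 - y.2|) * czxDecay θ₂ x y +
          C * (1 / |z.1 - y.1|) * (r ^ θ₁ / |z.2 - y.2| ^ (1 + θ₁)) * czxDecay θ₂ z y := by
          have d1 : 0 ≤ czxDecay θ₂ x y := by unfold czxDecay; positivity
          have d2 : 0 ≤ czxDecay θ₂ z y := by unfold czxDecay; positivity
          refine add_le_add (b1.trans ?_) (b2.trans ?_) <;> gcongr
      _ = _ := by
          simp only [F, G, czxDecay, z, hrp p1, hrp p2]
          ring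
  have hS : MeasurableSet {y : ℝ × ℝ | 3 * r ≤ |c.1 - y.1| ∧ 3 * r ≤ |c.2 - y.2|} :=
    (measurableSet_le (f := fun _ => 3 * r) (g := fun y : ℝ × ℝ => |c.1 - y.1|)
      (by fun_prop) (by fun_prop)).inter
    (measurableSet_le (f := fun _ => 3 * r) (g := fun y : ℝ × ℝ => |c.2 - y.2|)
      (by fun_prop) (by fun_prop))
  refine (setLIntegral_mono_ae' hS key).trans ?_
  rw [lintegral_const_mul' _ _ ENNReal.ofReal_ne_top, lintegral_add_left hF]
  have i1 : ∫⁻ y in {y : ℝ × ℝ | 3 * r ≤ |c.1 - y.1| ∧ 3 * r ≤ |c.2 - y.2|},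
      ENNReal.ofReal (F x y) ≤ ENNReal.ofReal ((2 * (2 * r) ^ (-θ₁) / θ₁) * (4 / θ₂)) :=
    (lintegral_mono_set fun y hy => far hx1 hy.1).trans
      (lintegral_holder_far_fst hθ₁ hθ₂ (by positivity) x)
  have i2 : ∫⁻ y in {y : ℝ × ℝ | 3 * r ≤ |c.1 - y.1| ∧ 3 * r ≤ |c.2 - y.2|},
      ENNReal.ofReal (G z y) ≤ ENNReal.ofReal ((2 * (2 * r) ^ (-θ₁) / θ₁) * (4 / θ₂)) :=
    (lintegral_mono_set fun y hy => far (a := z.2) hx2 hy.2).trans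
      (lintegral_holder_far_snd hθ₁ hθ₂ (by positivity) z)
  grw [i1, i2]
  rw [← ENNReal.ofReal_add (by positivity) (by positivity), ← ENNReal.ofReal_mul (by positivity)]
  refine (ENNReal.ofReal_le_ofReal (le_of_eq ?_)).trans le_rfl
  simp only [M]
  rw [← hs]; ring

theorem IsCZXKernel.exists_hormander {θ₁ θ₂ : ℝ} {K : ℝ × ℝ → ℝ × ℝ → ℂ}
    (hK : IsCZXKernel θ₁ θ₂ K) (hθ₁ : 0 < θ₁) (hθ₂ : 0 < θ₂) :
    ∃ C : ℝ≥0, ∀ (c : ℝ × ℝ) (r : ℝ), ∀ x ∈ cube c r,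
      ∫⁻ y in (cube c (3 * r))ᶜ, ‖K x y - K c y‖ₑ ≤ C := by
  obtain ⟨A, hA⟩ := hK.exists_holder_integral_le hθ₁ hθ₂
  obtain ⟨B, hB⟩ := hK.exists_size_integral_le hθ₂
  refine ⟨A + (B + B), fun c r x hx => ?_⟩
  have hr := pos_of_mem_cube hx
  have hc : c ∈ cube c r := ⟨⟨by linarith, by linarith⟩, by linarith, by linarith⟩
  refine (lintegral_mono_set compl_cube_subset).trans ((lintegral_union_le _ _ _).trans ?_)
  push_cast
  refine add_le_add (hA c r x hx) ?_
  -- On the strips the two kernel values are bounded separately; the size bound applies at c as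
  -- well, since c lies in its own square.
  refine (lintegral_mono fun y => enorm_sub_le).trans ?_
  rw [lintegral_add_left']
  · exact add_le_add (hB c r x hx) (hB c r c hc)
  · exact (hK.aestronglyMeasurable_right hθ₁ x).enorm.restrict

theorem IsCZXKernel.hormanderCondition {θ₁ θ₂ : ℝ} {K : ℝ × ℝ → ℝ × ℝ → ℂ}
    (hK : IsCZXKernel θ₁ θ₂ K) (hθ₁ : 0 < θ₁) (hθ₂ : 0 < θ₂) : HormanderCondition K := by
  obtain ⟨A, hA⟩ := hK.exists_hormander hθ₁ hθ₂
  obtain ⟨B, hB⟩ := hK.swap.exists_hormander hθ₁ hθ₂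
  refine ⟨max A B, fun c r x hx => ⟨(hA c r x hx).trans ?_, (hB c r x hx).trans ?_⟩⟩
  · exact_mod_cast le_max_left A B
  · exact_mod_cast le_max_right A B

/-! ### The transpose, and the kernel formula away from the support. -/

/-- The space `L²(ℝ²)`. -/
abbrev L2Plane : Type := Lp ℂ 2 (volume : Measure (ℝ × ℝ))

theorem norm_star_lp (f : L2Plane) : ‖star f‖ = ‖f‖ := by
  rw [Lp.norm_def, Lp.norm_def]
  congr 1
  refine eLpNorm_congr_norm_ae ?_
  filter_upwards [Lp.coeFn_star f] with x hx
  simp [hx]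

/-- The map g ↦ conj(T*(conj g)) is linear, being antilinear twice over. The bilinear pairing is
used instead of the inner product so that transposing swaps the kernel variables without conjugating
the kernel. -/
theorem exists_transpose (T : L2Plane →L[ℂ] L2Plane) :
    ∃ T' : L2Plane →L[ℂ] L2Plane, ∀ f g : L2Plane, ∫ x, T f x * g x = ∫ x, f x * T' g x := by
  have hadd : ∀ f g : L2Plane, star (f + g) = star f + star g := fun f g => by
    refine Lp.ext ?_
    filter_upwards [Lp.coeFn_star (f + g), Lp.coeFn_star f, Lp.coeFn_star g, Lp.coeFn_add f g,
      Lp.coeFn_add (star f) (star g)] with x h1 h2 h3 h4 h5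
    rw [h1, Pi.star_apply, h4, h5, Pi.add_apply, Pi.add_apply, star_add, h2, h3]
    rfl
  have hsmul : ∀ (a : ℂ) (f : L2Plane), star (a • f) = (starRingEnd ℂ a) • star f := fun a f => by
    refine Lp.ext ?_
    filter_upwards [Lp.coeFn_star (a • f), Lp.coeFn_star f, Lp.coeFn_smul a f,
      Lp.coeFn_smul (starRingEnd ℂ a) (star f)] with x h1 h2 h3 h4
    simp [h1, h2, h3, h4]
  let S : L2Plane →ₗ[ℂ] L2Plane :=
    { toFun := fun g => star (T.adjoint (star g))
      map_add' := fun f g => by rw [hadd, map_add, hadd]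
      map_smul' := fun a f => by rw [hsmul, map_smul, hsmul]; simp }
  refine ⟨S.mkContinuous ‖T.adjoint‖ fun g => ?_, fun f g => ?_⟩
  · change ‖star (T.adjoint (star g))‖ ≤ _
    rw [norm_star_lp, ← norm_star_lp g]
    exact T.adjoint.le_opNorm _
  · have h := T.adjoint_inner_left f (star g)
    rw [L2.inner_def, L2.inner_def] at h
    calc _ = ∫ x, inner ℂ ((star g : L2Plane) x) (T f x) := by
          refine integral_congr_ae ?_
          filter_upwards [Lp.coeFn_star g] with x hx
          simp [hx]
      _ = ∫ x, inner ℂ (T.adjoint (star g) x) (f x) := h.symm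
      _ = _ := by
          refine integral_congr_ae ?_
          filter_upwards [Lp.coeFn_star (T.adjoint (star g))] with x hx
          change _ = f x * (star (T.adjoint (star g)) : L2Plane) x
          simp [hx]

theorem cube_ae_eq_closedBall (c : ℝ × ℝ) (r : ℝ) :
    cube c r =ᵐ[volume] Metric.closedBall c r := by
  rw [← closedBall_prod_same, Real.closedBall_eq_Icc, Real.closedBall_eq_Icc, cube]
  exact Measure.set_prod_ae_eq Ico_ae_eq_Icc Ico_ae_eq_Icc

theorem ball_ae_eq_closedBall (c : ℝ × ℝ) (r : ℝ) :
    Metric.ball c r =ᵐ[volume] Metric.closedBall c r := by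
  rw [← closedBall_prod_same, ← ball_prod_same, Real.closedBall_eq_Icc, Real.closedBall_eq_Icc,
    Real.ball_eq_Ioo, Real.ball_eq_Ioo]
  exact Measure.set_prod_ae_eq Ioo_ae_eq_Icc Ioo_ae_eq_Icc

theorem ball_subset_cube (c : ℝ × ℝ) (r : ℝ) : Metric.ball c r ⊆ cube c r := by
  rw [← ball_prod_same, Real.ball_eq_Ioo, Real.ball_eq_Ioo]
  exact Set.prod_mono Set.Ioo_subset_Ico_self Set.Ioo_subset_Ico_self

theorem cube_subset_closedBall (c : ℝ × ℝ) (r : ℝ) : cube c r ⊆ Metric.closedBall c r := by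
  rw [← closedBall_prod_same, Real.closedBall_eq_Icc, Real.closedBall_eq_Icc]
  exact Set.prod_mono Set.Ico_subset_Icc_self Set.Ico_subset_Icc_self

/-- A function whose integral over every square inside an open set vanishes is zero there. -/
theorem ae_eq_zero_of_integral_cube_eq_zero {U : Set (ℝ × ℝ)} (hU : IsOpen U) {h : ℝ × ℝ → ℂ}
    (hi : IntegrableOn h U) (h0 : ∀ c r, 0 < r → cube c r ⊆ U → ∫ x in cube c r, h x = 0) :
    ∀ᵐ x, x ∈ U → h x = 0 := by
  have hi' : Integrable (U.indicator h) := hi.integrable_indicator hU.measurableSet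
  -- Lebesgue differentiation with the sup metric of `ℝ × ℝ`, whose balls are squares up to null
  -- sets.
  filter_upwards [IsUnifLocDoublingMeasure.ae_tendsto_average volume hi'.locallyIntegrable 1]
    with x hx hxU
  obtain ⟨ε, hε, hεU⟩ := Metric.isOpen_iff.1 hU x hxU
  have hδ : Tendsto (fun n : ℕ => 1 / ((n : ℝ) + 1)) atTop (𝓝[>] 0) :=
    tendsto_nhdsWithin_iff.2 ⟨tendsto_one_div_add_atTop_nhds_zero_nat,
      Eventually.of_forall fun n => Set.mem_Ioi.2 (by positivity)⟩
  have h1 := hx (fun _ : ℕ => x) (fun n : ℕ => 1 / ((n : ℝ) + 1)) hδ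
    (Eventually.of_forall fun n => Metric.mem_closedBall_self (by positivity))
  rw [Set.indicator_of_mem hxU] at h1
  refine tendsto_nhds_unique h1 ?_
  refine tendsto_const_nhds.congr' ?_
  filter_upwards [tendsto_one_div_add_atTop_nhds_zero_nat.eventually (gt_mem_nhds hε)] with n hn
  have hsub : cube x (1 / ((n : ℝ) + 1)) ⊆ U := fun y hy =>
    hεU (lt_of_le_of_lt (cube_subset_closedBall _ _ hy) hn)
  rw [setAverage_eq, ← setIntegral_congr_set (cube_ae_eq_closedBall _ _)]
  have : ∫ y in cube x (1 / ((n : ℝ) + 1)), U.indicator h y = 0 := by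
    rw [← h0 x (1 / ((n : ℝ) + 1)) (by positivity) hsub]
    exact setIntegral_congr_fun (measurableSet_cube _ _) fun y hy =>
      Set.indicator_of_mem (hsub hy) _
  rw [this, smul_zero]

/-- If the sup distance is at least δ, one coordinate gap is at least δ and the other is bounded, so
the separated strip bounds apply. This compensates for the kernel being unbounded near the
coordinate lines even at positive distance from x. -/
theorem IsCZXKernel.exists_lintegral_le_of_separated {θ₁ θ₂ : ℝ} {K : ℝ × ℝ → ℝ × ℝ → ℂ}
    (hK : IsCZXKernel θ₁ θ₂ K) (hθ₂ : 0 < θ₂) {δ : ℝ} (hδ : 0 < δ) (L : ℝ) :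
    ∃ M : ℝ≥0, ∀ (x : ℝ × ℝ) (A : Set (ℝ × ℝ)), (∀ y ∈ A, δ ≤ dist x y ∧ dist x y ≤ L) →
      ∫⁻ y in A, ‖K x y‖ₑ ≤ M := by
  obtain ⟨C, hC0, hC⟩ := hK.exists_size_le hθ₂
  -- Nothing prevents L from being negative, while the strip lemmas need a nonnegative width.
  set L' := max L 0
  have hL' : 0 ≤ L' := le_max_right _ _
  set N : ℝ := (2 * L' ^ θ₂ / θ₂) * (2 * δ ^ (-θ₂) / θ₂)
  refine ⟨(C * N + C * N).toNNReal, fun x A hA => ?_⟩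
  have hsub : A ⊆ {y : ℝ × ℝ | |x.1 - y.1| ≤ L' ∧ δ ≤ |x.2 - y.2|} ∪
      {y : ℝ × ℝ | δ ≤ |x.1 - y.1| ∧ |x.2 - y.2| ≤ L'} := by
    intro y hy
    obtain ⟨h1, h2⟩ := hA y hy
    rw [Prod.dist_eq, Real.dist_eq, Real.dist_eq] at h1 h2
    rw [max_le_iff] at h2
    have h3 : L ≤ L' := le_max_left _ _
    rcases le_max_iff.1 h1 with h | h
    · exact Or.inr ⟨h, h2.2.trans h3⟩
    · exact Or.inl ⟨h2.1.trans h3, h⟩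
  refine (lintegral_mono_set hsub).trans ((lintegral_union_le _ _ _).trans ?_)
  have h1 : ∫⁻ y in {y : ℝ × ℝ | |x.1 - y.1| ≤ L' ∧ δ ≤ |x.2 - y.2|}, ‖K x y‖ₑ ≤
      ENNReal.ofReal (C * N) := by
    calc _ ≤ ∫⁻ y in {y : ℝ × ℝ | |x.1 - y.1| ≤ L' ∧ δ ≤ |x.2 - y.2|}, ENNReal.ofReal C *
          ENNReal.ofReal (|x.1 - y.1| ^ (θ₂ - 1) * |x.2 - y.2| ^ (-1 - θ₂)) := by
          refine lintegral_mono_ae (ae_restrict_of_ae ?_)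
          filter_upwards [ae_prod_ne x] with y hy
          rw [← ENNReal.ofReal_mul hC0]
          exact enorm_le_ofReal (hC x y hy.1 hy.2).1
      _ ≤ _ := by
          rw [lintegral_const_mul' _ _ ENNReal.ofReal_ne_top]
          grw [lintegral_size_far_snd hθ₂ hL' hδ x]
          rw [← ENNReal.ofReal_mul hC0]
  have h2 : ∫⁻ y in {y : ℝ × ℝ | δ ≤ |x.1 - y.1| ∧ |x.2 - y.2| ≤ L'}, ‖K x y‖ₑ ≤
      ENNReal.ofReal (C * N) := by
    calc _ ≤ ∫⁻ y in {y : ℝ × ℝ | δ ≤ |x.1 - y.1| ∧ |x.2 - y.2| ≤ L'}, ENNReal.ofReal C *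
          ENNReal.ofReal (|x.1 - y.1| ^ (-1 - θ₂) * |x.2 - y.2| ^ (θ₂ - 1)) := by
          refine lintegral_mono_ae (ae_restrict_of_ae ?_)
          filter_upwards [ae_prod_ne x] with y hy
          rw [← ENNReal.ofReal_mul hC0]
          exact enorm_le_ofReal (hC x y hy.1 hy.2).2
      _ ≤ _ := by
          rw [lintegral_const_mul' _ _ ENNReal.ofReal_ne_top]
          grw [lintegral_size_far_fst hθ₂ hδ hL' x]
          rw [← ENNReal.ofReal_mul hC0, mul_comm (2 * δ ^ (-θ₂) / θ₂)]
  refine (add_le_add h1 h2).trans ?_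
  rw [← ENNReal.ofReal_add (by positivity) (by positivity)]
  rfl

theorem IsAssociatedKernel.transpose {K : ℝ × ℝ → ℝ × ℝ → ℂ} {T T' : L2Plane →L[ℂ] L2Plane}
    (hT : IsAssociatedKernel T K) (hTT : ∀ f g : L2Plane, ∫ x, T f x * g x = ∫ x, f x * T' g x) :
    IsAssociatedKernel T' fun x y => K y x := by
  intro f g hf hg hfg
  have h := hT g f hg hf (by rw [Set.inter_comm]; exact hfg)
  have e1 : ∫ x, T' ((memLp_of_mem_cubeStep hf 2).toLp f) x * g x =
      ∫ x, T ((memLp_of_mem_cubeStep hg 2).toLp g) x * f x := by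
    calc _ = ∫ x, ((memLp_of_mem_cubeStep hg 2).toLp g) x *
          T' ((memLp_of_mem_cubeStep hf 2).toLp f) x := by
          refine integral_congr_ae ?_
          filter_upwards [(memLp_of_mem_cubeStep hg 2).coeFn_toLp] with x hx
          rw [hx, mul_comm]
      _ = ∫ x, T ((memLp_of_mem_cubeStep hg 2).toLp g) x *
          ((memLp_of_mem_cubeStep hf 2).toLp f) x := (hTT _ _).symm
      _ = _ := by
          refine integral_congr_ae ?_
          filter_upwards [(memLp_of_mem_cubeStep hf 2).coeFn_toLp] with x hx
          rw [hx]
  rw [e1, h, Measure.volume_eq_prod, ← integral_prod_swap]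
  refine integral_congr_ae (Eventually.of_forall fun z => ?_)
  simp only [Prod.fst_swap, Prod.snd_swap]
  ring

/-- Integrating first in x needs only the uniform bound for the kernel over U and f in L¹; this
justifies the later uses of Fubini. -/
theorem integrable_kernel_mul_mul {K : ℝ × ℝ → ℝ × ℝ → ℂ}
    (hKm : AEStronglyMeasurable (Function.uncurry K) volume) {A U : Set (ℝ × ℝ)}
    (hUm : MeasurableSet U) {M : ℝ≥0} (hM : ∀ y ∈ A, ∫⁻ x in U, ‖K x y‖ₑ ≤ M)
    {f : ℝ × ℝ → ℂ} (hf : Integrable f) (hfA : ∀ y ∉ A, f y = 0) :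
    Integrable fun z : (ℝ × ℝ) × (ℝ × ℝ) => K z.1 z.2 * f z.2 * U.indicator 1 z.1 := by
  have hm : AEStronglyMeasurable
      (fun z : (ℝ × ℝ) × (ℝ × ℝ) => K z.1 z.2 * f z.2 * U.indicator 1 z.1)
      (volume.prod volume) :=
    (hKm.mul hf.aestronglyMeasurable.comp_snd).mul
      ((aestronglyMeasurable_const.indicator hUm).comp_fst)
  refine ⟨hm, ?_⟩
  rw [HasFiniteIntegral, Measure.volume_eq_prod, lintegral_prod_symm _ hm.enorm]
  calc _ ≤ ∫⁻ y, M * ‖f y‖ₑ := by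
        refine lintegral_mono fun y => ?_
        by_cases hy : y ∈ A
        · calc _ = ∫⁻ x, U.indicator (fun x => ‖K x y‖ₑ) x * ‖f y‖ₑ := by
                refine lintegral_congr fun x => ?_
                by_cases hx : x ∈ U <;> simp [hx, enorm_mul]
            _ = (∫⁻ x in U, ‖K x y‖ₑ) * ‖f y‖ₑ := by
                rw [lintegral_mul_const' _ _ (by simp), lintegral_indicator hUm]
            _ ≤ _ := by gcongr; exact hM y hy
        · simp [hfA y hy]
    _ < ∞ := by
        rw [lintegral_const_mul' _ _ (by simp)]
        exact ENNReal.mul_lt_top (by simp) hf.2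

theorem indicator_cube_mem_cubeStep (c : ℝ × ℝ) (r : ℝ) :
    (cube c r).indicator (fun _ => (1 : ℂ)) ∈ cubeStep :=
  Submodule.subset_span ⟨(c, r), rfl⟩

theorem integral_mul_indicator_cube (h : ℝ × ℝ → ℂ) (c : ℝ × ℝ) (r : ℝ) :
    ∫ x, h x * (cube c r).indicator (fun _ => (1 : ℂ)) x = ∫ x in cube c r, h x := by
  rw [← integral_indicator (measurableSet_cube c r)]
  refine integral_congr_ae (Eventually.of_forall fun x => ?_)
  by_cases hx : x ∈ cube c r <;> simp [hx]

theorem integrable_of_memLp_two {f : ℝ × ℝ → ℂ} (hf : MemLp f 2) {A : Set (ℝ × ℝ)}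
    (hA : MeasurableSet A) (hA' : volume A ≠ ∞) (hfA : ∀ y ∉ A, f y = 0) : Integrable f := by
  have : IsFiniteMeasure (volume.restrict A) := isFiniteMeasure_restrict.2 hA'
  have h1 : IntegrableOn f A := memLp_one_iff_integrable.1 ((hf.restrict A).mono_exponent
    (by norm_num))
  have h2 := h1.integrable_indicator hA
  rwa [Set.indicator_eq_self.2 (Function.support_subset_iff'.2 hfA)] at h2

theorem integrableOn_of_memLp_two {f : ℝ × ℝ → ℂ} (hf : MemLp f 2) {A : Set (ℝ × ℝ)}
    (hA' : volume A ≠ ∞) : IntegrableOn f A := by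
  have : IsFiniteMeasure (volume.restrict A) := isFiniteMeasure_restrict.2 hA'
  exact memLp_one_iff_integrable.1 ((hf.restrict A).mono_exponent (by norm_num))

/-- For squares inside separated open sets `A` and `U`, the transposed operator applied to the
indicator of a square in `U` is given on `A` by integrating the kernel. -/
theorem transpose_indicator_ae_eq {θ₁ θ₂ : ℝ} {K : ℝ × ℝ → ℝ × ℝ → ℂ}
    (hK : IsCZXKernel θ₁ θ₂ K) (hθ₁ : 0 < θ₁) (hθ₂ : 0 < θ₂) {T T' : L2Plane →L[ℂ] L2Plane}
    (hT : IsAssociatedKernel T K) (hTT : ∀ f g : L2Plane, ∫ x, T f x * g x = ∫ x, f x * T' g x)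
    {A U : Set (ℝ × ℝ)} (hA : IsOpen A) (hA' : volume A ≠ ∞) {δ L : ℝ} (hδ : 0 < δ)
    (hd : ∀ x ∈ U, ∀ y ∈ A, δ ≤ dist x y ∧ dist x y ≤ L) {c : ℝ × ℝ} {r : ℝ}
    (hc : cube c r ⊆ U) :
    ∀ᵐ y, y ∈ A → T' ((memLp_of_mem_cubeStep (indicator_cube_mem_cubeStep c r) 2).toLp _) y =
      ∫ x in cube c r, K x y := by
  obtain ⟨M, hM⟩ := hK.swap.exists_lintegral_le_of_separated hθ₂ hδ L
  have hM' : ∀ y ∈ A, ∫⁻ x in cube c r, ‖K x y‖ₑ ≤ M := fun y hy =>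
    hM y _ fun x hx => by rw [dist_comm]; exact hd x (hc hx) y hy
  have hKm := hK.aestronglyMeasurable hθ₁
  set g := (cube c r).indicator (fun _ => (1 : ℂ)) with hg
  set g2 : L2Plane := (memLp_of_mem_cubeStep (indicator_cube_mem_cubeStep c r) 2).toLp g
  have hint : ∀ B ⊆ A, MeasurableSet B →
      Integrable fun z : (ℝ × ℝ) × (ℝ × ℝ) => K z.1 z.2 * B.indicator 1 z.2 * g z.1 := by
    intro B hB hBm
    refine integrable_kernel_mul_mul (A := A) hKm (measurableSet_cube c r) hM' (f := B.indicator 1)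
      ?_ fun y hy => Set.indicator_of_notMem (fun h => hy (hB h)) _
    exact (integrable_indicator_iff hBm).2 (integrableOn_const (measure_ne_top_of_subset hB hA'))
  have hGB : ∀ (B : Set (ℝ × ℝ)) (y : ℝ × ℝ), ∫ x, K x y * B.indicator 1 y * g x =
      B.indicator (fun y => ∫ x in cube c r, K x y) y := by
    intro B y
    by_cases hy : y ∈ B
    · simp only [hy, Set.indicator_of_mem, Pi.one_apply, mul_one]
      exact integral_mul_indicator_cube _ c r
    · simp [hy]
  have hGi : IntegrableOn (fun y => ∫ x in cube c r, K x y) A := by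
    have h1 := (hint A subset_rfl hA.measurableSet).integral_prod_right
    simp only [hGB] at h1
    exact (integrable_indicator_iff hA.measurableSet).1 h1
  have hTi : IntegrableOn (T' g2) A := integrableOn_of_memLp_two (Lp.memLp _) hA'
  -- Testing the association against a square inside A is legitimate because A and U are separated;
  -- the resulting equality of integrals over all such squares identifies the two functions on A.
  have key := ae_eq_zero_of_integral_cube_eq_zero hA
    (h := fun y => T' g2 y - ∫ x in cube c r, K x y) (hTi.sub hGi) fun c' r' _ hc' => ?_
  · filter_upwards [key] with y hy hyA using sub_eq_zero.1 (hy hyA)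
  rw [integral_sub (hTi.mono_set hc') (hGi.mono_set hc'), sub_eq_zero]
  set q := (cube c' r').indicator (fun _ => (1 : ℂ)) with hq
  have hdisj : {x | q x ≠ 0} ∩ {x | g x ≠ 0} = ∅ := by
    refine Set.eq_empty_of_forall_notMem fun x hx => ?_
    have h1 : x ∈ cube c' r' := by
      by_contra h; exact hx.1 (Set.indicator_of_notMem h _)
    have h2 : x ∈ cube c r := by
      by_contra h; exact hx.2 (Set.indicator_of_notMem h _)
    have := (hd x (hc h2) x (hc' h1)).1
    rw [dist_self] at this
    exact absurd this (not_le.2 hδ)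
  have h := hT q g (indicator_cube_mem_cubeStep c' r') (indicator_cube_mem_cubeStep c r) hdisj
  set q2 : L2Plane := (memLp_of_mem_cubeStep (indicator_cube_mem_cubeStep c' r') 2).toLp q
  have e1 : ∫ x, T q2 x * g x = ∫ x in cube c' r', T' g2 x := by
    calc _ = ∫ x, T q2 x * g2 x := by
          refine integral_congr_ae ?_
          filter_upwards [(memLp_of_mem_cubeStep (indicator_cube_mem_cubeStep c r) 2).coeFn_toLp]
            with x hx
          rw [hx]
      _ = ∫ x, q2 x * T' g2 x := hTT _ _
      _ = ∫ x, T' g2 x * q x := by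
          refine integral_congr_ae ?_
          filter_upwards [(memLp_of_mem_cubeStep (indicator_cube_mem_cubeStep c' r') 2).coeFn_toLp]
            with x hx
          rw [hx, mul_comm]
      _ = _ := integral_mul_indicator_cube _ c' r'
  rw [← e1, h, Measure.volume_eq_prod, integral_prod_symm]
  · rw [← integral_indicator (measurableSet_cube _ _)]
    refine integral_congr_ae (Eventually.of_forall fun y => ?_)
    exact hGB (cube c' r') y
  · exact hint _ hc' (measurableSet_cube _ _)

/-- Away from the support of `f`, the function `T f` is given by integrating the kernel. -/
theorem ae_eq_integral_kernel {θ₁ θ₂ : ℝ} {K : ℝ × ℝ → ℝ × ℝ → ℂ}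
    (hK : IsCZXKernel θ₁ θ₂ K) (hθ₁ : 0 < θ₁) (hθ₂ : 0 < θ₂) {T : L2Plane →L[ℂ] L2Plane}
    (hT : IsAssociatedKernel T K) {A U : Set (ℝ × ℝ)} (hA : IsOpen A) (hA' : volume A ≠ ∞)
    (hU : IsOpen U) (hU' : volume U ≠ ∞) {δ L : ℝ} (hδ : 0 < δ)
    (hd : ∀ x ∈ U, ∀ y ∈ A, δ ≤ dist x y ∧ dist x y ≤ L) {f : ℝ × ℝ → ℂ} (hf : MemLp f 2)
    (hfA : ∀ y ∉ A, f y = 0) :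
    ∀ᵐ x, x ∈ U → Integrable (fun y => K x y * f y) ∧ T (hf.toLp f) x = ∫ y, K x y * f y := by
  obtain ⟨T', hTT⟩ := exists_transpose T
  obtain ⟨M, hM⟩ := hK.swap.exists_lintegral_le_of_separated hθ₂ hδ L
  have hKm := hK.aestronglyMeasurable hθ₁
  have hfi : Integrable f := integrable_of_memLp_two hf hA.measurableSet hA' hfA
  have hint : ∀ B ⊆ U, MeasurableSet B →
      Integrable fun z : (ℝ × ℝ) × (ℝ × ℝ) => K z.1 z.2 * f z.2 * B.indicator 1 z.1 := by
    intro B hB hBm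
    exact integrable_kernel_mul_mul (A := A) hKm hBm
      (fun y hy => hM y _ fun x hx => by rw [dist_comm]; exact hd x (hB hx) y hy) hfi hfA
  have hFB : ∀ (B : Set (ℝ × ℝ)) (x : ℝ × ℝ), ∫ y, K x y * f y * B.indicator 1 x =
      B.indicator (fun x => ∫ y, K x y * f y) x := by
    intro B x
    by_cases hx : x ∈ B <;> simp [hx]
  have hFi : IntegrableOn (fun x => ∫ y, K x y * f y) U := by
    have h1 := (hint U subset_rfl hU.measurableSet).integral_prod_left
    simp only [hFB] at h1
    exact (integrable_indicator_iff hU.measurableSet).1 h1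
  have hTi : IntegrableOn (T (hf.toLp f)) U := integrableOn_of_memLp_two (Lp.memLp _) hU'
  have key := ae_eq_zero_of_integral_cube_eq_zero hU
    (h := fun x => T (hf.toLp f) x - ∫ y, K x y * f y) (hTi.sub hFi) fun c r _ hc => ?_
  · have h2 := (hint U subset_rfl hU.measurableSet).prod_right_ae
    filter_upwards [key, h2] with x hx hx2 hxU
    refine ⟨?_, sub_eq_zero.1 (hx hxU)⟩
    simpa [hxU] using hx2
  rw [integral_sub (hTi.mono_set hc) (hFi.mono_set hc), sub_eq_zero]
  -- The association says nothing about a general L² function f. Moving T onto the indicator of a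
  -- square as T' leaves f untouched, and only the values of T' on A matter since f vanishes
  -- elsewhere.
  have hrep := transpose_indicator_ae_eq hK hθ₁ hθ₂ hT hTT hA hA' hδ hd hc
  set g2 : L2Plane := (memLp_of_mem_cubeStep (indicator_cube_mem_cubeStep c r) 2).toLp _
  calc _ = ∫ x, T (hf.toLp f) x * (cube c r).indicator (fun _ => (1 : ℂ)) x :=
        (integral_mul_indicator_cube _ c r).symm
    _ = ∫ x, T (hf.toLp f) x * g2 x := by
        refine integral_congr_ae ?_
        filter_upwards [(memLp_of_mem_cubeStep (indicator_cube_mem_cubeStep c r) 2).coeFn_toLp]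
          with x hx
        rw [hx]
    _ = ∫ y, hf.toLp f y * T' g2 y := hTT _ _
    _ = ∫ y, ∫ x, K x y * f y * (cube c r).indicator 1 x := by
        refine integral_congr_ae ?_
        filter_upwards [hf.coeFn_toLp, hrep] with y hy1 hy2
        rw [hy1]
        by_cases hy : y ∈ A
        · rw [hy2 hy, mul_comm, ← integral_mul_indicator_cube, ← integral_mul_const]
          refine integral_congr_ae (Eventually.of_forall fun x => ?_)
          simp only [Pi.one_def]; ring
        · simp [hfA y hy]
    _ = ∫ x, ∫ y, K x y * f y * (cube c r).indicator 1 x :=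
        (integral_integral_swap (hint _ hc (measurableSet_cube c r))).symm
    _ = _ := by
        simp only [hFB]
        rw [integral_indicator (measurableSet_cube c r)]

/-- `T` maps functions with integral zero supported in a square to functions that are integrable
off the tripled square, with a uniform bound. -/
def HasOffDiagonalBound (T : L2Plane →L[ℂ] L2Plane) (B : ℝ≥0) : Prop :=
  ∀ (c : ℝ × ℝ) (r : ℝ) (f : ℝ × ℝ → ℂ) (hf : MemLp f 2), 0 < r → (∀ y ∉ cube c r, f y = 0) →
    ∫ y, f y = 0 → ∫⁻ x in (cube c (3 * r))ᶜ, ‖T (hf.toLp f) x‖ₑ ≤ B * ∫⁻ y, ‖f y‖ₑ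

/-- A version of `ae_eq_integral_kernel` for functions that vanish almost everywhere off `A`. -/
theorem ae_eq_integral_kernel_of_ae {θ₁ θ₂ : ℝ} {K : ℝ × ℝ → ℝ × ℝ → ℂ}
    (hK : IsCZXKernel θ₁ θ₂ K) (hθ₁ : 0 < θ₁) (hθ₂ : 0 < θ₂) {T : L2Plane →L[ℂ] L2Plane}
    (hT : IsAssociatedKernel T K) {A U : Set (ℝ × ℝ)} (hA : IsOpen A) (hA' : volume A ≠ ∞)
    (hU : IsOpen U) (hU' : volume U ≠ ∞) {δ L : ℝ} (hδ : 0 < δ)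
    (hd : ∀ x ∈ U, ∀ y ∈ A, δ ≤ dist x y ∧ dist x y ≤ L) {f : ℝ × ℝ → ℂ} (hf : MemLp f 2)
    (hfA : ∀ᵐ y, y ∉ A → f y = 0) :
    ∀ᵐ x, x ∈ U → Integrable (fun y => K x y * f y) ∧ T (hf.toLp f) x = ∫ y, K x y * f y := by
  have hff : A.indicator f =ᵐ[volume] f := by
    filter_upwards [hfA] with x h
    by_cases hx : x ∈ A
    · simp [hx]
    · rw [Set.indicator_of_notMem hx, h hx]
  have hf2 : MemLp (A.indicator f) 2 := hf.indicator hA.measurableSet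
  have hlp : hf2.toLp _ = hf.toLp f := (MemLp.toLp_eq_toLp_iff _ _).2 hff
  filter_upwards [ae_eq_integral_kernel hK hθ₁ hθ₂ hT hA hA' hU hU' hδ hd hf2
    fun y hy => Set.indicator_of_notMem hy _] with x h1 hx
  obtain ⟨h3, h4⟩ := h1 hx
  have hK' : (fun y => K x y * A.indicator f y) =ᵐ[volume] fun y => K x y * f y := by
    filter_upwards [hff] with y hy
    rw [hy]
  rw [hlp] at h4
  exact ⟨h3.congr hK', h4.trans (integral_congr_ae hK')⟩

/-- Off the tripled square, the image of a function supported in a square is given by the kernel. -/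
theorem ae_eq_integral_kernel_off_cube {θ₁ θ₂ : ℝ} {K : ℝ × ℝ → ℝ × ℝ → ℂ}
    (hK : IsCZXKernel θ₁ θ₂ K) (hθ₁ : 0 < θ₁) (hθ₂ : 0 < θ₂) {T : L2Plane →L[ℂ] L2Plane}
    (hT : IsAssociatedKernel T K) {c : ℝ × ℝ} {r : ℝ} (hr : 0 < r) {f : ℝ × ℝ → ℂ}
    (hf : MemLp f 2) (hfc : ∀ y ∉ cube c r, f y = 0) :
    ∀ᵐ x, x ∉ cube c (3 * r) →
      Integrable (fun y => K x y * f y) ∧ T (hf.toLp f) x = ∫ y, K x y * f y := by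
  -- The kernel formula needs bounded sets, so the outside of the tripled square is exhausted by
  -- balls; the separation is 3r - r = 2r.
  have hrep : ∀ n : ℕ, ∀ᵐ x, x ∈ Metric.ball c n ∩ (Metric.closedBall c (3 * r))ᶜ →
      Integrable (fun y => K x y * f y) ∧ T (hf.toLp f) x = ∫ y, K x y * f y := fun n => by
    refine ae_eq_integral_kernel_of_ae hK hθ₁ hθ₂ hT Metric.isOpen_ball measure_ball_lt_top.ne
      (Metric.isOpen_ball.inter Metric.isClosed_closedBall.isOpen_compl)
      (measure_ne_top_of_subset Set.inter_subset_left measure_ball_lt_top.ne) (A := Metric.ball c r)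
      (δ := 2 * r) (L := n + r) (by positivity) (fun x hx y hy => ?_) hf ?_
    · have h1 : dist x c < n := hx.1
      have h2 : 3 * r < dist x c := not_le.1 hx.2
      have h3 : dist y c < r := hy
      have h4 := dist_triangle x y c
      have h5 := dist_triangle_right x y c
      constructor <;> linarith
    · filter_upwards [(ball_ae_eq_closedBall c r).mem_iff, (cube_ae_eq_closedBall c r).mem_iff]
        with x h1 h2 hx using hfc x fun h => hx (h1.2 (h2.1 h))
  filter_upwards [ae_all_iff.2 hrep, (cube_ae_eq_closedBall c (3 * r)).mem_iff] with x h1 h2 hx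
  obtain ⟨n, hn⟩ := exists_nat_gt (dist x c)
  exact h1 n ⟨hn, fun h => hx (h2.2 h)⟩

/-- Since f has mean zero, K(x, c) can be subtracted under the integral at no cost. Tonelli then
reduces the bound to the Hörmander condition in the second variable. -/
theorem exists_hasOffDiagonalBound {θ₁ θ₂ : ℝ} {K : ℝ × ℝ → ℝ × ℝ → ℂ}
    (hK : IsCZXKernel θ₁ θ₂ K) (hθ₁ : 0 < θ₁) (hθ₂ : 0 < θ₂) {T : L2Plane →L[ℂ] L2Plane}
    (hT : IsAssociatedKernel T K) : ∃ B, HasOffDiagonalBound T B := by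
  obtain ⟨B, hB⟩ := hK.swap.exists_hormander hθ₁ hθ₂
  refine ⟨B, fun c r f hf hr hfc hf0 => ?_⟩
  have hfi : Integrable f :=
    integrable_of_memLp_two hf (measurableSet_cube c r) (volume_cube_ne_top c r) hfc
  have hKm := hK.aestronglyMeasurable hθ₁
  have hKc := hK.swap.aestronglyMeasurable_right hθ₁ c
  have hm : AEStronglyMeasurable
      (fun z : (ℝ × ℝ) × (ℝ × ℝ) => (K z.1 z.2 - K z.1 c) * f z.2) (volume.prod volume) :=
    (hKm.sub hKc.comp_fst).mul hf.aestronglyMeasurable.comp_snd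
  have hm' : AEStronglyMeasurable (fun z : (ℝ × ℝ) × (ℝ × ℝ) => (K z.1 z.2 - K z.1 c) * f z.2)
      ((volume.restrict (cube c (3 * r))ᶜ).prod volume) := by
    have := hm.restrict (s := (cube c (3 * r))ᶜ ×ˢ Set.univ)
    rwa [← Measure.prod_restrict, Measure.restrict_univ] at this
  calc ∫⁻ x in (cube c (3 * r))ᶜ, ‖T (hf.toLp f) x‖ₑ
      ≤ ∫⁻ x in (cube c (3 * r))ᶜ, ∫⁻ y, ‖(K x y - K x c) * f y‖ₑ := by
        refine setLIntegral_mono_ae' (measurableSet_cube _ _).compl ?_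
        filter_upwards [ae_eq_integral_kernel_off_cube hK hθ₁ hθ₂ hT hr hf hfc] with x h1 hx
        obtain ⟨h2, h3⟩ := h1 hx
        have : ∫ y, K x y * f y = ∫ y, (K x y - K x c) * f y := by
          simp only [sub_mul]
          rw [integral_sub h2 (hfi.const_mul _), integral_const_mul, hf0, mul_zero, sub_zero]
        rw [h3, this]
        exact enorm_integral_le_lintegral_enorm _
    _ = ∫⁻ y, ∫⁻ x in (cube c (3 * r))ᶜ, ‖(K x y - K x c) * f y‖ₑ :=
        lintegral_lintegral_swap hm'.enorm
    _ ≤ ∫⁻ y, B * ‖f y‖ₑ := by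
        refine lintegral_mono fun y => ?_
        by_cases hy : y ∈ cube c r
        · simp only [enorm_mul]
          rw [lintegral_mul_const' _ _ (by simp)]
          gcongr
          exact hB c r y hy
        · simp [hfc y hy]
    _ = _ := lintegral_const_mul' _ _ (by simp)

/-! ### Dyadic squares and the Calderón–Zygmund decomposition. -/

theorem volume_cube (c : ℝ × ℝ) {r : ℝ} (hr : 0 ≤ r) :
    volume (cube c r) = ENNReal.ofReal (4 * r ^ 2) := by
  rw [cube, Measure.volume_eq_prod, Measure.prod_prod, Real.volume_Ico, Real.volume_Ico,
    ← ENNReal.ofReal_mul (by linarith)]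
  congr 1; ring

theorem volume_cube_ne_zero (c : ℝ × ℝ) {r : ℝ} (hr : 0 < r) : volume (cube c r) ≠ 0 := by
  rw [volume_cube c hr.le]
  exact (ENNReal.ofReal_pos.2 (by positivity)).ne'

/-- The index of the dyadic square of side `2 ^ s` that contains `x`. -/
noncomputable def dyadicIndex (s : ℤ) (x : ℝ × ℝ) : ℤ × ℤ :=
  (⌊x.1 / 2 ^ s⌋, ⌊x.2 / 2 ^ s⌋)

/-- The centre of a dyadic square. -/
noncomputable def dyadicCenter (s : ℤ) (k : ℤ × ℤ) : ℝ × ℝ :=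
  ((k.1 + 1 / 2) * 2 ^ s, (k.2 + 1 / 2) * 2 ^ s)

/-- The dyadic square of side `2 ^ s` with index `k`. -/
noncomputable def dyadicCube (s : ℤ) (k : ℤ × ℤ) : Set (ℝ × ℝ) :=
  cube (dyadicCenter s k) (2 ^ s / 2)

/-- Half-open squares fit the floor function exactly, so membership is an equation between indices,
and nesting reduces to integer division by 2. -/
theorem mem_dyadicCube {s : ℤ} {k : ℤ × ℤ} {x : ℝ × ℝ} :
    x ∈ dyadicCube s k ↔ dyadicIndex s x = k := by
  have hs : (0 : ℝ) < 2 ^ s := by positivity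
  have key : ∀ (m : ℤ) (t : ℝ), t ∈ Set.Ico ((m + 1 / 2) * (2 : ℝ) ^ s - 2 ^ s / 2)
      ((m + 1 / 2) * (2 : ℝ) ^ s + 2 ^ s / 2) ↔ ⌊t / 2 ^ s⌋ = m := by
    intro m t
    rw [Int.floor_eq_iff, le_div_iff₀ hs, div_lt_iff₀ hs, Set.mem_Ico]
    ring_nf
  rw [dyadicCube, cube, Set.mem_prod, dyadicIndex, dyadicCenter, key, key, Prod.ext_iff]

theorem dyadicIndex_succ (s : ℤ) (x : ℝ × ℝ) :
    dyadicIndex (s + 1) x = ((dyadicIndex s x).1 / 2, (dyadicIndex s x).2 / 2) := by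
  have key : ∀ t : ℝ, ⌊t / 2 ^ (s + 1)⌋ = ⌊t / 2 ^ s⌋ / 2 := fun t => by
    have h := Int.floor_div_natCast (t / 2 ^ s) 2
    rw [zpow_add_one₀ (by norm_num), ← div_div]
    exact_mod_cast h
  rw [dyadicIndex, key, key]
  rfl

theorem dyadicIndex_eq_of_le {s t : ℤ} (hst : s ≤ t) {x y : ℝ × ℝ}
    (h : dyadicIndex s x = dyadicIndex s y) : dyadicIndex t x = dyadicIndex t y := by
  induction t, hst using Int.leInduction with
  | base => exact h
  | succ n _ ih => rw [dyadicIndex_succ, dyadicIndex_succ, ih]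

theorem volume_dyadicCube (s : ℤ) (k : ℤ × ℤ) :
    volume (dyadicCube s k) = ENNReal.ofReal ((2 ^ s) ^ 2) := by
  rw [dyadicCube, volume_cube _ (by positivity)]
  congr 1; ring

/-- The maximal dyadic squares on which the average of `φ` exceeds `t`. -/
def IsStoppingCube (φ : ℝ × ℝ → ℝ≥0∞) (t : ℝ≥0∞) (i : ℤ × (ℤ × ℤ)) : Prop :=
  t * volume (dyadicCube i.1 i.2) < ∫⁻ x in dyadicCube i.1 i.2, φ x ∧
    ∀ s, i.1 < s → ∀ x ∈ dyadicCube i.1 i.2,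
      ∫⁻ y in dyadicCube s (dyadicIndex s x), φ y ≤ t * volume (dyadicCube s (dyadicIndex s x))

/-- Of two stopping squares of different sizes sharing a point, the larger would be a dyadic
ancestor of the smaller, which maximality forbids. -/
theorem IsStoppingCube.eq_of_mem {φ : ℝ × ℝ → ℝ≥0∞} {t : ℝ≥0∞} {i j : ℤ × (ℤ × ℤ)}
    (hi : IsStoppingCube φ t i) (hj : IsStoppingCube φ t j) {x : ℝ × ℝ}
    (hxi : x ∈ dyadicCube i.1 i.2) (hxj : x ∈ dyadicCube j.1 j.2) : i = j := by
  have key : ∀ {i j : ℤ × (ℤ × ℤ)}, IsStoppingCube φ t i → IsStoppingCube φ t j →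
      x ∈ dyadicCube i.1 i.2 → x ∈ dyadicCube j.1 j.2 → ¬ i.1 < j.1 := by
    intro i j hi hj hxi hxj hlt
    have := hi.2 _ hlt x hxi
    rw [mem_dyadicCube.1 hxj] at this
    exact absurd hj.1 (not_lt.2 this)
  have h1 : i.1 = j.1 := le_antisymm (not_lt.1 (key hj hi hxj hxi)) (not_lt.1 (key hi hj hxi hxj))
  refine Prod.ext h1 ?_
  rw [← mem_dyadicCube.1 hxi, ← mem_dyadicCube.1 hxj, h1]

/-- The dyadic parent is not selected and has four times the area. -/
theorem IsStoppingCube.lintegral_le {φ : ℝ × ℝ → ℝ≥0∞} {t : ℝ≥0∞} {i : ℤ × (ℤ × ℤ)}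
    (hi : IsStoppingCube φ t i) :
    ∫⁻ x in dyadicCube i.1 i.2, φ x ≤ 4 * t * volume (dyadicCube i.1 i.2) := by
  obtain ⟨x, hx⟩ : (dyadicCube i.1 i.2).Nonempty := by
    by_contra h
    rw [Set.not_nonempty_iff_eq_empty] at h
    have := hi.1
    simp [h] at this
  calc _ ≤ ∫⁻ y in dyadicCube (i.1 + 1) (dyadicIndex (i.1 + 1) x), φ y := by
        refine lintegral_mono_set fun y hy => mem_dyadicCube.2 ?_
        refine dyadicIndex_eq_of_le (by lia : i.1 ≤ i.1 + 1) ?_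
        rw [mem_dyadicCube.1 hx, mem_dyadicCube.1 hy]
    _ ≤ _ := hi.2 _ (by lia) x hx
    _ = _ := by
        rw [volume_dyadicCube, volume_dyadicCube, zpow_add_one₀ (by norm_num), mul_pow, mul_comm 4 t,
          mul_assoc, mul_comm ((2 ^ i.1) ^ 2 : ℝ), ENNReal.ofReal_mul (by norm_num)]
        norm_num

theorem exists_isStoppingCube {φ : ℝ × ℝ → ℝ≥0∞} {t : ℝ≥0∞} (ht : t ≠ 0) (ht' : t ≠ ∞)
    (hφ : ∫⁻ x, φ x ≠ ∞) {x : ℝ × ℝ} {s : ℤ}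
    (hs : t * volume (dyadicCube s (dyadicIndex s x)) < ∫⁻ y in dyadicCube s (dyadicIndex s x), φ y) :
    ∃ i, IsStoppingCube φ t i ∧ x ∈ dyadicCube i.1 i.2 := by
  -- A square of scale z > n has area at least n, and t * n already exceeds the total integral. The
  -- scales with large average are thus bounded above, and a greatest one exists.
  obtain ⟨n, hn⟩ := ENNReal.exists_nat_gt (ENNReal.div_ne_top hφ ht)
  have hbd : ∀ z : ℤ, t * volume (dyadicCube z (dyadicIndex z x)) <
      ∫⁻ y in dyadicCube z (dyadicIndex z x), φ y → z ≤ n := by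
    intro z hz
    by_contra! hlt
    have h1 : t * n ≤ t * volume (dyadicCube z (dyadicIndex z x)) := by
      gcongr
      rw [volume_dyadicCube, ← ENNReal.ofReal_natCast]
      refine ENNReal.ofReal_le_ofReal ?_
      have h2 : (n : ℝ) ≤ 2 ^ n := by exact_mod_cast Nat.lt_two_pow_self.le
      have h3 : (2 : ℝ) ^ n ≤ 2 ^ z := by
        rw [← zpow_natCast]; exact zpow_le_zpow_right₀ (by norm_num) hlt.le
      have h4 : (1 : ℝ) ≤ 2 ^ n := one_le_pow₀ (by norm_num)
      nlinarith
    have h5 : ∫⁻ x, φ x < t * n := by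
      rw [mul_comm]; exact (ENNReal.div_lt_iff (Or.inl ht) (Or.inl ht')).1 hn
    exact absurd (h1.trans (hz.le.trans (setLIntegral_le_lintegral _ _))) (not_le.2 h5)
  obtain ⟨z, hz, hmax⟩ := Int.exists_greatest_of_bdd ⟨(n : ℤ), hbd⟩ ⟨s, hs⟩
  refine ⟨(z, dyadicIndex z x), ⟨hz, fun s' hs' y hy => ?_⟩, mem_dyadicCube.2 rfl⟩
  rw [dyadicIndex_eq_of_le hs'.le (mem_dyadicCube.1 hy)]
  by_contra! h
  exact absurd (hmax s' h) (not_le.2 hs')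

theorem enorm_le_of_forall_dyadicCube {f : ℝ × ℝ → ℂ} (hf : Integrable f) (t : ℝ≥0) :
    ∀ᵐ x, (∀ s, ∫⁻ y in dyadicCube s (dyadicIndex s x), ‖f y‖ₑ ≤
      t * volume (dyadicCube s (dyadicIndex s x))) → ‖f x‖ₑ ≤ t := by
  filter_upwards [IsUnifLocDoublingMeasure.ae_tendsto_average volume hf.norm.locallyIntegrable 1]
    with x hx h
  have hδ : Tendsto (fun n : ℕ => (2 : ℝ) ^ (-n : ℤ) / 2) atTop (𝓝[>] 0) := by
    refine tendsto_nhdsWithin_iff.2 ⟨?_, Eventually.of_forall fun n => Set.mem_Ioi.2 (by positivity)⟩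
    have := (tendsto_pow_atTop_nhds_zero_of_lt_one (r := (1 / 2 : ℝ)) (by norm_num)
      (by norm_num)).div_const 2
    simpa using this
  -- The differentiation theorem allows x anywhere in the averaging ball when the dilation factor is
  -- 1, so dyadic squares that are not centred at x are admissible.
  have h1 := hx (fun n : ℕ => dyadicCenter (-n) (dyadicIndex (-n) x)) _ hδ
    (Eventually.of_forall fun n => by
      rw [one_mul]
      exact cube_subset_closedBall _ _ (mem_dyadicCube.2 (rfl : dyadicIndex (-n) x = _)))
  have h2 : ‖f x‖ ≤ t := by
    refine le_of_tendsto' h1 fun n => ?_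
    rw [setAverage_eq, ← setIntegral_congr_set (cube_ae_eq_closedBall _ _),
      ← measureReal_congr (cube_ae_eq_closedBall _ _)]
    have h3 := h (-n)
    rw [← ofReal_integral_norm_eq_lintegral_enorm hf.integrableOn] at h3
    change (volume.real (dyadicCube _ _))⁻¹ • ∫ y in dyadicCube _ _, ‖f y‖ ≤ _
    set Q := dyadicCube (-n) (dyadicIndex (-n) x) with hQ
    have hQ0 : volume Q ≠ 0 := volume_cube_ne_zero _ (by positivity)
    have hQ1 : volume Q ≠ ∞ := volume_cube_ne_top _ _
    have hQr : 0 < volume.real Q := ENNReal.toReal_pos hQ0 hQ1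
    rw [← ENNReal.ofReal_toReal hQ1, ← ENNReal.ofReal_coe_nnreal,
      ← ENNReal.ofReal_mul t.coe_nonneg, ENNReal.ofReal_le_ofReal_iff (by positivity)] at h3
    rw [smul_eq_mul, inv_mul_le_iff₀ hQr, mul_comm]
    exact h3
  rw [← ofReal_norm, ← ENNReal.ofReal_coe_nnreal]
  exact ENNReal.ofReal_le_ofReal h2

/-- The family of squares of the Calderón–Zygmund decomposition at height `t`. -/
theorem exists_calderonZygmund_cubes {f : ℝ × ℝ → ℂ} (hf : Integrable f) {t : ℝ≥0} (ht : 0 < t) :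
    ∃ (ι : Type) (_ : Countable ι) (c : ι → ℝ × ℝ) (r : ι → ℝ), (∀ i, 0 < r i) ∧
      Pairwise (Function.onFun Disjoint fun i => cube (c i) (r i)) ∧
      (∀ i, t * volume (cube (c i) (r i)) ≤ ∫⁻ x in cube (c i) (r i), ‖f x‖ₑ) ∧
      (∀ i, ∫⁻ x in cube (c i) (r i), ‖f x‖ₑ ≤ 4 * t * volume (cube (c i) (r i))) ∧
      ∀ᵐ x, (∀ i, x ∉ cube (c i) (r i)) → ‖f x‖ₑ ≤ t := by
  refine ⟨{i : ℤ × (ℤ × ℤ) // IsStoppingCube (fun x => ‖f x‖ₑ) t i}, inferInstance,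
    fun i => dyadicCenter i.1.1 i.1.2, fun i => 2 ^ i.1.1 / 2, fun i => by positivity,
    fun i j hij => ?_, fun i => i.2.1.le, fun i => i.2.lintegral_le, ?_⟩
  · exact Set.disjoint_left.2 fun x hxi hxj => hij (Subtype.ext (i.2.eq_of_mem j.2 hxi hxj))
  · filter_upwards [enorm_le_of_forall_dyadicCube hf t] with x hx h
    refine hx fun s => ?_
    by_contra! hs
    obtain ⟨i, hi, hxi⟩ := exists_isStoppingCube (by exact_mod_cast ht.ne') (by simp) hf.2.ne hs
    exact h ⟨i, hi⟩ hxi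

/-! ### The weak type (1, 1) estimate. -/

theorem eLpNorm_two_sq {α : Type*} [MeasurableSpace α] (μ : Measure α) (f : α → ℂ) :
    eLpNorm f 2 μ ^ 2 = ∫⁻ x, ‖f x‖ₑ ^ 2 ∂μ := by
  rw [eLpNorm_eq_lintegral_rpow_enorm_toReal (by norm_num) (by norm_num)]
  simp only [ENNReal.toReal_ofNat, one_div, ENNReal.rpow_ofNat]
  rw [← ENNReal.rpow_ofNat, ← ENNReal.rpow_mul]
  norm_num

theorem lintegral_sq_apply_le (T : L2Plane →L[ℂ] L2Plane) {f : ℝ × ℝ → ℂ} (hf : MemLp f 2) :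
    ∫⁻ x, ‖T (hf.toLp f) x‖ₑ ^ 2 ≤ ‖T‖ₑ ^ 2 * ∫⁻ x, ‖f x‖ₑ ^ 2 := by
  rw [← eLpNorm_two_sq, ← eLpNorm_two_sq, ← mul_pow, ← Lp.enorm_def, ← Lp.enorm_toLp hf]
  gcongr
  exact T.le_opENorm _

theorem mul_meas_sq_le {f : ℝ × ℝ → ℂ} (t : ℝ≥0∞) (hf : AEStronglyMeasurable f volume) :
    t ^ 2 * volume {x | t < ‖f x‖ₑ} ≤ ∫⁻ x, ‖f x‖ₑ ^ 2 := by
  refine le_trans ?_ (mul_meas_ge_le_lintegral₀ (hf.enorm.pow_const 2) (t ^ 2))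
  gcongr with x
  exact fun hx => pow_le_pow_left' (le_of_lt hx) 2

theorem toLp_sub_apply (T : L2Plane →L[ℂ] L2Plane) {f g : ℝ × ℝ → ℂ} (hf : MemLp f 2)
    (hg : MemLp g 2) :
    T ((hf.sub hg).toLp _) =ᵐ[volume] fun x => T (hf.toLp f) x - T (hg.toLp g) x := by
  rw [MemLp.toLp_sub, map_sub]
  exact Lp.coeFn_sub _ _

theorem toLp_add_apply (T : L2Plane →L[ℂ] L2Plane) {f g : ℝ × ℝ → ℂ} (hf : MemLp f 2)
    (hg : MemLp g 2) :
    T ((hf.add hg).toLp _) =ᵐ[volume] fun x => T (hf.toLp f) x + T (hg.toLp g) x := by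
  rw [MemLp.toLp_add, map_add]
  exact Lp.coeFn_add _ _

/-- A measurable function of modulus at most one that turns `h` into its absolute value on `W`. -/
noncomputable def phase (W : Set (ℝ × ℝ)) (h : ℝ × ℝ → ℂ) : ℝ × ℝ → ℂ :=
  W.indicator fun x => (starRingEnd ℂ) (h x) / ‖h x‖

theorem mul_phase (W : Set (ℝ × ℝ)) (h : ℝ × ℝ → ℂ) (x : ℝ × ℝ) :
    h x * phase W h x = W.indicator (fun x => (‖h x‖ : ℂ)) x := by
  by_cases hx : x ∈ W
  · simp only [phase, hx, Set.indicator_of_mem]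
    by_cases h0 : h x = 0
    · simp [h0]
    · have : (‖h x‖ : ℂ) ≠ 0 := by simpa using h0
      rw [← mul_div_assoc, Complex.mul_conj', sq, mul_div_assoc, div_self this, mul_one]
  · simp [phase, hx]

theorem enorm_phase_le (W : Set (ℝ × ℝ)) (h : ℝ × ℝ → ℂ) (x : ℝ × ℝ) :
    ‖phase W h x‖ₑ ≤ W.indicator 1 x := by
  by_cases hx : x ∈ W
  · simp only [phase, hx, Set.indicator_of_mem, Pi.one_apply]
    rw [← ofReal_norm, ENNReal.ofReal_le_one, norm_div]
    simp only [RCLike.norm_conj, Complex.norm_real, norm_norm]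
    exact div_self_le_one _
  · simp [phase, hx]

theorem memLp_phase {W : Set (ℝ × ℝ)} {h : ℝ × ℝ → ℂ} (hW : MeasurableSet W) (hW' : volume W ≠ ∞)
    (hh : Measurable h) (p : ℝ≥0∞) : MemLp (phase W h) p := by
  have hm : Measurable (phase W h) := by
    refine Measurable.indicator ?_ hW
    fun_prop
  refine (memLp_indicator_const p hW (1 : ℂ) (Or.inr hW')).of_le hm.aestronglyMeasurable
    (Eventually.of_forall fun x => ?_)
  have := enorm_phase_le W h x
  rw [← enorm_le_iff_norm_le]
  refine this.trans (le_of_eq ?_)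
  by_cases hx : x ∈ W <;> simp [hx]

/-- An `L²` function that vanishes off countably many disjoint squares and has integral zero over
each of them is mapped to a function that is integrable off the tripled squares. -/
theorem lintegral_le_of_cancellation {T : L2Plane →L[ℂ] L2Plane} {B : ℝ≥0}
    (hB : HasOffDiagonalBound T B) {ι : Type*} [Countable ι] {c : ι → ℝ × ℝ} {r : ι → ℝ}
    (hr : ∀ i, 0 < r i) (hd : Pairwise (Function.onFun Disjoint fun i => cube (c i) (r i)))
    {b : ℝ × ℝ → ℂ} (hb : MemLp b 2) (hb0 : ∀ x, (∀ i, x ∉ cube (c i) (r i)) → b x = 0)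
    (hbi : ∀ i, ∫ x in cube (c i) (r i), b x = 0) {W : Set (ℝ × ℝ)} (hW : MeasurableSet W)
    (hW' : volume W ≠ ∞) (hWc : ∀ i, Disjoint W (cube (c i) (3 * r i))) :
    ∫⁻ x in W, ‖T (hb.toLp b) x‖ₑ ≤ B * ∫⁻ x, ‖b x‖ₑ := by
  obtain ⟨T', hTT⟩ := exists_transpose T
  set h := T (hb.toLp b)
  have hhm : Measurable h := (Lp.stronglyMeasurable h).measurable
  have hφ := memLp_phase hW hW' hhm 2
  set φ : L2Plane := hφ.toLp _
  have hQm : ∀ i, MeasurableSet (cube (c i) (r i)) := fun i => measurableSet_cube _ _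
  have e1 : ∫⁻ x in W, ‖h x‖ₑ = ‖∫ x, h x * φ x‖ₑ := by
    have : ∫ x, h x * φ x = ((∫ x in W, ‖h x‖ : ℝ) : ℂ) := by
      rw [← integral_complex_ofReal, ← integral_indicator hW]
      refine integral_congr_ae ?_
      filter_upwards [hφ.coeFn_toLp] with x hx
      rw [hx]
      exact mul_phase W h x
    rw [this, ← ofReal_integral_norm_eq_lintegral_enorm
      (integrableOn_of_memLp_two (Lp.memLp h) hW'), ← ofReal_norm, Complex.norm_real,
      Real.norm_of_nonneg (integral_nonneg fun _ => norm_nonneg _)]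
  have hint : Integrable fun x => b x * T' φ x := hb.integrable_mul (Lp.memLp (T' φ))
  -- Moving T onto φ turns the decomposition of b into countable additivity of one integral, so no
  -- convergence of the series of images of the pieces has to be discussed.
  have e2 : ∫ x, h x * φ x = ∑' i, ∫ x in cube (c i) (r i), b x * T' φ x := by
    rw [← integral_iUnion hQm hd hint.integrableOn, hTT]
    have : ∫ x, hb.toLp b x * T' φ x = ∫ x, b x * T' φ x := by
      refine integral_congr_ae ?_
      filter_upwards [hb.coeFn_toLp] with x hx
      rw [hx]
    rw [this]
    refine (setIntegral_eq_integral_of_forall_compl_eq_zero fun x hx => ?_).symm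
    rw [hb0 x fun i hi => hx (Set.mem_iUnion.2 ⟨i, hi⟩), zero_mul]
  have e3 : ∀ i, ‖∫ x in cube (c i) (r i), b x * T' φ x‖ₑ ≤
      B * ∫⁻ x in cube (c i) (r i), ‖b x‖ₑ := by
    intro i
    have hbm : MemLp ((cube (c i) (r i)).indicator b) 2 := hb.indicator (hQm i)
    have e4 : ∫ x in cube (c i) (r i), b x * T' φ x = ∫ x, T (hbm.toLp _) x * φ x := by
      rw [hTT, ← integral_indicator (hQm i)]
      refine integral_congr_ae ?_
      filter_upwards [hbm.coeFn_toLp] with x hx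
      rw [hx]
      by_cases hx : x ∈ cube (c i) (r i) <;> simp [hx]
    have e5 := hB (c i) (r i) _ hbm (hr i) (fun y hy => Set.indicator_of_notMem hy _)
      (by rw [integral_indicator (hQm i), hbi i])
    rw [e4]
    calc _ ≤ ∫⁻ x, ‖T (hbm.toLp _) x * φ x‖ₑ := enorm_integral_le_lintegral_enorm _
      _ ≤ ∫⁻ x, (cube (c i) (3 * r i))ᶜ.indicator (fun x => ‖T (hbm.toLp _) x‖ₑ) x := by
          refine lintegral_mono_ae ?_
          filter_upwards [hφ.coeFn_toLp] with x hx
          rw [hx, enorm_mul]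
          have h1 := enorm_phase_le W h x
          by_cases hxW : x ∈ W
          · rw [Set.indicator_of_mem (Set.disjoint_left.1 (hWc i) hxW)]
            rw [Set.indicator_of_mem hxW] at h1
            exact mul_le_of_le_one_right' h1
          · simp [phase, hxW]
      _ = ∫⁻ x in (cube (c i) (3 * r i))ᶜ, ‖T (hbm.toLp _) x‖ₑ :=
          lintegral_indicator (measurableSet_cube _ _).compl _
      _ ≤ _ := e5
      _ = _ := by
          rw [← lintegral_indicator (hQm i)]
          simp only [enorm_indicator_eq_indicator_enorm]
  rw [e1, e2]
  calc _ ≤ ∑' i, ‖∫ x in cube (c i) (r i), b x * T' φ x‖ₑ := enorm_tsum_le_tsum_enorm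
    _ ≤ ∑' i, B * ∫⁻ x in cube (c i) (r i), ‖b x‖ₑ := ENNReal.tsum_le_tsum e3
    _ = B * ∫⁻ x in ⋃ i, cube (c i) (r i), ‖b x‖ₑ := by
        rw [ENNReal.tsum_mul_left, lintegral_iUnion hQm hd]
    _ ≤ _ := by gcongr; exact Measure.restrict_le_self

theorem volume_mul_enorm_setAverage_le (f : ℝ × ℝ → ℂ) {Q : Set (ℝ × ℝ)} (hQ : volume Q ≠ ∞) :
    volume Q * ‖⨍ x in Q, f x‖ₑ ≤ ∫⁻ x in Q, ‖f x‖ₑ := by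
  have : IsFiniteMeasure (volume.restrict Q) := isFiniteMeasure_restrict.2 hQ
  have h := measure_smul_setAverage f hQ
  calc _ = ‖volume.real Q • ⨍ x in Q, f x‖ₑ := by
        rw [enorm_smul, Real.enorm_of_nonneg measureReal_nonneg, measureReal_def,
          ENNReal.ofReal_toReal hQ]
    _ ≤ _ := by rw [h]; exact enorm_integral_le_lintegral_enorm _

/-- The good function of the Calderón–Zygmund decomposition. -/
theorem exists_good_function {f : ℝ × ℝ → ℂ} (hf : Integrable f) {t : ℝ≥0} {ι : Type*}
    [Countable ι] {c : ι → ℝ × ℝ} {r : ι → ℝ} (hr : ∀ i, 0 < r i)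
    (hd : Pairwise (Function.onFun Disjoint fun i => cube (c i) (r i)))
    (hu : ∀ i, ∫⁻ x in cube (c i) (r i), ‖f x‖ₑ ≤ 4 * t * volume (cube (c i) (r i)))
    (ho : ∀ᵐ x, (∀ i, x ∉ cube (c i) (r i)) → ‖f x‖ₑ ≤ t) :
    ∃ g : ℝ × ℝ → ℂ, AEStronglyMeasurable g volume ∧
      (∀ x, (∀ i, x ∉ cube (c i) (r i)) → g x = f x) ∧
      (∀ i, ∫ x in cube (c i) (r i), g x = ∫ x in cube (c i) (r i), f x) ∧
      (∫⁻ x, ‖g x‖ₑ ≤ ∫⁻ x, ‖f x‖ₑ) ∧ ∀ᵐ x, ‖g x‖ₑ ≤ 4 * t := by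
  classical
  have hQm : ∀ i, MeasurableSet (cube (c i) (r i)) := fun i => measurableSet_cube _ _
  have hQt : ∀ i, volume (cube (c i) (r i)) ≠ ∞ := fun i => volume_cube_ne_top _ _
  set Ω := ⋃ i, cube (c i) (r i) with hΩ
  have hΩm : MeasurableSet Ω := MeasurableSet.iUnion hQm
  set a : ι → ℂ := fun i => ⨍ x in cube (c i) (r i), f x with ha
  -- The square containing x is chosen arbitrarily; disjointness makes it unique.
  set g : ℝ × ℝ → ℂ := fun x => if h : ∃ i, x ∈ cube (c i) (r i) then a h.choose else f x with hg
  have g1 : ∀ i, ∀ x ∈ cube (c i) (r i), g x = a i := by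
    intro i x hx
    have h : ∃ i, x ∈ cube (c i) (r i) := ⟨i, hx⟩
    have : h.choose = i := by
      by_contra hne
      exact Set.disjoint_left.1 (hd hne) h.choose_spec hx
    simp only [hg, dif_pos h, this]
  have g2 : ∀ x, (∀ i, x ∉ cube (c i) (r i)) → g x = f x := by
    intro x hx
    have : ¬ ∃ i, x ∈ cube (c i) (r i) := fun ⟨i, hi⟩ => hx i hi
    simp only [hg, dif_neg this]
  have g2' : ∀ x ∈ Ωᶜ, g x = f x := fun x hx => g2 x fun i hi => hx (Set.mem_iUnion.2 ⟨i, hi⟩)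
  have hav : ∀ i, volume (cube (c i) (r i)) * ‖a i‖ₑ ≤ ∫⁻ x in cube (c i) (r i), ‖f x‖ₑ :=
    fun i => volume_mul_enorm_setAverage_le f (hQt i)
  refine ⟨g, ?_, g2, fun i => ?_, ?_, ?_⟩
  · rw [← Measure.restrict_univ (μ := volume), ← Set.union_compl_self Ω,
      aestronglyMeasurable_union_iff, hΩ, aestronglyMeasurable_iUnion_iff]
    refine ⟨fun i => ?_, ?_⟩
    · refine (aestronglyMeasurable_const (b := a i)).congr ?_
      filter_upwards [ae_restrict_mem (hQm i)] with x hx using (g1 i x hx).symm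
    · refine hf.aestronglyMeasurable.restrict.congr ?_
      filter_upwards [ae_restrict_mem hΩm.compl] with x hx using (g2' x hx).symm
  · have : IsFiniteMeasure (volume.restrict (cube (c i) (r i))) :=
      isFiniteMeasure_restrict.2 (hQt i)
    rw [setIntegral_congr_fun (hQm i) (g1 i), setIntegral_const, ha,
      measure_smul_setAverage f (hQt i)]
  · rw [← lintegral_add_compl (fun x => ‖g x‖ₑ) hΩm, ← lintegral_add_compl (fun x => ‖f x‖ₑ) hΩm]
    refine add_le_add ?_ (le_of_eq ?_)
    · rw [lintegral_iUnion hQm hd, lintegral_iUnion hQm hd]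
      refine ENNReal.tsum_le_tsum fun i => ?_
      rw [setLIntegral_congr_fun (hQm i) (g := fun _ => ‖a i‖ₑ) fun x hx => by
        simp only [g1 i x hx], setLIntegral_const, mul_comm]
      exact hav i
    · exact setLIntegral_congr_fun hΩm.compl fun x hx => by simp only [g2' x hx]
  · filter_upwards [ho] with x hx
    by_cases h : ∃ i, x ∈ cube (c i) (r i)
    · obtain ⟨i, hi⟩ := h
      rw [g1 i x hi]
      have h1 := (hav i).trans (hu i)
      rw [mul_comm (volume _)] at h1
      exact (ENNReal.mul_le_mul_iff_left (volume_cube_ne_zero _ (hr i)) (hQt i)).1 h1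
    · push Not at h
      rw [g2 x h]
      refine (hx h).trans ?_
      exact le_mul_of_one_le_left' (by norm_num)

theorem volume_cube_three_mul (c : ℝ × ℝ) {r : ℝ} (hr : 0 < r) :
    volume (cube c (3 * r)) = 9 * volume (cube c r) := by
  rw [volume_cube c hr.le, volume_cube c (by positivity), ← ENNReal.ofReal_ofNat 9,
    ← ENNReal.ofReal_mul (by norm_num)]
  congr 1; ring

/-- The weak type `(1, 1)` estimate on `L¹ ∩ L²`. -/
theorem weak_type_one_one {T : L2Plane →L[ℂ] L2Plane} {B : ℝ≥0} (hB : HasOffDiagonalBound T B)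
    {f : ℝ × ℝ → ℂ} (hf1 : Integrable f) (hf : MemLp f 2) {t : ℝ≥0} (ht : 0 < t) :
    t * volume {x | (t : ℝ≥0∞) < ‖T (hf.toLp f) x‖ₑ} ≤
      (16 * ‖T‖ₑ ^ 2 + 9 + 4 * B) * ∫⁻ x, ‖f x‖ₑ := by
  obtain ⟨ι, _, c, r, hr, hd, hl, hu, ho⟩ := exists_calderonZygmund_cubes hf1 ht
  obtain ⟨g, hgm, hg0, hgi, hg1, hgb⟩ := exists_good_function hf1 hr hd hu ho
  have hQm : ∀ i, MeasurableSet (cube (c i) (r i)) := fun i => measurableSet_cube _ _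
  set N := ∫⁻ x, ‖f x‖ₑ with hN
  have hNt : N ≠ ∞ := hf1.2.ne
  -- The good function is bounded by 4t and has L¹ norm at most N, which puts it in L² with a bound
  -- linear in t.
  have hg2 : ∫⁻ x, ‖g x‖ₑ ^ 2 ≤ 4 * t * N := by
    calc _ ≤ ∫⁻ x, 4 * t * ‖g x‖ₑ := by
          refine lintegral_mono_ae ?_
          filter_upwards [hgb] with x hx
          rw [sq]; gcongr
      _ = 4 * t * ∫⁻ x, ‖g x‖ₑ := lintegral_const_mul' _ _ (by finiteness)
      _ ≤ _ := by gcongr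
  have hg : MemLp g 2 := by
    refine ⟨hgm, ?_⟩
    have : eLpNorm g 2 volume ^ 2 < ∞ := by
      rw [eLpNorm_two_sq]; exact hg2.trans_lt (by finiteness)
    exact (ENNReal.pow_lt_top_iff.1 this).resolve_right (by norm_num)
  have hgint : Integrable g := ⟨hgm, hg1.trans_lt hf1.2⟩
  have hb : MemLp (f - g) 2 := hf.sub hg
  have hb1 : ∫⁻ x, ‖(f - g) x‖ₑ ≤ 2 * N := by
    calc _ ≤ ∫⁻ x, ‖f x‖ₑ + ‖g x‖ₑ := lintegral_mono fun x => enorm_sub_le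
      _ = N + ∫⁻ x, ‖g x‖ₑ := lintegral_add_left' hf1.aestronglyMeasurable.enorm _
      _ ≤ _ := by rw [two_mul]; gcongr
  have hbi : ∀ i, ∫ x in cube (c i) (r i), (f - g) x = 0 := fun i => by
    simp only [Pi.sub_apply]
    rw [integral_sub hf1.integrableOn hgint.integrableOn, hgi i, sub_self]
  set E := ⋃ i, cube (c i) (3 * r i)
  have hEm : MeasurableSet E := MeasurableSet.iUnion fun i => measurableSet_cube _ _
  have hE : t * volume E ≤ 9 * N := by
    calc t * volume E ≤ t * ∑' i, 9 * volume (cube (c i) (r i)) := by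
          gcongr
          refine (measure_iUnion_le _).trans (le_of_eq ?_)
          exact tsum_congr fun i => volume_cube_three_mul _ (hr i)
      _ = 9 * ∑' i, t * volume (cube (c i) (r i)) := by
          rw [ENNReal.tsum_mul_left, ENNReal.tsum_mul_left]; ring
      _ ≤ 9 * ∑' i, ∫⁻ x in cube (c i) (r i), ‖f x‖ₑ := by
          gcongr; exact hl _
      _ = 9 * ∫⁻ x in ⋃ i, cube (c i) (r i), ‖f x‖ₑ := by rw [lintegral_iUnion hQm hd]
      _ ≤ _ := by gcongr; exact setLIntegral_le_lintegral _ _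
  -- Half the height goes to the good part and half to the bad part.
  obtain ⟨h, hh⟩ : ∃ h : ℝ≥0, t = 2 * h := ⟨t / 2, by field_simp⟩
  have hh0 : 0 < h := by
    rcases eq_or_ne h 0 with h0 | h0
    · simp [hh, h0] at ht
    · exact pos_iff_ne_zero.2 h0
  have hhe : (h : ℝ≥0∞) ≠ 0 := by exact_mod_cast hh0.ne'
  have hte : (t : ℝ≥0∞) = 2 * h := by rw [hh]; push_cast; rfl
  have hG : t * volume {x | (h : ℝ≥0∞) < ‖T (hg.toLp g) x‖ₑ} ≤ 16 * ‖T‖ₑ ^ 2 * N := by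
    have h1 := (mul_meas_sq_le h (Lp.aestronglyMeasurable (T (hg.toLp g)))).trans
      ((lintegral_sq_apply_le T hg).trans (mul_le_mul_right hg2 _))
    set V := volume {x | (h : ℝ≥0∞) < ‖T (hg.toLp g) x‖ₑ}
    refine (ENNReal.mul_le_mul_iff_right hhe ENNReal.coe_ne_top).1 ?_
    calc (h : ℝ≥0∞) * (t * V) = 2 * (h ^ 2 * V) := by rw [hte]; ring
      _ ≤ 2 * (‖T‖ₑ ^ 2 * (4 * t * N)) := by gcongr
      _ = _ := by rw [hte]; ring
  set Tb := T (hb.toLp _) with hTb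
  -- The tripled squares E already have measure at most 9N/t; off them the cancellation estimate
  -- controls the bad part. Finiteness of the measure of W, which that estimate requires, comes from
  -- Chebyshev in L².
  set W := {x | (h : ℝ≥0∞) < ‖Tb x‖ₑ} \ E with hWdef
  have hTbm : Measurable Tb := (Lp.stronglyMeasurable Tb).measurable
  have hVm : MeasurableSet {x | (h : ℝ≥0∞) < ‖Tb x‖ₑ} :=
    measurableSet_lt measurable_const hTbm.enorm
  have hVt : volume {x | (h : ℝ≥0∞) < ‖Tb x‖ₑ} ≠ ∞ := by
    intro htop
    have h1 := mul_meas_sq_le h (Lp.aestronglyMeasurable Tb)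
    rw [htop, ENNReal.mul_top (pow_ne_zero 2 hhe), ← eLpNorm_two_sq, top_le_iff,
      ENNReal.pow_eq_top_iff] at h1
    exact (Lp.eLpNorm_ne_top Tb) h1.1
  have hWm : MeasurableSet W := hVm.diff hEm
  have hWb := lintegral_le_of_cancellation hB hr hd hb
    (fun x hx => by rw [Pi.sub_apply, hg0 x hx, sub_self]) hbi hWm
    (measure_ne_top_of_subset Set.sdiff_subset hVt)
    (fun i => Set.disjoint_left.2 fun x hx hxi => hx.2 (Set.mem_iUnion.2 ⟨i, hxi⟩))
  have hW : t * volume W ≤ 4 * B * N := by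
    have h1 : h * volume W ≤ ∫⁻ x in W, ‖Tb x‖ₑ := by
      rw [← setLIntegral_const]
      exact setLIntegral_mono' hWm fun x hx => le_of_lt hx.1
    calc t * volume W = 2 * (h * volume W) := by rw [hte]; ring
      _ ≤ 2 * (B * (2 * N)) := by
          refine mul_le_mul_right (h1.trans (hWb.trans ?_)) _
          exact mul_le_mul_right hb1 _
      _ = _ := by ring
  have hsub : volume {x | (t : ℝ≥0∞) < ‖T (hf.toLp f) x‖ₑ} ≤
      volume ({x | (h : ℝ≥0∞) < ‖T (hg.toLp g) x‖ₑ} ∪ (E ∪ W)) := by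
    refine measure_mono_ae ?_
    filter_upwards [toLp_sub_apply T hf hg] with x hx hxt
    by_contra hcon
    have n1 : ¬ (h : ℝ≥0∞) < ‖T (hg.toLp g) x‖ₑ := fun h' => hcon (Or.inl h')
    have n2 : ¬ (h : ℝ≥0∞) < ‖Tb x‖ₑ := fun h' => by
      by_cases hxE : x ∈ E
      · exact hcon (Or.inr (Or.inl hxE))
      · exact hcon (Or.inr (Or.inr ⟨h', hxE⟩))
    have h1 : T (hf.toLp f) x = Tb x + T (hg.toLp g) x := by
      rw [hTb, hx]; ring
    have h2 : (t : ℝ≥0∞) < ‖T (hf.toLp f) x‖ₑ := hxt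
    have h3 : ‖T (hf.toLp f) x‖ₑ ≤ t := by
      rw [h1, hte, two_mul]
      exact (enorm_add_le _ _).trans (add_le_add (not_lt.1 n2) (not_lt.1 n1))
    exact absurd h2 (not_lt.2 h3)
  calc _ ≤ t * (volume {x | (h : ℝ≥0∞) < ‖T (hg.toLp g) x‖ₑ} + (volume E + volume W)) := by
        gcongr
        exact hsub.trans ((measure_union_le _ _).trans (by gcongr; exact measure_union_le _ _))
    _ ≤ 16 * ‖T‖ₑ ^ 2 * N + (9 * N + 4 * B * N) := by
        rw [mul_add, mul_add]
        exact add_le_add hG (add_le_add hE hW)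
    _ = _ := by ring

/-! ### Marcinkiewicz interpolation between L¹ and L². -/

/-- This and the next integral are what remains of the height s after Fubini: the part of f above
height s needs convergence at 0, hence p > 1, and the part below needs convergence at infinity,
hence p < 2. -/
theorem lintegral_Ioi_rpow_below {p a : ℝ} (hp : 1 < p) (ha : 0 ≤ a) :
    ∫⁻ s in Set.Ioi (0 : ℝ), ENNReal.ofReal (s ^ (p - 2)) * (if s < a then 1 else 0) =
      ENNReal.ofReal (a ^ (p - 1) / (p - 1)) := by
  have e : ∀ s : ℝ, ENNReal.ofReal (s ^ (p - 2)) * (if s < a then 1 else 0) =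
      (Set.Iio a).indicator (fun s => ENNReal.ofReal (s ^ (p - 2))) s := fun s => by
    by_cases h : s < a <;> simp [h]
  have hi : IntervalIntegrable (fun x : ℝ => x ^ (p - 2)) volume 0 a :=
    intervalIntegral.intervalIntegrable_rpow' (by linarith)
  rw [intervalIntegrable_iff_integrableOn_Ioc_of_le ha] at hi
  simp only [e]
  rw [setLIntegral_indicator measurableSet_Iio, Set.inter_comm, Set.Ioi_inter_Iio,
    setLIntegral_congr Ioo_ae_eq_Ioc,
    ← ofReal_integral_eq_lintegral_ofReal hi, ← intervalIntegral.integral_of_le ha,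
    integral_rpow (Or.inl (by linarith))]
  · congr 1
    rw [show p - 2 + 1 = p - 1 by ring, Real.zero_rpow (by linarith), sub_zero]
  · filter_upwards [ae_restrict_mem measurableSet_Ioc] with x hx
    exact Real.rpow_nonneg hx.1.le _

theorem lintegral_Ioi_rpow_above {p a : ℝ} (hp : p < 2) (ha : 0 < a) :
    ∫⁻ s in Set.Ioi (0 : ℝ), ENNReal.ofReal (s ^ (p - 3)) * (if s < a then 0 else 1) =
      ENNReal.ofReal (a ^ (p - 2) / (2 - p)) := by
  have e : ∀ s : ℝ, ENNReal.ofReal (s ^ (p - 3)) * (if s < a then 0 else 1) =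
      (Set.Ici a).indicator (fun s => ENNReal.ofReal (s ^ (p - 3))) s := fun s => by
    by_cases h : s < a
    · simp [h]
    · simp [h, not_lt.1 h]
  have hLs : Set.Ici a ∩ Set.Ioi 0 = Set.Ici a :=
    Set.inter_eq_left.2 fun x hx => lt_of_lt_of_le ha hx
  simp only [e]
  rw [setLIntegral_indicator measurableSet_Ici, hLs, setLIntegral_congr Ioi_ae_eq_Ici.symm,
    ← ofReal_integral_eq_lintegral_ofReal (integrableOn_Ioi_rpow_of_lt (by linarith) ha),
    integral_Ioi_rpow_of_lt (by linarith) ha]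
  · congr 1
    rw [show p - 3 + 1 = p - 2 by ring, neg_div, ← div_neg, neg_sub]
  · filter_upwards [ae_restrict_mem measurableSet_Ioi] with x hx
    exact Real.rpow_nonneg (ha.trans hx).le _

theorem enorm_mul_rpow_below {p : ℝ} (hp : 1 < p) (z : ℂ) :
    ‖z‖ₑ * ENNReal.ofReal (‖z‖ ^ (p - 1) / (p - 1)) = ENNReal.ofReal (1 / (p - 1)) * ‖z‖ₑ ^ p := by
  have hp' : 0 < p - 1 := by linarith
  rw [← ofReal_norm, ENNReal.ofReal_rpow_of_nonneg (norm_nonneg _) (by linarith),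
    ← ENNReal.ofReal_mul (norm_nonneg _), ← ENNReal.ofReal_mul (by positivity)]
  congr 1
  rcases (norm_nonneg z).eq_or_lt with h | h
  · rw [← h, Real.zero_rpow (by linarith : p ≠ 0)]; ring
  · rw [Real.rpow_sub_one h.ne']; field_simp

theorem enorm_mul_rpow_above {p : ℝ} (hp : p < 2) {z : ℂ} (hz : z ≠ 0) :
    ‖z‖ₑ ^ 2 * ENNReal.ofReal (‖z‖ ^ (p - 2) / (2 - p)) =
      ENNReal.ofReal (1 / (2 - p)) * ‖z‖ₑ ^ p := by
  have hp' : 0 < 2 - p := by linarith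
  have h : 0 < ‖z‖ := norm_pos_iff.2 hz
  rw [← ofReal_norm, ENNReal.ofReal_rpow_of_pos h, ← ENNReal.ofReal_pow (norm_nonneg _),
    ← ENNReal.ofReal_mul (by positivity), ← ENNReal.ofReal_mul (by positivity)]
  congr 1
  rw [Real.rpow_sub h, Real.rpow_two]
  field_simp

/-- Where |f| > s one has |f| ≤ |f|²/s, so the large part of an L² function is in L¹ and the weak
type estimate applies to it. -/
theorem integrable_large_part {f : ℝ × ℝ → ℂ} (hf : MemLp f 2) (hfm : Measurable f) {s : ℝ}
    (hs : 0 < s) : Integrable ({x | s < ‖f x‖}.indicator f) := by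
  have hm : MeasurableSet {x | s < ‖f x‖} := measurableSet_lt measurable_const hfm.norm
  refine (hf.integrable_norm_pow (by norm_num) |>.div_const s).mono'
    (hfm.indicator hm).aestronglyMeasurable (Eventually.of_forall fun x => ?_)
  dsimp only
  by_cases hx : x ∈ {x | s < ‖f x‖}
  · rw [Set.indicator_of_mem hx, le_div_iff₀ hs, sq]
    have : s < ‖f x‖ := hx
    gcongr
  · rw [Set.indicator_of_notMem hx, norm_zero]
    positivity

/-- The distribution function of `T f` is controlled by splitting `f` at height `s`. -/
theorem distribution_le {T : L2Plane →L[ℂ] L2Plane} {A : ℝ≥0∞}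
    (hA : ∀ (f : ℝ × ℝ → ℂ) (_ : Integrable f) (hf : MemLp f 2) (t : ℝ≥0), 0 < t →
      t * volume {x | (t : ℝ≥0∞) < ‖T (hf.toLp f) x‖ₑ} ≤ A * ∫⁻ x, ‖f x‖ₑ)
    {f : ℝ × ℝ → ℂ} (hf : MemLp f 2) (hfm : Measurable f) {p s : ℝ} (hs : 0 < s) :
    volume {x | s < ‖T (hf.toLp f) x‖ / 2} * ENNReal.ofReal (s ^ (p - 1)) ≤
      A * (∫⁻ x, ‖f x‖ₑ * (ENNReal.ofReal (s ^ (p - 2)) * if s < ‖f x‖ then 1 else 0)) +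
      ‖T‖ₑ ^ 2 *
        ∫⁻ x, ‖f x‖ₑ ^ 2 * (ENNReal.ofReal (s ^ (p - 3)) * if s < ‖f x‖ then 0 else 1) := by
  set S := {x | s < ‖f x‖} with hS
  have hSm : MeasurableSet S := measurableSet_lt measurable_const hfm.norm
  have h1 : MemLp (S.indicator f) 2 := hf.indicator hSm
  have h2 : MemLp (Sᶜ.indicator f) 2 := hf.indicator hSm.compl
  set t : ℝ≥0 := ⟨s, hs.le⟩ with ht
  have ht0 : (t : ℝ≥0∞) ≠ 0 := by
    rw [ENNReal.coe_ne_zero]; exact fun h => hs.ne' (congrArg NNReal.toReal h)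
  have hts : (t : ℝ≥0∞) = ENNReal.ofReal s := by
    rw [← ENNReal.ofReal_coe_nnreal]
    rfl
  have w1 := hA _ (integrable_large_part hf hfm hs) h1 t hs
  have w2 := (mul_meas_sq_le t (Lp.aestronglyMeasurable (T (h2.toLp _)))).trans
    (lintegral_sq_apply_le T h2)
  have hsub : volume {x | s < ‖T (hf.toLp f) x‖ / 2} ≤
      volume {x | (t : ℝ≥0∞) < ‖T (h1.toLp _) x‖ₑ} +
        volume {x | (t : ℝ≥0∞) < ‖T (h2.toLp _) x‖ₑ} := by
    refine le_trans (measure_mono_ae ?_) (measure_union_le _ _)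
    have hadd : hf.toLp f = (h1.add h2).toLp _ := by
      refine (MemLp.toLp_eq_toLp_iff _ _).2 (Eventually.of_forall fun x => ?_)
      exact (congrFun (Set.indicator_self_add_compl S f) x).symm
    filter_upwards [toLp_add_apply T h1 h2] with x hx hxs
    have hlt : ∀ z : ℂ, (t : ℝ≥0∞) < ‖z‖ₑ ↔ s < ‖z‖ := fun z => by
      rw [hts, ← ofReal_norm, ENNReal.ofReal_lt_ofReal_iff_of_nonneg hs.le]
    by_contra hcon
    have n1 : ¬ s < ‖T (h1.toLp _) x‖ := fun h' => hcon (Or.inl ((hlt _).2 h'))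
    have n2 : ¬ s < ‖T (h2.toLp _) x‖ := fun h' => hcon (Or.inr ((hlt _).2 h'))
    have h3 : s < ‖T (hf.toLp f) x‖ / 2 := hxs
    rw [hadd, hx] at h3
    have := norm_add_le (T (h1.toLp _) x) (T (h2.toLp _) x)
    linarith
  have e1 : ∫⁻ x, ‖S.indicator f x‖ₑ = ∫⁻ x, ‖f x‖ₑ * (if s < ‖f x‖ then 1 else 0) := by
    refine lintegral_congr fun x => ?_
    by_cases hx : s < ‖f x‖ <;> simp [hS, hx]
  have e2 : ∫⁻ x, ‖Sᶜ.indicator f x‖ₑ ^ 2 =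
      ∫⁻ x, ‖f x‖ₑ ^ 2 * (if s < ‖f x‖ then 0 else 1) := by
    refine lintegral_congr fun x => ?_
    by_cases hx : s < ‖f x‖ <;> simp [hS, hx]
  rw [e1] at w1
  rw [e2] at w2
  have f1 : ∫⁻ x, ‖f x‖ₑ * (ENNReal.ofReal (s ^ (p - 2)) * if s < ‖f x‖ then 1 else 0) =
      ENNReal.ofReal (s ^ (p - 2)) * ∫⁻ x, ‖f x‖ₑ * (if s < ‖f x‖ then 1 else 0) := by
    rw [← lintegral_const_mul' _ _ ENNReal.ofReal_ne_top]
    exact lintegral_congr fun x => by ring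
  have f2 : ∫⁻ x, ‖f x‖ₑ ^ 2 * (ENNReal.ofReal (s ^ (p - 3)) * if s < ‖f x‖ then 0 else 1) =
      ENNReal.ofReal (s ^ (p - 3)) * ∫⁻ x, ‖f x‖ₑ ^ 2 * (if s < ‖f x‖ then 0 else 1) := by
    rw [← lintegral_const_mul' _ _ ENNReal.ofReal_ne_top]
    exact lintegral_congr fun x => by ring
  -- The weak type estimate consumes one power of s, the L² Chebyshev estimate two.
  have r1 : ENNReal.ofReal (s ^ (p - 1)) = ENNReal.ofReal (s ^ (p - 2)) * t := by
    rw [hts, ← ENNReal.ofReal_mul (by positivity), ← Real.rpow_add_one hs.ne']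
    ring_nf
  have r2 : ENNReal.ofReal (s ^ (p - 1)) = ENNReal.ofReal (s ^ (p - 3)) * t ^ 2 := by
    rw [hts, ← ENNReal.ofReal_pow hs.le, ← ENNReal.ofReal_mul (by positivity),
      ← Real.rpow_two,
      ← Real.rpow_add hs]
    ring_nf
  refine (mul_le_mul_left hsub _).trans ?_
  rw [add_mul, f1, f2]
  refine add_le_add ?_ ?_
  · rw [r1]
    calc _ = ENNReal.ofReal (s ^ (p - 2)) * (t * volume {x | (t : ℝ≥0∞) < ‖T (h1.toLp _) x‖ₑ}) := by
          ring
      _ ≤ ENNReal.ofReal (s ^ (p - 2)) * (A * _) := by gcongr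
      _ = _ := by ring
  · rw [r2]
    calc _ = ENNReal.ofReal (s ^ (p - 3)) *
          (t ^ 2 * volume {x | (t : ℝ≥0∞) < ‖T (h2.toLp _) x‖ₑ}) := by ring
      _ ≤ ENNReal.ofReal (s ^ (p - 3)) * (‖T‖ₑ ^ 2 * _) := by gcongr
      _ = _ := by ring

/-- Marcinkiewicz interpolation between the weak type `(1, 1)` and the strong type `(2, 2)`. -/
theorem strong_type_of_lt_two {T : L2Plane →L[ℂ] L2Plane} {A : ℝ≥0∞}
    (hA : ∀ (f : ℝ × ℝ → ℂ) (_ : Integrable f) (hf : MemLp f 2) (t : ℝ≥0), 0 < t →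
      t * volume {x | (t : ℝ≥0∞) < ‖T (hf.toLp f) x‖ₑ} ≤ A * ∫⁻ x, ‖f x‖ₑ)
    (hA' : A ≠ ∞) {p : ℝ} (hp : 1 < p) (hp' : p < 2) :
    ∃ C : ℝ≥0, ∀ f : L2Plane, ∫⁻ x, ‖T f x‖ₑ ^ p ≤ C * ∫⁻ x, ‖f x‖ₑ ^ p := by
  set D : ℝ≥0∞ := 2 ^ p * (ENNReal.ofReal p * (A * ENNReal.ofReal (1 / (p - 1)) +
    ‖T‖ₑ ^ 2 * ENNReal.ofReal (1 / (2 - p)))) with hD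
  have hDt : D ≠ ∞ := by
    have : (2 : ℝ≥0∞) ^ p ≠ ∞ := ENNReal.rpow_ne_top_of_nonneg (by linarith) (by norm_num)
    finiteness
  refine ⟨D.toNNReal, fun f => ?_⟩
  rw [ENNReal.coe_toNNReal hDt]
  have hfm : Measurable f := (Lp.stronglyMeasurable f).measurable
  have hf : MemLp f 2 := Lp.memLp f
  have hff : hf.toLp f = f := Lp.toLp_coeFn f hf
  have hd := fun (s : ℝ) (hs : 0 < s) => distribution_le hA hf hfm (p := p) hs
  rw [hff] at hd
  have hhm : Measurable (T f) := (Lp.stronglyMeasurable (T f)).measurable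
  -- The layer cake formula is applied to |Tf|/2, the halving that the splitting of f requires; this
  -- is the factor 2^p in D.
  have hlc := lintegral_rpow_eq_lintegral_meas_lt_mul (volume : Measure (ℝ × ℝ))
    (f := fun x => ‖T f x‖ / 2) (Eventually.of_forall fun x => by positivity)
    (hhm.norm.div_const 2).aemeasurable (p := p) (by linarith)
  have i1 : ∫⁻ s in Set.Ioi (0 : ℝ), ∫⁻ x, ‖f x‖ₑ *
      (ENNReal.ofReal (s ^ (p - 2)) * if s < ‖f x‖ then 1 else 0) =
      ENNReal.ofReal (1 / (p - 1)) * ∫⁻ x, ‖f x‖ₑ ^ p := by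
    rw [lintegral_lintegral_swap]
    · rw [← lintegral_const_mul' _ _ ENNReal.ofReal_ne_top]
      refine lintegral_congr fun x => ?_
      rw [lintegral_const_mul' _ _ (by simp), lintegral_Ioi_rpow_below hp (norm_nonneg _),
        enorm_mul_rpow_below hp]
    · refine Measurable.aemeasurable ?_
      refine (hfm.comp measurable_snd).enorm.mul (Measurable.mul (by fun_prop) ?_)
      exact Measurable.ite (measurableSet_lt measurable_fst (hfm.comp measurable_snd).norm)
        measurable_const measurable_const
  have i2 : ∫⁻ s in Set.Ioi (0 : ℝ), ∫⁻ x, ‖f x‖ₑ ^ 2 *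
      (ENNReal.ofReal (s ^ (p - 3)) * if s < ‖f x‖ then 0 else 1) =
      ENNReal.ofReal (1 / (2 - p)) * ∫⁻ x, ‖f x‖ₑ ^ p := by
    rw [lintegral_lintegral_swap]
    · rw [← lintegral_const_mul' _ _ ENNReal.ofReal_ne_top]
      refine lintegral_congr fun x => ?_
      rw [lintegral_const_mul' _ _ (by simp)]
      -- At zeros of f the inner integral diverges, but it is multiplied by 0.
      by_cases h0 : f x = 0
      · simp [h0, show 0 < p by linarith]
      · rw [lintegral_Ioi_rpow_above hp' (norm_pos_iff.2 h0), enorm_mul_rpow_above hp' h0]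
    · refine Measurable.aemeasurable ?_
      refine ((hfm.comp measurable_snd).enorm.pow_const 2).mul (Measurable.mul (by fun_prop) ?_)
      exact Measurable.ite (measurableSet_lt measurable_fst (hfm.comp measurable_snd).norm)
        measurable_const measurable_const
  have m1 : Measurable fun s : ℝ => A * ∫⁻ x, ‖f x‖ₑ *
      (ENNReal.ofReal (s ^ (p - 2)) * if s < ‖f x‖ then 1 else 0) := by
    refine Measurable.const_mul (Measurable.lintegral_prod_right' (f := fun z : ℝ × (ℝ × ℝ) =>
      ‖f z.2‖ₑ * (ENNReal.ofReal (z.1 ^ (p - 2)) * if z.1 < ‖f z.2‖ then 1 else 0)) ?_) _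
    refine (hfm.comp measurable_snd).enorm.mul (Measurable.mul (by fun_prop) ?_)
    exact Measurable.ite (measurableSet_lt measurable_fst (hfm.comp measurable_snd).norm)
      measurable_const measurable_const
  have e0 : ∀ z : ℂ, ‖z‖ₑ ^ p = 2 ^ p * ENNReal.ofReal ((‖z‖ / 2) ^ p) := fun z => by
    rw [← ENNReal.ofReal_rpow_of_nonneg (by positivity) (by linarith),
      ← ENNReal.mul_rpow_of_nonneg _ _ (by linarith), ← ENNReal.ofReal_ofNat 2,
      ← ENNReal.ofReal_mul (by norm_num), mul_div_cancel₀ _ (by norm_num), ofReal_norm]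
  simp only [e0 (T f _)]
  rw [lintegral_const_mul' _ _ (ENNReal.rpow_ne_top_of_nonneg (by linarith) (by norm_num)), hlc, hD,
    mul_assoc, mul_assoc]
  refine mul_le_mul_right (mul_le_mul_right ?_ _) _
  calc _ ≤ ∫⁻ s in Set.Ioi (0 : ℝ), (A * (∫⁻ x, ‖f x‖ₑ *
          (ENNReal.ofReal (s ^ (p - 2)) * if s < ‖f x‖ then 1 else 0)) +
      ‖T‖ₑ ^ 2 *
        ∫⁻ x, ‖f x‖ₑ ^ 2 * (ENNReal.ofReal (s ^ (p - 3)) * if s < ‖f x‖ then 0 else 1)) :=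
        setLIntegral_mono' measurableSet_Ioi fun s hs => hd s hs
    _ = _ := by
        rw [lintegral_add_left m1, lintegral_const_mul' _ _ hA', lintegral_const_mul' _ _ (by finiteness),
          i1, i2]
        ring

/-! ### Duality: exponents above 2. -/

theorem norm_phase (W : Set (ℝ × ℝ)) (h : ℝ × ℝ → ℂ) (x : ℝ × ℝ) :
    ‖phase W h x‖ ≤ 1 := by
  by_cases hx : x ∈ W
  · simp only [phase, hx, Set.indicator_of_mem, norm_div, RCLike.norm_conj, Complex.norm_real,
      norm_norm]
    exact div_self_le_one _
  · simp [phase, hx]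

/-- Test Tf against g, equal on W to |Tf|^(p-1) times the conjugate phase and zero elsewhere. As Tf
is bounded on W and W has finite measure, g is in L², so T can be transposed. Hölder gives I ≤
X^(1/p) (C I)^(1/q) for I the integral of |Tf|^p over W and X that of |f|^p over the plane. -/
theorem strong_type_dual_aux {T T' : L2Plane →L[ℂ] L2Plane}
    (hTT : ∀ f g : L2Plane, ∫ x, T f x * g x = ∫ x, f x * T' g x) {p q : ℝ}
    (hpq : p.HolderConjugate q) {C : ℝ≥0}
    (hC : ∀ f : L2Plane, ∫⁻ x, ‖T' f x‖ₑ ^ q ≤ C * ∫⁻ x, ‖f x‖ₑ ^ q) (f : L2Plane)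
    {W : Set (ℝ × ℝ)} (hW : MeasurableSet W) (hW' : volume W ≠ ∞) {M : ℝ}
    (hM : ∀ x ∈ W, ‖T f x‖ ≤ M) :
    ∫⁻ x in W, ‖T f x‖ₑ ^ p ≤ (C : ℝ≥0∞) ^ (p - 1) * ∫⁻ x, ‖f x‖ₑ ^ p := by
  have hp := hpq.lt
  have hp1 : 0 < p - 1 := by linarith
  set h := T f
  have hhm : Measurable h := (Lp.stronglyMeasurable h).measurable
  set g : ℝ × ℝ → ℂ := fun x => phase W h x * ((‖h x‖ ^ (p - 1) : ℝ) : ℂ) with hg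
  have hgn : ∀ x, ‖g x‖ₑ ≤ W.indicator (fun x => ‖h x‖ₑ ^ (p - 1)) x := by
    intro x
    rw [hg, enorm_mul]
    have h1 := enorm_phase_le W h x
    have h2 : ‖((‖h x‖ ^ (p - 1) : ℝ) : ℂ)‖ₑ = ‖h x‖ₑ ^ (p - 1) := by
      rw [← ofReal_norm, Complex.norm_real, Real.norm_of_nonneg (by positivity),
        ← ENNReal.ofReal_rpow_of_nonneg (norm_nonneg _) hp1.le, ofReal_norm]
    rw [h2]
    by_cases hx : x ∈ W
    · simp only [hx, Set.indicator_of_mem, Pi.one_apply] at h1 ⊢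
      exact mul_le_of_le_one_left' h1
    · simp [phase, hx]
  have hgm : Measurable g := by
    refine Measurable.mul (Measurable.indicator ?_ hW) ?_
    · fun_prop
    · exact Complex.measurable_ofReal.comp (hhm.norm.pow_const _)
  have hg2 : MemLp g 2 := by
    refine (memLp_indicator_const 2 hW ((M ^ (p - 1) : ℝ) : ℂ) (Or.inr hW')).of_le
      hgm.aestronglyMeasurable (Eventually.of_forall fun x => ?_)
    by_cases hx : x ∈ W
    · have h0 : 0 ≤ M := (norm_nonneg _).trans (hM x hx)
      rw [Set.indicator_of_mem hx, hg, norm_mul, Complex.norm_real, Complex.norm_real,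
        Real.norm_of_nonneg (by positivity), Real.norm_of_nonneg (by positivity)]
      calc _ ≤ 1 * M ^ (p - 1) := by
            gcongr
            · exact norm_phase W h x
            · exact hM x hx
        _ = _ := one_mul _
    · simp [hg, phase, hx]
  set I := ∫⁻ x in W, ‖h x‖ₑ ^ p with hI
  set X := ∫⁻ x, ‖f x‖ₑ ^ p
  -- The truncation to W serves this: a finite I can be cancelled from the inequality it satisfies.
  have hIt : I ≠ ∞ := by
    have : I ≤ ∫⁻ x in W, ENNReal.ofReal M ^ p := by
      refine setLIntegral_mono' hW fun x hx => ?_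
      gcongr
      exact enorm_le_ofReal (hM x hx)
    refine (this.trans_lt ?_).ne
    rw [setLIntegral_const]
    exact ENNReal.mul_lt_top (ENNReal.rpow_lt_top_of_nonneg (by linarith) (by simp)) hW'.lt_top
  have hgq : ∫⁻ x, ‖hg2.toLp g x‖ₑ ^ q ≤ I := by
    calc _ ≤ ∫⁻ x, W.indicator (fun x => ‖h x‖ₑ ^ p) x := by
          refine lintegral_mono_ae ?_
          filter_upwards [hg2.coeFn_toLp] with x hx
          rw [hx]
          refine (ENNReal.rpow_le_rpow (hgn x) hpq.symm.nonneg).trans (le_of_eq ?_)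
          by_cases hx : x ∈ W
          · simp only [hx, Set.indicator_of_mem]
            rw [← ENNReal.rpow_mul, hpq.sub_one_mul_conj]
          · simp [hx, hpq.symm.pos]
      _ = I := lintegral_indicator hW _
  have hmain : I ≤ X ^ (1 / p) * (C * I) ^ (1 / q) := by
    have e1 : I = ‖∫ x, h x * hg2.toLp g x‖ₑ := by
      have e2 : ∫ x, h x * hg2.toLp g x = ((∫ x in W, ‖h x‖ ^ p : ℝ) : ℂ) := by
        rw [← integral_complex_ofReal, ← integral_indicator hW]
        refine integral_congr_ae ?_
        filter_upwards [hg2.coeFn_toLp] with x hx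
        rw [hx, hg, ← mul_assoc, mul_phase]
        by_cases hxW : x ∈ W
        · simp only [hxW, Set.indicator_of_mem]
          rw [← Complex.ofReal_mul]
          congr 1
          rcases (norm_nonneg (h x)).eq_or_lt with h0 | h0
          · rw [← h0, Real.zero_rpow (by linarith : p ≠ 0), zero_mul]
          · rw [Real.rpow_sub_one h0.ne', mul_div_cancel₀ _ h0.ne']
        · simp [hxW]
      rw [e2, ← ofReal_norm, Complex.norm_real,
        Real.norm_of_nonneg (integral_nonneg fun _ => by positivity),
        integral_eq_lintegral_of_nonneg_ae (Eventually.of_forall fun x => by positivity)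
          (hhm.norm.pow_const p).aestronglyMeasurable]
      have e3 : ∀ x, ENNReal.ofReal (‖h x‖ ^ p) = ‖h x‖ₑ ^ p := fun x => by
        rw [← ENNReal.ofReal_rpow_of_nonneg (norm_nonneg _) (by linarith), ofReal_norm]
      simp only [e3]
      rw [ENNReal.ofReal_toReal hIt]
    calc I = ‖∫ x, f x * T' (hg2.toLp g) x‖ₑ := by rw [e1, hTT]
      _ ≤ ∫⁻ x, ‖f x‖ₑ * ‖T' (hg2.toLp g) x‖ₑ := by
          refine (enorm_integral_le_lintegral_enorm _).trans (le_of_eq ?_)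
          exact lintegral_congr fun x => enorm_mul _ _
      _ ≤ X ^ (1 / p) * (∫⁻ x, ‖T' (hg2.toLp g) x‖ₑ ^ q) ^ (1 / q) :=
          ENNReal.lintegral_mul_le_Lp_mul_Lq volume hpq (Lp.aestronglyMeasurable _).enorm
            (Lp.aestronglyMeasurable _).enorm
      _ ≤ _ := by
          have := hpq.symm.nonneg
          gcongr
          exact (hC _).trans (by gcongr)
  rcases eq_or_ne I 0 with hI0 | hI0
  · rw [hI0]; exact zero_le
  have h1 := ENNReal.rpow_le_rpow hmain (by linarith : 0 ≤ p)
  -- Raising to the power p leaves I^p ≤ X C^(p-1) I^(p-1), from which I^(p-1) is divided out.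
  have hpq' : 1 / q * p = p - 1 := by
    have := hpq.div_conj_eq_sub_one
    rw [← this]; ring
  rw [ENNReal.mul_rpow_of_nonneg _ _ (by linarith), ← ENNReal.rpow_mul, ← ENNReal.rpow_mul, hpq',
    one_div_mul_cancel (by linarith), ENNReal.rpow_one, ENNReal.mul_rpow_of_nonneg _ _ hp1.le] at h1
  have h2 : I ^ p = I * I ^ (p - 1) := by
    conv_lhs => rw [show p = 1 + (p - 1) by ring]
    rw [ENNReal.rpow_add _ _ hI0 hIt, ENNReal.rpow_one]
  rw [h2, ← mul_assoc] at h1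
  have h3 := (ENNReal.mul_le_mul_iff_left (ENNReal.rpow_pos (pos_iff_ne_zero.2 hI0) hIt).ne'
    (ENNReal.rpow_ne_top_of_nonneg hp1.le hIt)).1 h1
  rwa [mul_comm X] at h3

/-- An `L^q` estimate for the transposed operator gives an `L^p` estimate for the operator. -/
theorem strong_type_dual {T T' : L2Plane →L[ℂ] L2Plane}
    (hTT : ∀ f g : L2Plane, ∫ x, T f x * g x = ∫ x, f x * T' g x) {p q : ℝ}
    (hpq : p.HolderConjugate q)
    (hC : ∃ C : ℝ≥0, ∀ f : L2Plane, ∫⁻ x, ‖T' f x‖ₑ ^ q ≤ C * ∫⁻ x, ‖f x‖ₑ ^ q) :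
    ∃ C : ℝ≥0, ∀ f : L2Plane, ∫⁻ x, ‖T f x‖ₑ ^ p ≤ C * ∫⁻ x, ‖f x‖ₑ ^ p := by
  obtain ⟨C, hC⟩ := hC
  refine ⟨C ^ (p - 1), fun f => ?_⟩
  rw [ENNReal.coe_rpow_of_nonneg _ (by linarith [hpq.lt])]
  have hhm : Measurable (T f) := (Lp.stronglyMeasurable (T f)).measurable
  -- Truncation in space and in height; the bound is uniform in n and passes to the plane by
  -- monotone convergence.
  set W : ℕ → Set (ℝ × ℝ) := fun n => Metric.ball 0 n ∩ {x | ‖T f x‖ ≤ n} with hW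
  have hWm : ∀ n, MeasurableSet (W n) := fun n =>
    Metric.isOpen_ball.measurableSet.inter (measurableSet_le hhm.norm measurable_const)
  have hmono : Monotone W := fun m n hmn x hx => by
    have : (m : ℝ) ≤ n := by exact_mod_cast hmn
    exact ⟨Metric.ball_subset_ball this hx.1, le_trans (show ‖T f x‖ ≤ m from hx.2) this⟩
  have hU : ⋃ n, W n = Set.univ := by
    refine Set.eq_univ_of_forall fun x => ?_
    obtain ⟨n, hn⟩ := exists_nat_gt (max (dist x 0) ‖T f x‖)
    exact Set.mem_iUnion.2 ⟨n, (le_max_left _ _).trans_lt hn, ((le_max_right _ _).trans_lt hn).le⟩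
  rw [← setLIntegral_univ, ← hU, setLIntegral_iUnion_of_directed _ hmono.directed_le]
  refine iSup_le fun n => ?_
  exact strong_type_dual_aux hTT hpq hC f (hWm n)
    (measure_ne_top_of_subset Set.inter_subset_left measure_ball_lt_top.ne) (M := n)
    fun x hx => hx.2

/-! ### Extension to L^p by density. -/

/-- The functions in `L²` that also belong to `L^p`. -/
def l2InterLp (p : ℝ≥0∞) : Submodule ℂ L2Plane where
  carrier := {f | MemLp f p volume}
  zero_mem' := MemLp.zero.ae_eq (Lp.coeFn_zero _ _ _).symm
  add_mem' := fun {f g} hf hg => (MemLp.add (f := f) (g := g) hf hg).ae_eq (Lp.coeFn_add f g).symm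
  smul_mem' := fun a f hf => (MemLp.const_smul (f := f) hf a).ae_eq (Lp.coeFn_smul a f).symm

theorem memLp_of_mem_l2InterLp {p : ℝ≥0∞} {f : L2Plane} (hf : f ∈ l2InterLp p) :
    MemLp f p volume := hf

/-- The inclusion of `L² ∩ L^p` into `L^p`. -/
noncomputable def l2InterLpToLp (p : ℝ≥0∞) :
    l2InterLp p →ₗ[ℂ] Lp ℂ p (volume : Measure (ℝ × ℝ)) where
  toFun f := MemLp.toLp (f : L2Plane) (memLp_of_mem_l2InterLp f.2)
  map_add' f g := by
    rw [← MemLp.toLp_add]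
    exact (MemLp.toLp_eq_toLp_iff _ _).2 (Lp.coeFn_add (f : L2Plane) g)
  map_smul' a f := by
    rw [RingHom.id_apply, ← MemLp.toLp_const_smul]
    exact (MemLp.toLp_eq_toLp_iff _ _).2 (Lp.coeFn_smul a (f : L2Plane))

/-- For 0 < p < ∞ a simple function is in L^p exactly when its support has finite measure, a
condition that does not involve p. The dense class of L^p simple functions therefore lies in L². -/
theorem denseRange_l2InterLpToLp {p : ℝ≥0∞} [Fact (1 ≤ p)] (hp : p ≠ ∞) :
    DenseRange (l2InterLpToLp p) := by
  refine (Lp.simpleFunc.denseRange (E := ℂ) (μ := (volume : Measure (ℝ × ℝ))) hp).mono ?_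
  rintro _ ⟨φ, rfl⟩
  have hp0 : p ≠ 0 := (lt_of_lt_of_le zero_lt_one (Fact.out : 1 ≤ p)).ne'
  have h1 := Lp.simpleFunc.memLp φ
  have h2 : MemLp (Lp.simpleFunc.toSimpleFunc φ) 2 volume :=
    (SimpleFunc.memLp_iff (by norm_num) (by norm_num)).2 ((SimpleFunc.memLp_iff hp0 hp).1 h1)
  have h3 : MemLp (h2.toLp _) p volume := h1.ae_eq h2.coeFn_toLp.symm
  refine ⟨⟨h2.toLp _, h3⟩, ?_⟩
  refine Lp.ext ?_
  filter_upwards [h3.coeFn_toLp, h2.coeFn_toLp, Lp.simpleFunc.toSimpleFunc_eq_toFun φ]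
    with x a b c
  exact a.trans (b.trans c)

theorem exists_restrict_l2InterLp (T : L2Plane →L[ℂ] L2Plane) {p : ℝ≥0∞}
    (hmem : ∀ f : l2InterLp p, MemLp (T f) p volume) :
    ∃ S : l2InterLp p →ₗ[ℂ] Lp ℂ p (volume : Measure (ℝ × ℝ)), ∀ f, S f = (hmem f).toLp _ := by
  refine ⟨{ toFun := fun f => (hmem f).toLp _, map_add' := fun f g => ?_,
            map_smul' := fun a f => ?_ }, fun f => rfl⟩
  · rw [← MemLp.toLp_add]
    refine (MemLp.toLp_eq_toLp_iff _ _).2 ?_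
    rw [Submodule.coe_add, map_add]
    exact Lp.coeFn_add _ _
  · rw [RingHom.id_apply, ← MemLp.toLp_const_smul]
    refine (MemLp.toLp_eq_toLp_iff _ _).2 ?_
    rw [Submodule.coe_smul, map_smul]
    exact Lp.coeFn_smul _ _

theorem exists_continuousLinearMap_extension {V X Y : Type*} [AddCommGroup V] [Module ℂ V]
    [NormedAddCommGroup X] [NormedSpace ℂ X] [NormedAddCommGroup Y] [NormedSpace ℂ Y]
    [CompleteSpace Y] (f : V →ₗ[ℂ] Y) (e : V →ₗ[ℂ] X) (he : DenseRange e) (D : ℝ)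
    (hD : ∀ v, ‖f v‖ ≤ D * ‖e v‖) : ∃ S : X →L[ℂ] Y, ∀ v, S (e v) = f v :=
  ⟨f.extendOfNorm e, LinearMap.extendOfNorm_eq he ⟨D, hD⟩⟩

theorem extendsLp_of_strong_type {T : L2Plane →L[ℂ] L2Plane} {p : ℝ≥0∞} [Fact (1 ≤ p)]
    (hp : p ≠ ∞)
    (hC : ∃ C : ℝ≥0, ∀ f : L2Plane, ∫⁻ x, ‖T f x‖ₑ ^ p.toReal ≤ C * ∫⁻ x, ‖f x‖ₑ ^ p.toReal) :
    ExtendsLp T p := by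
  obtain ⟨C, hC⟩ := hC
  have hp0 : p ≠ 0 := (lt_of_lt_of_le zero_lt_one (Fact.out : 1 ≤ p)).ne'
  have hpr : 0 < p.toReal := ENNReal.toReal_pos hp0 hp
  obtain ⟨D, hD⟩ : ∃ D : ℝ≥0, ∀ f : L2Plane, eLpNorm (T f) p volume ≤ D * eLpNorm f p volume := by
    refine ⟨C ^ (1 / p.toReal), fun f => ?_⟩
    rw [eLpNorm_eq_lintegral_rpow_enorm_toReal hp0 hp, eLpNorm_eq_lintegral_rpow_enorm_toReal hp0 hp,
      ENNReal.coe_rpow_of_nonneg _ (by positivity), ← ENNReal.mul_rpow_of_nonneg _ _ (by positivity)]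
    gcongr
    exact hC f
  have hmem : ∀ f : l2InterLp p, MemLp (T f) p volume := fun f =>
    ⟨Lp.aestronglyMeasurable _, (hD f).trans_lt
      (ENNReal.mul_lt_top (by simp) (memLp_of_mem_l2InterLp f.2).2)⟩
  obtain ⟨S₀, hS₀⟩ := exists_restrict_l2InterLp T hmem
  have hnorm : ∀ f, ‖S₀ f‖ ≤ D * ‖l2InterLpToLp p f‖ := by
    intro f
    have hf := memLp_of_mem_l2InterLp f.2
    have h2 : l2InterLpToLp p f = hf.toLp _ := rfl
    rw [hS₀, h2, Lp.norm_toLp, Lp.norm_toLp, ← ENNReal.coe_toReal, ← ENNReal.toReal_mul]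
    exact ENNReal.toReal_mono (ENNReal.mul_ne_top (by simp) hf.2.ne) (hD f)
  obtain ⟨S, hS⟩ := exists_continuousLinearMap_extension S₀ (l2InterLpToLp p)
    (denseRange_l2InterLpToLp hp) D hnorm
  refine ⟨S, fun f h2 h => ?_⟩
  have h3 : MemLp (h2.toLp f) p volume := h.ae_eq h2.coeFn_toLp.symm
  obtain ⟨F, hF⟩ : ∃ F : l2InterLp p, (F : L2Plane) = h2.toLp f := ⟨⟨h2.toLp f, h3⟩, rfl⟩
  have h6 : f =ᵐ[volume] (F : L2Plane) := by rw [hF]; exact h2.coeFn_toLp.symm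
  have hFm : MemLp (F : L2Plane) p volume := memLp_of_mem_l2InterLp F.2
  have h4 : h.toLp f = hFm.toLp (F : L2Plane) := (MemLp.toLp_eq_toLp_iff h hFm).2 h6
  have h7 : hFm.toLp (F : L2Plane) = l2InterLpToLp p F := rfl
  have h5 : S (h.toLp f) = (hmem F).toLp _ := by
    rw [h4, h7, hS, hS₀]
  rw [h5, ← hF]
  exact (hmem F).coeFn_toLp

theorem strong_type_of_hasOffDiagonalBound {T : L2Plane →L[ℂ] L2Plane} {B : ℝ≥0}
    (hB : HasOffDiagonalBound T B) {p : ℝ} (hp : 1 < p) (hp2 : p < 2) :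
    ∃ C : ℝ≥0, ∀ f : L2Plane, ∫⁻ x, ‖T f x‖ₑ ^ p ≤ C * ∫⁻ x, ‖f x‖ₑ ^ p :=
  strong_type_of_lt_two (fun _ hf1 hf _ ht => weak_type_one_one hB hf1 hf ht)
    (by finiteness) hp hp2

theorem extendsLp_of_hasOffDiagonalBound {T T' : L2Plane →L[ℂ] L2Plane}
    (hTT : ∀ f g : L2Plane, ∫ x, T f x * g x = ∫ x, f x * T' g x) {B B' : ℝ≥0}
    (hB : HasOffDiagonalBound T B) (hB' : HasOffDiagonalBound T' B') {p : ℝ≥0∞} [Fact (1 ≤ p)]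
    (hp : 1 < p) (hp' : p < ∞) : ExtendsLp T p := by
  refine extendsLp_of_strong_type hp'.ne ?_
  have hr : 1 < p.toReal := by
    rw [← ENNReal.toReal_one]
    exact (ENNReal.toReal_lt_toReal ENNReal.one_ne_top hp'.ne).2 hp
  rcases lt_trichotomy p.toReal 2 with h | h | h
  · exact strong_type_of_hasOffDiagonalBound hB hr h
  · refine ⟨‖T‖₊ ^ 2, fun f => ?_⟩
    have h1 := lintegral_sq_apply_le T (Lp.memLp f)
    rw [Lp.toLp_coeFn] at h1
    rw [h]
    simp only [ENNReal.rpow_ofNat]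
    push_cast
    exact h1
  -- For p > 2 the conjugate exponent lies in (1, 2), where interpolation applies to the transpose.
  · have hpq := Real.HolderConjugate.conjExponent hr
    refine strong_type_dual hTT hpq (strong_type_of_hasOffDiagonalBound hB' hpq.symm.lt ?_)
    rw [Real.conjExponent, div_lt_iff₀ (by linarith)]
    linarith

/-! ### Extension from L¹ to weak L¹. -/

/-- The weak type `(1, 1)` estimate with constant `A` on `L¹ ∩ L²`. -/
def HasWeakType (T : L2Plane →L[ℂ] L2Plane) (A : ℝ≥0) : Prop :=
  ∀ f : L2Plane, Integrable f → ∀ t : ℝ≥0,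
    t * volume {x | (t : ℝ≥0∞) < ‖T f x‖ₑ} ≤ A * ∫⁻ x, ‖f x‖ₑ

theorem exists_hasWeakType {T : L2Plane →L[ℂ] L2Plane} {B : ℝ≥0}
    (hB : HasOffDiagonalBound T B) : ∃ A, HasWeakType T A := by
  refine ⟨16 * ‖T‖₊ ^ 2 + 9 + 4 * B, fun f hf t => ?_⟩
  rcases eq_or_lt_of_le (zero_le : 0 ≤ t) with h | h
  · simp [← h]
  have := weak_type_one_one hB hf (Lp.memLp f) h
  rw [Lp.toLp_coeFn] at this
  push_cast
  exact this

/-- A sequence in `L¹ ∩ L²` that converges to `f` in `L¹` at a geometric rate. -/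
def IsRapidlyConvergent (φ : ℕ → L2Plane) (f : ℝ × ℝ → ℂ) : Prop :=
  (∀ n, Integrable (φ n)) ∧ ∃ A : ℝ≥0, ∀ n, ∫⁻ x, ‖φ n x - f x‖ₑ ≤ A * (4⁻¹ : ℝ≥0∞) ^ n

/-- Borel–Cantelli. The set where |Tφₙ| > 2^(-n) has measure at most BA 4^(-n)/2^(-n) = BA 2^(-n),
which is summable; the rate 4^(-n) leaves room for both the threshold and the measure. -/
theorem HasWeakType.ae_summable {T : L2Plane →L[ℂ] L2Plane} {B : ℝ≥0} (hT : HasWeakType T B)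
    {φ : ℕ → L2Plane} (hφ : ∀ n, Integrable (φ n)) {A : ℝ≥0}
    (hA : ∀ n, ∫⁻ x, ‖φ n x‖ₑ ≤ A * (4⁻¹ : ℝ≥0∞) ^ n) :
    ∀ᵐ x, Summable fun n => ‖T (φ n) x‖ := by
  set s : ℕ → Set (ℝ × ℝ) := fun n => {x | (((2⁻¹ : ℝ≥0) ^ n : ℝ≥0) : ℝ≥0∞) < ‖T (φ n) x‖ₑ}
  have hs : ∀ n, volume (s n) ≤ B * A * (2⁻¹ : ℝ≥0∞) ^ n := fun n => by
    have h1 := (hT (φ n) (hφ n) (2⁻¹ ^ n)).trans (mul_le_mul_right (hA n) _)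
    have h2 : (((2⁻¹ : ℝ≥0) ^ n : ℝ≥0) : ℝ≥0∞) = (2⁻¹ : ℝ≥0∞) ^ n := by
      rw [ENNReal.coe_pow, ENNReal.coe_inv (by norm_num)]; norm_num
    have h3 : (4⁻¹ : ℝ≥0∞) ^ n = (2⁻¹ : ℝ≥0∞) ^ n * (2⁻¹ : ℝ≥0∞) ^ n := by
      rw [← mul_pow, ← ENNReal.mul_inv (by norm_num) (by norm_num)]; norm_num
    have h4 : (2⁻¹ : ℝ≥0∞) ^ n ≠ 0 := by simp
    have h5 : (2⁻¹ : ℝ≥0∞) ^ n ≠ ∞ := by finiteness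
    rw [h3] at h1
    refine (ENNReal.mul_le_mul_iff_right h4 h5).1 ?_
    calc _ = (((2⁻¹ : ℝ≥0) ^ n : ℝ≥0) : ℝ≥0∞) * volume (s n) := by rw [h2]
      _ ≤ _ := h1
      _ = _ := by ring
  have hsum : ∑' n, volume (s n) ≠ ∞ := by
    refine ne_top_of_le_ne_top ?_ (ENNReal.tsum_le_tsum hs)
    rw [ENNReal.tsum_mul_left, ENNReal.tsum_geometric]
    refine ENNReal.mul_ne_top (by finiteness) ?_
    rw [ENNReal.one_sub_inv_two, inv_inv]
    norm_num
  filter_upwards [ae_eventually_notMem hsum] with x hx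
  refine Summable.of_norm_bounded_eventually_nat (g := fun n => (2⁻¹ : ℝ) ^ n)
    (summable_geometric_of_lt_one (by norm_num) (by norm_num)) ?_
  filter_upwards [hx] with n hn
  have h1 : ‖T (φ n) x‖ₑ ≤ (((2⁻¹ : ℝ≥0) ^ n : ℝ≥0) : ℝ≥0∞) := not_lt.1 hn
  rw [enorm_le_coe] at h1
  rw [norm_norm]
  have h2 := NNReal.coe_le_coe.2 h1
  simpa using h2

theorem lintegral_enorm_sub_le {f g h : ℝ × ℝ → ℂ} (hf : AEStronglyMeasurable f volume)
    (hg : AEStronglyMeasurable g volume) :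
    ∫⁻ x, ‖f x - h x‖ₑ ≤ (∫⁻ x, ‖f x - g x‖ₑ) + ∫⁻ x, ‖g x - h x‖ₑ := by
  rw [← lintegral_add_left' (f := fun x => ‖f x - g x‖ₑ) (hf.sub hg).enorm]
  refine lintegral_mono fun x => ?_
  calc ‖f x - h x‖ₑ = ‖(f x - g x) + (g x - h x)‖ₑ := by ring_nf
    _ ≤ _ := enorm_add_le _ _

/-- Consecutive differences also decay like 4^(-n) in L¹, so their images are summable almost
everywhere and the sequence telescopes. -/
theorem IsRapidlyConvergent.ae_exists_tendsto {T : L2Plane →L[ℂ] L2Plane} {B : ℝ≥0}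
    (hT : HasWeakType T B) {φ : ℕ → L2Plane} {f : ℝ × ℝ → ℂ} (hf : AEStronglyMeasurable f volume)
    (hφ : IsRapidlyConvergent φ f) : ∀ᵐ x, ∃ l, Tendsto (fun n => T (φ n) x) atTop (𝓝 l) := by
  obtain ⟨h1, A, hA⟩ := hφ
  have key := hT.ae_summable (φ := fun n => φ (n + 1) - φ n) (A := 2 * A)
    (fun n => ((h1 (n + 1)).sub (h1 n)).congr (Lp.coeFn_sub _ _).symm) fun n => ?_
  · filter_upwards [key, ae_all_iff.2 fun n => Lp.coeFn_sub (T (φ (n + 1))) (T (φ n))]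
      with x hx hsub
    have hx' : Summable fun n => T (φ (n + 1)) x - T (φ n) x := by
      refine Summable.of_norm (hx.congr fun n => ?_)
      rw [map_sub, hsub n]
      rfl
    obtain ⟨l, hl⟩ := hx'
    have := hl.tendsto_sum_nat
    simp only [Finset.sum_range_sub fun n => T (φ n) x] at this
    refine ⟨l + T (φ 0) x, ?_⟩
    simpa using this.add_const (T (φ 0) x)
  · calc _ = ∫⁻ x, ‖φ (n + 1) x - φ n x‖ₑ := by
          refine lintegral_congr_ae ?_
          filter_upwards [Lp.coeFn_sub (φ (n + 1)) (φ n)] with x hx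
          rw [hx]; rfl
      _ ≤ (∫⁻ x, ‖φ (n + 1) x - f x‖ₑ) + ∫⁻ x, ‖f x - φ n x‖ₑ :=
          lintegral_enorm_sub_le (h1 _).aestronglyMeasurable hf
      _ ≤ A * (4⁻¹ : ℝ≥0∞) ^ n + A * (4⁻¹ : ℝ≥0∞) ^ n := by
          refine add_le_add ((hA (n + 1)).trans ?_) ?_
          · refine mul_le_mul_right ?_ _
            exact pow_le_pow_right_of_le_one' (by simp [ENNReal.inv_le_one]) (Nat.le_succ n)
          · simp only [enorm_sub_rev (f _)]
            exact hA n
      _ = _ := by push_cast; ring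

/-- `h` is the almost everywhere limit of `T φₙ` for a rapidly convergent sequence `φₙ → f`. -/
def IsRapidLimit (T : L2Plane →L[ℂ] L2Plane) (f h : ℝ × ℝ → ℂ) : Prop :=
  ∃ φ, IsRapidlyConvergent φ f ∧ ∀ᵐ x, Tendsto (fun n => T (φ n) x) atTop (𝓝 (h x))

/-- The difference of two approximating sequences is summable after applying T, hence tends to 0.
Linearity of the extension and its agreement with T both follow from this uniqueness. -/
theorem IsRapidLimit.ae_eq {T : L2Plane →L[ℂ] L2Plane} {B : ℝ≥0} (hT : HasWeakType T B)
    {f h h' : ℝ × ℝ → ℂ} (hf : AEStronglyMeasurable f volume) (H : IsRapidLimit T f h)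
    (H' : IsRapidLimit T f h') : h =ᵐ[volume] h' := by
  obtain ⟨φ, ⟨h1, A, hA⟩, hφ⟩ := H
  obtain ⟨φ', ⟨h1', A', hA'⟩, hφ'⟩ := H'
  have key := hT.ae_summable (φ := fun n => φ n - φ' n) (A := A + A')
    (fun n => ((h1 n).sub (h1' n)).congr (Lp.coeFn_sub _ _).symm) fun n => ?_
  · filter_upwards [key, hφ, hφ', ae_all_iff.2 fun n => Lp.coeFn_sub (T (φ n)) (T (φ' n))]
      with x hx l1 l2 hsub
    have h3 := tendsto_zero_iff_norm_tendsto_zero.2 hx.tendsto_atTop_zero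
    have h4 : Tendsto (fun n => T (φ n) x - T (φ' n) x) atTop (𝓝 0) := by
      refine h3.congr fun n => ?_
      rw [map_sub, hsub n]
      rfl
    exact sub_eq_zero.1 (tendsto_nhds_unique (l1.sub l2) h4)
  · calc _ = ∫⁻ x, ‖φ n x - φ' n x‖ₑ := by
          refine lintegral_congr_ae ?_
          filter_upwards [Lp.coeFn_sub (φ n) (φ' n)] with x hx
          rw [hx]; rfl
      _ ≤ (∫⁻ x, ‖φ n x - f x‖ₑ) + ∫⁻ x, ‖f x - φ' n x‖ₑ :=
          lintegral_enorm_sub_le (h1 _).aestronglyMeasurable hf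
      _ ≤ A * (4⁻¹ : ℝ≥0∞) ^ n + A' * (4⁻¹ : ℝ≥0∞) ^ n := by
          refine add_le_add (hA n) ?_
          simp only [enorm_sub_rev (f _)]
          exact hA' n
      _ = _ := by push_cast; ring

theorem IsRapidLimit.add {T : L2Plane →L[ℂ] L2Plane} {f g h k : ℝ × ℝ → ℂ}
    (hf : AEStronglyMeasurable f volume) (H : IsRapidLimit T f h)
    (H' : IsRapidLimit T g k) : IsRapidLimit T (f + g) (h + k) := by
  obtain ⟨φ, ⟨h1, A, hA⟩, hφ⟩ := H
  obtain ⟨φ', ⟨h1', A', hA'⟩, hφ'⟩ := H'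
  refine ⟨fun n => φ n + φ' n, ⟨fun n => ((h1 n).add (h1' n)).congr (Lp.coeFn_add _ _).symm,
    A + A', fun n => ?_⟩, ?_⟩
  · calc _ = ∫⁻ x, ‖(φ n x - f x) + (φ' n x - g x)‖ₑ := by
          refine lintegral_congr_ae ?_
          filter_upwards [Lp.coeFn_add (φ n) (φ' n)] with x hx
          rw [hx, Pi.add_apply, Pi.add_apply]; ring_nf
      _ ≤ ∫⁻ x, ‖φ n x - f x‖ₑ + ‖φ' n x - g x‖ₑ := lintegral_mono fun x => enorm_add_le _ _
      _ = (∫⁻ x, ‖φ n x - f x‖ₑ) + ∫⁻ x, ‖φ' n x - g x‖ₑ :=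
          lintegral_add_left' ((h1 n).aestronglyMeasurable.sub hf).enorm _
      _ ≤ _ := add_le_add (hA n) (hA' n)
      _ = _ := by push_cast; ring
  · filter_upwards [hφ, hφ', ae_all_iff.2 fun n => Lp.coeFn_add (T (φ n)) (T (φ' n))]
      with x l1 l2 hadd
    refine (l1.add l2).congr fun n => ?_
    rw [map_add, hadd n]
    rfl

theorem IsRapidLimit.const_smul {T : L2Plane →L[ℂ] L2Plane} {f h : ℝ × ℝ → ℂ} (a : ℂ)
    (H : IsRapidLimit T f h) : IsRapidLimit T (a • f) (a • h) := by
  obtain ⟨φ, ⟨h1, A, hA⟩, hφ⟩ := H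
  refine ⟨fun n => a • φ n, ⟨fun n => ((h1 n).smul a).congr (Lp.coeFn_smul _ _).symm,
    ‖a‖₊ * A, fun n => ?_⟩, ?_⟩
  · calc _ = ∫⁻ x, ‖a‖ₑ * ‖φ n x - f x‖ₑ := by
          refine lintegral_congr_ae ?_
          filter_upwards [Lp.coeFn_smul a (φ n)] with x hx
          rw [hx, Pi.smul_apply, Pi.smul_apply, ← smul_sub, enorm_smul]
      _ = ‖a‖ₑ * ∫⁻ x, ‖φ n x - f x‖ₑ := lintegral_const_mul' _ _ (by simp)
      _ ≤ ‖a‖ₑ * (A * (4⁻¹ : ℝ≥0∞) ^ n) := by gcongr; exact hA n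
      _ = _ := by push_cast; rw [← mul_assoc]; rfl
  · filter_upwards [hφ, ae_all_iff.2 fun n => Lp.coeFn_smul a (T (φ n))] with x l1 hsmul
    refine (l1.const_smul a).congr fun n => ?_
    rw [map_smul, hsmul n]
    rfl

theorem exists_isRapidlyConvergent {f : ℝ × ℝ → ℂ} (hf : Integrable f) :
    ∃ φ, IsRapidlyConvergent φ f := by
  have key : ∀ n : ℕ, ∃ φ : L2Plane, Integrable φ ∧ ∫⁻ x, ‖φ x - f x‖ₑ ≤ (4⁻¹ : ℝ≥0∞) ^ n := by
    intro n
    obtain ⟨g, hg, hg1⟩ := (memLp_one_iff_integrable.2 hf).exists_simpleFunc_eLpNorm_sub_lt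
      (by norm_num) (ε := (4⁻¹ : ℝ≥0∞) ^ n) (by simp)
    have hg2 : MemLp g 2 volume :=
      (SimpleFunc.memLp_iff (by norm_num) (by norm_num)).2
        ((SimpleFunc.memLp_iff (by norm_num) (by norm_num)).1 hg1)
    refine ⟨hg2.toLp g, (memLp_one_iff_integrable.1 hg1).congr hg2.coeFn_toLp.symm, ?_⟩
    refine le_trans (le_of_eq ?_) hg.le
    rw [eLpNorm_one_eq_lintegral_enorm]
    refine lintegral_congr_ae ?_
    filter_upwards [hg2.coeFn_toLp] with x hx
    rw [hx, enorm_sub_rev]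
    rfl
  choose φ h1 h2 using key
  exact ⟨φ, h1, 1, fun n => by rw [ENNReal.coe_one, one_mul]; exact h2 n⟩

theorem exists_isRapidLimit {T : L2Plane →L[ℂ] L2Plane} {B : ℝ≥0} (hT : HasWeakType T B)
    {f : ℝ × ℝ → ℂ} (hf : Integrable f) :
    ∃ h : ℝ × ℝ →ₘ[volume] ℂ, IsRapidLimit T f h := by
  obtain ⟨φ, hφ⟩ := exists_isRapidlyConvergent hf
  obtain ⟨h, hm, hh⟩ := exists_stronglyMeasurable_limit_of_tendsto_ae
    (fun n => Lp.aestronglyMeasurable (T (φ n)))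
    (hφ.ae_exists_tendsto hT hf.aestronglyMeasurable)
  refine ⟨AEEqFun.mk h hm.aestronglyMeasurable, φ, hφ, ?_⟩
  filter_upwards [hh, AEEqFun.coeFn_mk h hm.aestronglyMeasurable] with x h1 h2
  rwa [h2]

/-- Because the inequality defining the level set is strict, its indicator is at most the lower
limit of those for Tφₙ; Fatou then transfers the weak type bound. -/
theorem IsRapidLimit.weakL1Norm_le {T : L2Plane →L[ℂ] L2Plane} {B : ℝ≥0} (hT : HasWeakType T B)
    {f h : ℝ × ℝ → ℂ} (hf : AEStronglyMeasurable f volume) (hh : Measurable h)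
    (H : IsRapidLimit T f h) : weakL1Norm h ≤ B * ∫⁻ x, ‖f x‖ₑ := by
  obtain ⟨φ, ⟨h1, A, hA⟩, hφ⟩ := H
  refine iSup_le fun t => ?_
  have hm : ∀ n, MeasurableSet {x | (t : ℝ≥0∞) < ‖T (φ n) x‖ₑ} := fun n =>
    measurableSet_lt measurable_const (Lp.stronglyMeasurable (T (φ n))).measurable.enorm
  have hs : MeasurableSet {x | (t : ℝ≥0∞) < ‖h x‖ₑ} := measurableSet_lt measurable_const hh.enorm
  have e1 : t * volume {x | (t : ℝ≥0∞) < ‖h x‖ₑ} ≤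
      liminf (fun n => t * volume {x | (t : ℝ≥0∞) < ‖T (φ n) x‖ₑ}) atTop := by
    calc _ = ∫⁻ x, {x | (t : ℝ≥0∞) < ‖h x‖ₑ}.indicator (fun _ => (t : ℝ≥0∞)) x :=
          (lintegral_indicator_const hs _).symm
      _ ≤ ∫⁻ x, liminf (fun n =>
          {x | (t : ℝ≥0∞) < ‖T (φ n) x‖ₑ}.indicator (fun _ => (t : ℝ≥0∞)) x) atTop := by
          refine lintegral_mono_ae ?_
          filter_upwards [hφ] with x hx
          by_cases hxt : x ∈ {x | (t : ℝ≥0∞) < ‖h x‖ₑ}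
          · rw [Set.indicator_of_mem hxt]
            refine le_liminf_of_le (by isBoundedDefault) ?_
            filter_upwards [hx.enorm.eventually (lt_mem_nhds hxt)] with n hn
            rw [Set.indicator_of_mem (s := {x | (t : ℝ≥0∞) < ‖T (φ n) x‖ₑ}) hn]
          · rw [Set.indicator_of_notMem hxt]
            exact zero_le
      _ ≤ liminf (fun n => ∫⁻ x,
          {x | (t : ℝ≥0∞) < ‖T (φ n) x‖ₑ}.indicator (fun _ => (t : ℝ≥0∞)) x) atTop :=
          lintegral_liminf_le fun n => measurable_const.indicator (hm n)
      _ = _ := by simp only [lintegral_indicator_const (hm _)]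
  have e2 : ∀ n, t * volume {x | (t : ℝ≥0∞) < ‖T (φ n) x‖ₑ} ≤
      B * (A * (4⁻¹ : ℝ≥0∞) ^ n + ∫⁻ x, ‖f x‖ₑ) := fun n => by
    refine (hT (φ n) (h1 n) t).trans (mul_le_mul_right ?_ _)
    have h2 := lintegral_enorm_sub_le (h := fun _ => 0) (h1 n).aestronglyMeasurable hf
    simp only [sub_zero] at h2
    exact h2.trans (add_le_add (hA n) le_rfl)
  have e3 : Tendsto (fun n : ℕ => (B : ℝ≥0∞) * (A * (4⁻¹ : ℝ≥0∞) ^ n + ∫⁻ x, ‖f x‖ₑ)) atTop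
      (𝓝 (B * (A * 0 + ∫⁻ x, ‖f x‖ₑ))) := by
    refine ENNReal.Tendsto.const_mul (Tendsto.add_const _ ?_) (Or.inr (by simp))
    refine ENNReal.Tendsto.const_mul ?_ (Or.inr (by simp))
    exact ENNReal.tendsto_pow_atTop_nhds_zero_of_lt_one (by
      rw [ENNReal.inv_lt_one]; norm_num)
  refine e1.trans ((liminf_le_liminf (Eventually.of_forall e2)).trans ?_)
  rw [e3.liminf_eq, mul_zero, zero_add]

theorem extendsWeakL1_of_hasWeakType {T : L2Plane →L[ℂ] L2Plane} {B : ℝ≥0}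
    (hT : HasWeakType T B) : ExtendsWeakL1 T := by
  have hint : ∀ f : Lp ℂ 1 (volume : Measure (ℝ × ℝ)), Integrable f := fun f =>
    memLp_one_iff_integrable.1 (Lp.memLp f)
  choose S hS using fun f : Lp ℂ 1 (volume : Measure (ℝ × ℝ)) => exists_isRapidLimit hT (hint f)
  have hcongr : ∀ {f g h k : ℝ × ℝ → ℂ}, f =ᵐ[volume] g → h =ᵐ[volume] k → IsRapidLimit T f h →
      IsRapidLimit T g k := by
    rintro f g h k hfg hhk ⟨φ, ⟨h1, A, hA⟩, hφ⟩
    refine ⟨φ, ⟨h1, A, fun n => (le_of_eq (lintegral_congr_ae ?_)).trans (hA n)⟩, ?_⟩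
    · filter_upwards [hfg] with x hx
      rw [hx]
    · filter_upwards [hφ, hhk] with x hx hk
      rwa [← hk]
  refine ⟨{ toFun := S, map_add' := fun f g => ?_, map_smul' := fun a f => ?_ }, B, fun f => ?_,
    fun f h2 h => ?_⟩
  · refine AEEqFun.ext ?_
    refine (hS (f + g)).ae_eq hT (hint _).aestronglyMeasurable ?_
    exact hcongr (Lp.coeFn_add f g).symm (AEEqFun.coeFn_add _ _).symm
      ((hS f).add (hint f).aestronglyMeasurable (hS g))
  · refine AEEqFun.ext ?_
    refine (hS (a • f)).ae_eq hT (hint _).aestronglyMeasurable ?_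
    exact hcongr (Lp.coeFn_smul a f).symm (AEEqFun.coeFn_smul _ _).symm ((hS f).const_smul a)
  · refine ((hS f).weakL1Norm_le hT (hint f).aestronglyMeasurable
      (AEEqFun.measurable _)).trans (le_of_eq ?_)
    rw [Lp.enorm_def, eLpNorm_one_eq_lintegral_enorm]
  · refine (hS (h.toLp f)).ae_eq hT (hint _).aestronglyMeasurable ?_
    -- For f already in L² the constant sequence is rapidly convergent, with rate constant 0.
    refine ⟨fun _ => h2.toLp f, ⟨fun _ => (memLp_one_iff_integrable.1 h).congr h2.coeFn_toLp.symm,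
      0, fun n => ?_⟩, Eventually.of_forall fun x => tendsto_const_nhds⟩
    refine le_of_eq ?_
    rw [ENNReal.coe_zero, zero_mul, lintegral_eq_zero_iff' (by fun_prop)]
    filter_upwards [h2.coeFn_toLp, h.coeFn_toLp] with x h3 h4
    rw [h3, h4, sub_self, enorm_zero, Pi.zero_apply]

/-! ### Extension from L^∞ to BMO. -/

/-- The space `L^∞(ℝ²)`. -/
abbrev LInftyPlane : Type := Lp ℂ ∞ (volume : Measure (ℝ × ℝ))

theorem ae_enorm_le_enorm (f : LInftyPlane) : ∀ᵐ y, ‖f y‖ₑ ≤ ‖f‖ₑ := by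
  rw [Lp.enorm_def, eLpNorm_exponent_top]
  exact enorm_ae_le_eLpNormEssSup f volume

theorem memLp_indicator_of_bounded (f : LInftyPlane) {A : Set (ℝ × ℝ)} (hA : MeasurableSet A)
    (hA' : volume A ≠ ∞) : MemLp (A.indicator f) 2 volume := by
  rw [memLp_indicator_iff_restrict hA]
  have : IsFiniteMeasure (volume.restrict A) := isFiniteMeasure_restrict.2 hA'
  exact ((Lp.memLp f).restrict _).mono_exponent le_top

theorem memLp_near (f : LInftyPlane) (c : ℝ × ℝ) (r : ℝ) :
    MemLp ((cube c (3 * r)).indicator f) 2 volume :=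
  memLp_indicator_of_bounded f (measurableSet_cube _ _) (volume_cube_ne_top _ _)

/-- The constant subtracted from `T (1_{[-n, n)²} f)` on the square `cube c r`. -/
noncomputable def farConst (K : ℝ × ℝ → ℝ × ℝ → ℂ) (f : LInftyPlane) (c : ℝ × ℝ) (r : ℝ) (n : ℕ) :
    ℂ :=
  ∫ y in cube 0 n \ cube c (3 * r), K c y * f y

/-- The extension of `T` to `f ∈ L^∞`, on the square `cube c r` and up to a constant. -/
noncomputable def localExtension (T : L2Plane →L[ℂ] L2Plane) (K : ℝ × ℝ → ℝ × ℝ → ℂ)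
    (f : LInftyPlane) (c : ℝ × ℝ) (r : ℝ) (x : ℝ × ℝ) : ℂ :=
  T ((memLp_near f c r).toLp _) x + ∫ y in (cube c (3 * r))ᶜ, (K x y - K c y) * f y

theorem cube_subset_cube_zero {c : ℝ × ℝ} {r R : ℝ} (h : |c.1| + |c.2| + r ≤ R) :
    cube c r ⊆ cube 0 R := by
  rintro y ⟨⟨h1, h2⟩, h3, h4⟩
  have := neg_abs_le c.1
  have := neg_abs_le c.2
  have := le_abs_self c.1
  have := le_abs_self c.2
  have := abs_nonneg c.1
  have := abs_nonneg c.2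
  refine ⟨⟨?_, ?_⟩, ?_, ?_⟩ <;> simp only [Prod.fst_zero, Prod.snd_zero] <;> linarith

theorem eventually_cube_subset (c : ℝ × ℝ) (r : ℝ) : ∀ᶠ n : ℕ in atTop, cube c r ⊆ cube 0 n := by
  filter_upwards [tendsto_natCast_atTop_atTop.eventually_ge_atTop (|c.1| + |c.2| + r)] with n hn
  exact cube_subset_cube_zero hn

/-- Only the truncated integral is controlled: K(c, ·) need not be integrable on the whole
complement of the tripled square, so the constants `farConst` may diverge with n. -/
theorem integrableOn_kernel_center {θ₁ θ₂ : ℝ} {K : ℝ × ℝ → ℝ × ℝ → ℂ}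
    (hK : IsCZXKernel θ₁ θ₂ K) (hθ₁ : 0 < θ₁) (hθ₂ : 0 < θ₂) (f : LInftyPlane) (c : ℝ × ℝ) {r : ℝ}
    (hr : 0 < r) (n : ℕ) :
    IntegrableOn (fun y => K c y * f y) (cube 0 n \ cube c (3 * r)) := by
  obtain ⟨M, hM⟩ := hK.exists_lintegral_le_of_separated hθ₂ (δ := 3 * r) (by positivity)
    (dist c 0 + n)
  have h1 := hM c (cube 0 n \ cube c (3 * r)) fun y hy => by
    constructor
    · rw [Prod.dist_eq, Real.dist_eq, Real.dist_eq]
      exact le_max_iff.2 (le_abs_sub_of_notMem_cube hy.2)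
    · have h2 : dist y 0 ≤ n := cube_subset_closedBall _ _ hy.1
      linarith [dist_triangle_right c y 0]
  refine ⟨((hK.aestronglyMeasurable_right hθ₁ c).mul (Lp.aestronglyMeasurable f)).restrict, ?_⟩
  calc _ ≤ ∫⁻ y in cube 0 n \ cube c (3 * r), ‖K c y‖ₑ * ‖f‖ₑ := by
        refine lintegral_mono_ae (ae_restrict_of_ae ?_)
        filter_upwards [ae_enorm_le_enorm f] with y hy
        rw [enorm_mul]; gcongr
    _ ≤ M * ‖f‖ₑ := by
        rw [lintegral_mul_const' _ _ (by simp)]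
        gcongr
    _ < ∞ := ENNReal.mul_lt_top (by simp) (by simp)

theorem lintegral_kernel_sub_mul_le {K : ℝ × ℝ → ℝ × ℝ → ℂ} {D : ℝ≥0}
    {c x : ℝ × ℝ} {r : ℝ} (hD : ∫⁻ y in (cube c (3 * r))ᶜ, ‖K x y - K c y‖ₑ ≤ D) (f : LInftyPlane)
    {A : Set (ℝ × ℝ)} (hA : A ⊆ (cube c (3 * r))ᶜ) :
    ∫⁻ y in A, ‖(K x y - K c y) * f y‖ₑ ≤ D * ‖f‖ₑ := by
  calc _ ≤ ∫⁻ y in (cube c (3 * r))ᶜ, ‖(K x y - K c y) * f y‖ₑ := lintegral_mono_set hA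
    _ ≤ ∫⁻ y in (cube c (3 * r))ᶜ, ‖K x y - K c y‖ₑ * ‖f‖ₑ := by
        refine lintegral_mono_ae (ae_restrict_of_ae ?_)
        filter_upwards [ae_enorm_le_enorm f] with y hy
        rw [enorm_mul]; gcongr
    _ ≤ _ := by
        rw [lintegral_mul_const' _ _ (by simp)]
        gcongr

/-- The truncation is cut at the tripled square. Its outer part is separated from `cube c r`, so its
image is a kernel integral there, and subtracting `farConst` replaces the kernel by a difference. -/
theorem truncation_sub_farConst_ae_eq {θ₁ θ₂ : ℝ} {K : ℝ × ℝ → ℝ × ℝ → ℂ}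
    (hK : IsCZXKernel θ₁ θ₂ K) (hθ₁ : 0 < θ₁) (hθ₂ : 0 < θ₂) {T : L2Plane →L[ℂ] L2Plane}
    (hT : IsAssociatedKernel T K) (f : LInftyPlane) {c : ℝ × ℝ} {r : ℝ} (hr : 0 < r) {n : ℕ}
    (hn : cube c (3 * r) ⊆ cube 0 n) :
    ∀ᵐ x, x ∈ cube c r → T (truncation f n) x - farConst K f c r n =
      T ((memLp_near f c r).toLp _) x +
        ∫ y in cube 0 n \ cube c (3 * r), (K x y - K c y) * f y := by
  set B := cube 0 (n : ℝ) \ cube c (3 * r) with hB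
  have hBm : MeasurableSet B := (measurableSet_cube _ _).diff (measurableSet_cube _ _)
  have hg : MemLp (B.indicator f) 2 volume :=
    memLp_indicator_of_bounded f hBm (measure_ne_top_of_subset Set.sdiff_subset
      (volume_cube_ne_top _ _))
  have htr : truncation f n = ((memLp_near f c r).add hg).toLp _ := by
    refine (MemLp.toLp_eq_toLp_iff _ _).2 (Eventually.of_forall fun x => ?_)
    rw [Pi.add_apply]
    by_cases hx : x ∈ cube c (3 * r)
    · simp [hB, hx, hn hx]
    · by_cases hx' : x ∈ cube 0 (n : ℝ) <;> simp [hB, hx, hx']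
  have hrep := ae_eq_integral_kernel_of_ae hK hθ₁ hθ₂ hT
    (A := Metric.ball 0 n ∩ (Metric.closedBall c (3 * r))ᶜ) (U := Metric.ball c r)
    (Metric.isOpen_ball.inter Metric.isClosed_closedBall.isOpen_compl)
    (measure_ne_top_of_subset Set.inter_subset_left measure_ball_lt_top.ne) Metric.isOpen_ball
    measure_ball_lt_top.ne (δ := 2 * r) (L := r + dist c 0 + n) (by positivity)
    (fun x hx y hy => by
      have h1 : dist y 0 < n := hy.1
      have h2 : 3 * r < dist y c := not_le.1 hy.2
      have h3 : dist x c < r := hx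
      have h4 := dist_triangle_left y c x
      have h5 := dist_triangle_right x y 0
      have h6 := dist_triangle x c 0
      constructor <;> linarith) hg (by
      filter_upwards [(ball_ae_eq_closedBall 0 n).mem_iff, (cube_ae_eq_closedBall 0 n).mem_iff,
        (cube_ae_eq_closedBall c (3 * r)).mem_iff] with y h1 h2 h3 hy
      refine Set.indicator_of_notMem (fun h => hy ⟨h1.2 (h2.1 h.1), fun h' => h.2 (h3.2 h')⟩) _)
  filter_upwards [hrep, (ball_ae_eq_closedBall c r).mem_iff, (cube_ae_eq_closedBall c r).mem_iff,
    toLp_add_apply T (memLp_near f c r) hg] with x h1 h2 h3 h4 hx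
  obtain ⟨h5, h6⟩ := h1 (h2.2 (h3.1 hx))
  have e : ∀ z : ℝ × ℝ, (fun y => K z y * B.indicator f y) = B.indicator fun y => K z y * f y :=
    fun z => by
      ext y
      by_cases hy : y ∈ B <;> simp [hy]
  rw [e, integrable_indicator_iff hBm] at h5
  rw [e, integral_indicator hBm] at h6
  rw [htr, h4, h6, farConst]
  simp only [sub_mul]
  rw [integral_sub h5 (integrableOn_kernel_center hK hθ₁ hθ₂ f c hr n)]
  ring

/-- The constant of the Hörmander condition in the first variable. -/
def HasHormanderBound (K : ℝ × ℝ → ℝ × ℝ → ℂ) (D : ℝ≥0) : Prop :=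
  ∀ (c : ℝ × ℝ) (r : ℝ), ∀ x ∈ cube c r, ∫⁻ y in (cube c (3 * r))ᶜ, ‖K x y - K c y‖ₑ ≤ D

/-- The Hörmander condition makes the kernel difference integrable off the tripled square, so the
truncated integrals converge even if the subtracted constants do not. -/
theorem tendsto_truncation_sub_farConst {θ₁ θ₂ : ℝ} {K : ℝ × ℝ → ℝ × ℝ → ℂ}
    (hK : IsCZXKernel θ₁ θ₂ K) (hθ₁ : 0 < θ₁) (hθ₂ : 0 < θ₂) {T : L2Plane →L[ℂ] L2Plane}
    (hT : IsAssociatedKernel T K) {D : ℝ≥0} (hD : HasHormanderBound K D) (f : LInftyPlane)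
    (c : ℝ × ℝ) {r : ℝ} (hr : 0 < r) :
    ∀ᵐ x, x ∈ cube c r → Tendsto (fun n => T (truncation f n) x - farConst K f c r n) atTop
      (𝓝 (localExtension T K f c r x)) := by
  have hall : ∀ n : ℕ, ∀ᵐ x, cube c (3 * r) ⊆ cube 0 n → x ∈ cube c r →
      T (truncation f n) x - farConst K f c r n = T ((memLp_near f c r).toLp _) x +
        ∫ y in cube 0 n \ cube c (3 * r), (K x y - K c y) * f y := fun n => by
    by_cases hn : cube c (3 * r) ⊆ cube 0 (n : ℝ)
    · filter_upwards [truncation_sub_farConst_ae_eq hK hθ₁ hθ₂ hT f hr hn] with x hx _ using hx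
    · exact Eventually.of_forall fun x h => absurd h hn
  filter_upwards [ae_all_iff.2 hall] with x hx hxJ
  have hcm : MeasurableSet (cube c (3 * r))ᶜ := (measurableSet_cube _ _).compl
  have hmeas : AEStronglyMeasurable (fun y => (K x y - K c y) * f y) volume :=
    ((hK.aestronglyMeasurable_right hθ₁ x).sub (hK.aestronglyMeasurable_right hθ₁ c)).mul
      (Lp.aestronglyMeasurable f)
  have hint : IntegrableOn (fun y => (K x y - K c y) * f y) (cube c (3 * r))ᶜ := by
    refine ⟨hmeas.restrict, (lintegral_kernel_sub_mul_le (hD c r x hxJ) f subset_rfl).trans_lt ?_⟩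
    exact ENNReal.mul_lt_top (by simp) (by simp)
  have hlim : Tendsto (fun n : ℕ => ∫ y in cube 0 n \ cube c (3 * r), (K x y - K c y) * f y) atTop
      (𝓝 (∫ y in (cube c (3 * r))ᶜ, (K x y - K c y) * f y)) := by
    have e : ⋃ n : ℕ, cube 0 (n : ℝ) \ cube c (3 * r) = (cube c (3 * r))ᶜ := by
      ext y
      simp only [Set.mem_iUnion, Set.mem_sdiff, Set.mem_compl_iff]
      refine ⟨fun ⟨n, h⟩ => h.2, fun h => ?_⟩
      obtain ⟨n, hn⟩ := exists_nat_gt (dist y 0)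
      exact ⟨n, ball_subset_cube _ _ hn, h⟩
    rw [← e]
    refine tendsto_setIntegral_of_monotone
      (fun n => (measurableSet_cube _ _).diff (measurableSet_cube _ _)) (fun m n hmn => ?_)
      (by rw [e]; exact hint)
    refine Set.sdiff_subset_sdiff_left (cube_subset_cube_zero ?_)
    simpa using hmn
  refine (hlim.const_add (T ((memLp_near f c r).toLp _) x)).congr' ?_
  filter_upwards [eventually_cube_subset c (3 * r)] with n hn
  exact (hx n hn hxJ).symm

/-- Cauchy–Schwarz around the L² bound: the tripled square has 9 times the area, and the factor 3 is
the square root of 9. -/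
theorem lintegral_near_le (T : L2Plane →L[ℂ] L2Plane) (f : LInftyPlane) (c : ℝ × ℝ) {r : ℝ}
    (hr : 0 < r) : ∫⁻ x in cube c r, ‖T ((memLp_near f c r).toLp _) x‖ₑ ≤
      3 * ‖T‖ₑ * ‖f‖ₑ * volume (cube c r) := by
  set V := volume (cube c r) with hV
  have hhalf : (0 : ℝ) ≤ 1 / 2 := by norm_num
  have h1 : eLpNorm ((cube c (3 * r)).indicator f) 2 volume ≤ ‖f‖ₑ * (3 * V ^ (1 / 2 : ℝ)) := by
    rw [eLpNorm_indicator_eq_eLpNorm_restrict (measurableSet_cube _ _)]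
    have h2 := eLpNorm_le_eLpNorm_mul_rpow_measure_univ (p := 2) (q := ∞)
      (μ := volume.restrict (cube c (3 * r))) (f := (f : ℝ × ℝ → ℂ)) le_top
      (Lp.aestronglyMeasurable f).restrict
    refine h2.trans ?_
    rw [Measure.restrict_apply_univ, volume_cube_three_mul c hr]
    simp only [ENNReal.toReal_top, ENNReal.toReal_ofNat, div_zero, sub_zero]
    rw [ENNReal.mul_rpow_of_nonneg _ _ hhalf]
    have h3 : (9 : ℝ≥0∞) ^ (1 / 2 : ℝ) = 3 := by
      rw [show (9 : ℝ≥0∞) = 3 ^ (2 : ℝ) by norm_num, ← ENNReal.rpow_mul]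
      norm_num
    rw [h3, Lp.enorm_def]
    exact mul_le_mul' (eLpNorm_restrict_le (f : ℝ × ℝ → ℂ) _ _ _) le_rfl
  have h4 : eLpNorm (T ((memLp_near f c r).toLp _)) 2 volume ≤
      ‖T‖ₑ * (‖f‖ₑ * (3 * V ^ (1 / 2 : ℝ))) := by
    rw [← Lp.enorm_def]
    refine (T.le_opENorm _).trans ?_
    rw [Lp.enorm_toLp]
    gcongr
  have h5 := eLpNorm_le_eLpNorm_mul_rpow_measure_univ (p := 1) (q := 2)
    (μ := volume.restrict (cube c r)) (f := (T ((memLp_near f c r).toLp _) : ℝ × ℝ → ℂ))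
    (by norm_num) (Lp.aestronglyMeasurable (T ((memLp_near f c r).toLp _))).restrict
  rw [Measure.restrict_apply_univ, eLpNorm_one_eq_lintegral_enorm] at h5
  refine h5.trans ?_
  have h6 : (1 / (1 : ℝ≥0∞).toReal - 1 / (2 : ℝ≥0∞).toReal) = (1 / 2 : ℝ) := by norm_num
  rw [h6]
  calc _ ≤ ‖T‖ₑ * (‖f‖ₑ * (3 * V ^ (1 / 2 : ℝ))) * V ^ (1 / 2 : ℝ) := by
        gcongr
        exact (eLpNorm_restrict_le _ _ _ _).trans h4
    _ = 3 * ‖T‖ₑ * ‖f‖ₑ * (V ^ (1 / 2 : ℝ) * V ^ (1 / 2 : ℝ)) := by ring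
    _ = _ := by
        rw [← ENNReal.rpow_add_of_nonneg _ _ hhalf hhalf]
        norm_num

theorem lintegral_localExtension_le (T : L2Plane →L[ℂ] L2Plane) {K : ℝ × ℝ → ℝ × ℝ → ℂ}
    {D : ℝ≥0} (hD : HasHormanderBound K D) (f : LInftyPlane) (c : ℝ × ℝ) {r : ℝ} (hr : 0 < r) :
    ∫⁻ x in cube c r, ‖localExtension T K f c r x‖ₑ ≤
      (3 * ‖T‖ₑ + D) * ‖f‖ₑ * volume (cube c r) := by
  calc _ ≤ ∫⁻ x in cube c r, (‖T ((memLp_near f c r).toLp _) x‖ₑ + D * ‖f‖ₑ) := by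
        refine setLIntegral_mono' (measurableSet_cube c r) fun x hx => ?_
        refine (enorm_add_le _ _).trans ?_
        gcongr
        exact (enorm_integral_le_lintegral_enorm _).trans
          (lintegral_kernel_sub_mul_le (hD c r x hx) f subset_rfl)
    _ = (∫⁻ x in cube c r, ‖T ((memLp_near f c r).toLp _) x‖ₑ) +
          D * ‖f‖ₑ * volume (cube c r) := by
        rw [lintegral_add_right _ measurable_const, setLIntegral_const]
    _ ≤ _ := by
        grw [lintegral_near_le T f c hr]
        rw [add_mul, add_mul]

theorem integrableOn_localExtension {θ₁ θ₂ : ℝ} {K : ℝ × ℝ → ℝ × ℝ → ℂ}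
    (hK : IsCZXKernel θ₁ θ₂ K) (hθ₁ : 0 < θ₁) (hθ₂ : 0 < θ₂) {T : L2Plane →L[ℂ] L2Plane}
    (hT : IsAssociatedKernel T K) {D : ℝ≥0} (hD : HasHormanderBound K D) (f : LInftyPlane)
    (c : ℝ × ℝ) {r : ℝ} (hr : 0 < r) : IntegrableOn (localExtension T K f c r) (cube c r) := by
  refine ⟨?_, (lintegral_localExtension_le T hD f c hr).trans_lt (ENNReal.mul_lt_top (by finiteness)
    (volume_cube_ne_top c r).lt_top)⟩
  refine aestronglyMeasurable_of_tendsto_ae atTop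
    (f := fun (n : ℕ) x => T (truncation f n) x - farConst K f c r n)
    (fun n => ((Lp.aestronglyMeasurable _).sub aestronglyMeasurable_const).restrict) ?_
  rw [ae_restrict_iff' (measurableSet_cube c r)]
  exact tendsto_truncation_sub_farConst hK hθ₁ hθ₂ hT hD f c hr

/-- `s` is the normalized almost everywhere limit of `T (1_{[-n, n)²} f)`. -/
def IsBMOLimit (T : L2Plane →L[ℂ] L2Plane) (K : ℝ × ℝ → ℝ × ℝ → ℂ) (f : LInftyPlane)
    (s : ℝ × ℝ → ℂ) : Prop :=
  ∀ᵐ x, Tendsto (fun n => T (truncation f n) x - farConst K f 0 1 n) atTop (𝓝 (s x))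

theorem exists_mem_of_ae {P : ℝ × ℝ → Prop} (h : ∀ᵐ x, P x) (c : ℝ × ℝ) {r : ℝ} (hr : 0 < r) :
    ∃ x ∈ cube c r, P x := by
  by_contra! hcon
  have : cube c r ⊆ {x | ¬ P x} := fun x hx => hcon x hx
  exact volume_cube_ne_zero c hr (measure_mono_null this h)

/-- All truncations are normalized by the constants of one fixed square. On each larger centred
square a different normalization is known to converge; the two differ by a sequence of constants, so
convergence at one point settles it everywhere. -/
theorem exists_isBMOLimit {θ₁ θ₂ : ℝ} {K : ℝ × ℝ → ℝ × ℝ → ℂ}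
    (hK : IsCZXKernel θ₁ θ₂ K) (hθ₁ : 0 < θ₁) (hθ₂ : 0 < θ₂) {T : L2Plane →L[ℂ] L2Plane}
    (hT : IsAssociatedKernel T K) {D : ℝ≥0} (hD : HasHormanderBound K D) (f : LInftyPlane) :
    ∃ s : ℝ × ℝ →ₘ[volume] ℂ, IsBMOLimit T K f s := by
  have hloc : ∀ k : ℕ, ∀ᵐ x, x ∈ cube 0 ((k : ℝ) + 1) →
      ∃ l, Tendsto (fun n => T (truncation f n) x - farConst K f 0 1 n) atTop (𝓝 l) := by
    intro k
    have h1 := tendsto_truncation_sub_farConst hK hθ₁ hθ₂ hT hD f 0 one_pos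
    have h2 := tendsto_truncation_sub_farConst hK hθ₁ hθ₂ hT hD f 0
      (by positivity : (0 : ℝ) < (k : ℝ) + 1)
    have hsub : cube 0 1 ⊆ cube 0 ((k : ℝ) + 1) := cube_subset_cube_zero (by simp)
    -- At a common point of convergence, subtraction removes the truncations and shows that the
    -- difference of the two constants converges.
    obtain ⟨x₀, hx₀, h3, h4⟩ := exists_mem_of_ae (h1.and h2) 0 one_pos
    have h5 := (h3 hx₀).sub (h4 (hsub hx₀))
    filter_upwards [h2] with x hx hxk
    refine ⟨_, ((hx hxk).add h5).congr fun n => ?_⟩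
    ring
  obtain ⟨s, hsm, hs⟩ := exists_stronglyMeasurable_limit_of_tendsto_ae
    (f := fun (n : ℕ) x => T (truncation f n) x - farConst K f 0 1 n) (μ := volume)
    (fun n => (Lp.aestronglyMeasurable _).sub aestronglyMeasurable_const) (by
      filter_upwards [ae_all_iff.2 hloc] with x hx
      obtain ⟨k, hk⟩ := exists_nat_gt (dist x 0)
      exact hx k (ball_subset_cube _ _ (by rw [Metric.mem_ball]; linarith)))
  refine ⟨AEEqFun.mk s hsm.aestronglyMeasurable, ?_⟩
  filter_upwards [hs, AEEqFun.coeFn_mk s hsm.aestronglyMeasurable] with x h1 h2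
  rwa [h2]

theorem IsBMOLimit.exists_eq_add {θ₁ θ₂ : ℝ} {K : ℝ × ℝ → ℝ × ℝ → ℂ}
    (hK : IsCZXKernel θ₁ θ₂ K) (hθ₁ : 0 < θ₁) (hθ₂ : 0 < θ₂) {T : L2Plane →L[ℂ] L2Plane}
    (hT : IsAssociatedKernel T K) {D : ℝ≥0} (hD : HasHormanderBound K D) {f : LInftyPlane}
    {s : ℝ × ℝ → ℂ} (hs : IsBMOLimit T K f s) (c : ℝ × ℝ) {r : ℝ} (hr : 0 < r) :
    ∃ b, ∀ᵐ x, x ∈ cube c r → s x = localExtension T K f c r x + b := by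
  have h1 := tendsto_truncation_sub_farConst hK hθ₁ hθ₂ hT hD f c hr
  obtain ⟨x₀, hx₀, h2, h3⟩ := exists_mem_of_ae (h1.and hs) c hr
  have h4 := h3.sub (h2 hx₀)
  refine ⟨s x₀ - localExtension T K f c r x₀, ?_⟩
  filter_upwards [h1, hs] with x h5 h6 hx
  refine tendsto_nhds_unique h6 (((h5 hx).add h4).congr fun n => ?_)
  ring

/-- Oscillation may be measured against any constant; passing to the average at most doubles it. -/
theorem bmoSeminorm_le_of_forall {s : ℝ × ℝ → ℂ} {C : ℝ≥0∞}
    (h : ∀ (c : ℝ × ℝ) (r : ℝ), 0 < r → ∃ (H : ℝ × ℝ → ℂ) (b : ℂ), IntegrableOn H (cube c r) ∧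
      (∀ᵐ x, x ∈ cube c r → s x = H x + b) ∧ ∫⁻ x in cube c r, ‖H x‖ₑ ≤ C * volume (cube c r)) :
    bmoSeminorm s ≤ 2 * C := by
  refine iSup_le fun c => iSup_le fun r => iSup_le fun hr => ?_
  obtain ⟨H, b, hi, hsb, hH⟩ := h c r hr
  have hV := volume_cube_ne_zero c hr
  have hV' := volume_cube_ne_top c r
  have : IsFiniteMeasure (volume.restrict (cube c r)) := isFiniteMeasure_restrict.2 hV'
  have hsb' : ∀ᵐ x ∂(volume.restrict (cube c r)), s x = H x + b :=
    (ae_restrict_iff' (measurableSet_cube c r)).2 hsb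
  have hav : ⨍ y in cube c r, s y = (⨍ y in cube c r, H y) + b := by
    rw [average_congr hsb', setAverage_eq, setAverage_eq, integral_add hi (integrable_const b),
      setIntegral_const, smul_add, smul_smul, inv_mul_cancel₀, one_smul]
    exact (ENNReal.toReal_pos hV hV').ne'
  refine ENNReal.div_le_of_le_mul ?_
  calc _ ≤ ∫⁻ x in cube c r, (‖H x‖ₑ + ‖⨍ y in cube c r, H y‖ₑ) := by
        refine lintegral_mono_ae ?_
        filter_upwards [hsb'] with x hx
        rw [hav, hx, add_sub_add_right_eq_sub]
        exact enorm_sub_le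
    _ = (∫⁻ x in cube c r, ‖H x‖ₑ) + volume (cube c r) * ‖⨍ y in cube c r, H y‖ₑ := by
        rw [lintegral_add_right _ measurable_const, setLIntegral_const, mul_comm (volume _)]
    _ ≤ C * volume (cube c r) + C * volume (cube c r) :=
        add_le_add hH ((volume_mul_enorm_setAverage_le H hV').trans hH)
    _ = _ := by ring

theorem locallyIntegrable_of_forall_cube {s : ℝ × ℝ → ℂ}
    (h : ∀ n : ℕ, IntegrableOn s (cube 0 ((n : ℝ) + 1))) : LocallyIntegrable s volume := by
  rw [locallyIntegrable_iff]
  intro k hk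
  obtain ⟨R, hR⟩ := hk.isBounded.subset_ball 0
  obtain ⟨n, hn⟩ := exists_nat_gt R
  refine (h n).mono_set fun x hx => ball_subset_cube _ _ ?_
  exact Metric.ball_subset_ball (by linarith) (hR hx)

theorem exists_bound_of_mem_cubeStep {g : ℝ × ℝ → ℂ} (hg : g ∈ cubeStep) :
    ∃ (k : ℕ) (M : ℝ), ∀ x, ‖g x‖ ≤ M ∧ (x ∉ cube 0 ((k : ℝ) + 1) → g x = 0) := by
  unfold cubeStep at hg
  induction hg using Submodule.span_induction with
  | mem f hf =>
    obtain ⟨q, rfl⟩ := hf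
    obtain ⟨k, hk⟩ := exists_nat_gt (|q.1.1| + |q.1.2| + q.2)
    refine ⟨k, 1, fun x => ⟨?_, fun hx => Set.indicator_of_notMem (fun h => hx ?_) _⟩⟩
    · by_cases hx : x ∈ cube q.1 q.2 <;> simp [hx]
    · exact cube_subset_cube_zero (by linarith) h
  | zero => exact ⟨0, 0, fun x => by simp⟩
  | add f g _ _ hf hg =>
    obtain ⟨k, M, h⟩ := hf
    obtain ⟨k', M', h'⟩ := hg
    refine ⟨k + k', M + M', fun x => ⟨(norm_add_le _ _).trans (add_le_add (h x).1 (h' x).1),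
      fun hx => ?_⟩⟩
    have e1 : x ∉ cube 0 ((k : ℝ) + 1) := fun hk => hx (cube_subset_cube_zero (by simp) hk)
    have e2 : x ∉ cube 0 ((k' : ℝ) + 1) := fun hk => hx (cube_subset_cube_zero (by simp) hk)
    rw [Pi.add_apply, (h x).2 e1, (h' x).2 e2, add_zero]
  | smul a f _ hf =>
    obtain ⟨k, M, h⟩ := hf
    refine ⟨k, ‖a‖ * M, fun x => ⟨?_, fun hx => by rw [Pi.smul_apply, (h x).2 hx, smul_zero]⟩⟩
    rw [Pi.smul_apply, norm_smul]
    exact mul_le_mul_of_nonneg_left (h x).1 (norm_nonneg a)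

theorem truncation_add (f g : LInftyPlane) (n : ℕ) :
    truncation (f + g) n = truncation f n + truncation g n := by
  rw [truncation, truncation, truncation, ← MemLp.toLp_add]
  refine (MemLp.toLp_eq_toLp_iff _ _).2 ?_
  filter_upwards [Lp.coeFn_add f g] with x hx
  by_cases h : x ∈ cube 0 (n : ℝ)
  · simp only [Pi.add_apply, Set.indicator_of_mem h, hx]
  · simp only [Pi.add_apply, Set.indicator_of_notMem h, add_zero]

theorem truncation_smul (a : ℂ) (f : LInftyPlane) (n : ℕ) :
    truncation (a • f) n = a • truncation f n := by
  rw [truncation, truncation, ← MemLp.toLp_const_smul]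
  refine (MemLp.toLp_eq_toLp_iff _ _).2 ?_
  filter_upwards [Lp.coeFn_smul a f] with x hx
  by_cases h : x ∈ cube 0 (n : ℝ)
  · simp only [Pi.smul_apply, Set.indicator_of_mem h, hx]
  · simp only [Pi.smul_apply, Set.indicator_of_notMem h, smul_zero]

theorem farConst_smul (K : ℝ × ℝ → ℝ × ℝ → ℂ) (a : ℂ) (f : LInftyPlane) (c : ℝ × ℝ) (r : ℝ)
    (n : ℕ) : farConst K (a • f) c r n = a * farConst K f c r n := by
  rw [farConst, farConst, ← integral_const_mul]
  refine integral_congr_ae (ae_restrict_of_ae ?_)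
  filter_upwards [Lp.coeFn_smul a f] with y hy
  rw [hy, Pi.smul_apply, smul_eq_mul]
  ring

theorem farConst_add {θ₁ θ₂ : ℝ} {K : ℝ × ℝ → ℝ × ℝ → ℂ}
    (hK : IsCZXKernel θ₁ θ₂ K) (hθ₁ : 0 < θ₁) (hθ₂ : 0 < θ₂) (f g : LInftyPlane) (c : ℝ × ℝ)
    {r : ℝ} (hr : 0 < r) (n : ℕ) :
    farConst K (f + g) c r n = farConst K f c r n + farConst K g c r n := by
  rw [farConst, farConst, farConst,
    ← integral_add (integrableOn_kernel_center hK hθ₁ hθ₂ f c hr n)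
      (integrableOn_kernel_center hK hθ₁ hθ₂ g c hr n)]
  refine integral_congr_ae (ae_restrict_of_ae ?_)
  filter_upwards [Lp.coeFn_add f g] with y hy
  rw [hy, Pi.add_apply]
  ring

namespace IsBMOLimit

variable {T : L2Plane →L[ℂ] L2Plane} {K : ℝ × ℝ → ℝ × ℝ → ℂ} {f g : LInftyPlane}
  {s t : ℝ × ℝ → ℂ}

theorem ae_eq (hs : IsBMOLimit T K f s) (ht : IsBMOLimit T K f t) : s =ᵐ[volume] t := by
  filter_upwards [hs, ht] with x h1 h2 using tendsto_nhds_unique h1 h2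

theorem smul (hs : IsBMOLimit T K f s) (a : ℂ) : IsBMOLimit T K (a • f) (a • s) := by
  filter_upwards [hs, ae_all_iff.2 fun n => Lp.coeFn_smul a (T (truncation f n))] with x h1 h2
  refine (h1.const_mul a).congr fun n => ?_
  rw [truncation_smul, map_smul, h2 n, farConst_smul, Pi.smul_apply, smul_eq_mul, mul_sub]

theorem add {θ₁ θ₂ : ℝ} (hK : IsCZXKernel θ₁ θ₂ K) (hθ₁ : 0 < θ₁) (hθ₂ : 0 < θ₂)
    (hs : IsBMOLimit T K f s) (ht : IsBMOLimit T K g t) : IsBMOLimit T K (f + g) (s + t) := by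
  filter_upwards [hs, ht, ae_all_iff.2 fun n =>
    Lp.coeFn_add (T (truncation f n)) (T (truncation g n))] with x h1 h2 h3
  refine (h1.add h2).congr fun n => ?_
  rw [truncation_add, map_add, h3 n, farConst_add hK hθ₁ hθ₂ f g 0 one_pos, Pi.add_apply]
  ring

end IsBMOLimit

theorem tendsto_truncation {f : ℝ × ℝ → ℂ} (h2 : MemLp f 2 volume) (h : MemLp f ∞ volume) :
    Tendsto (truncation (h.toLp f)) atTop (𝓝 (h2.toLp f)) := by
  have hgoal : Tendsto (fun n : ℕ => ∫⁻ x, ‖(cube 0 (n : ℝ)).indicator f x - f x‖ₑ ^ 2) atTop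
      (𝓝 0) := by
    have hfin : ∫⁻ x, ‖f x‖ₑ ^ 2 ≠ ∞ := by
      rw [← eLpNorm_two_sq]
      exact ENNReal.pow_ne_top h2.eLpNorm_ne_top
    have := tendsto_lintegral_of_dominated_convergence' (μ := volume)
      (F := fun (n : ℕ) x => ‖(cube 0 (n : ℝ)).indicator f x - f x‖ₑ ^ 2) (f := fun _ => 0)
      (fun x => ‖f x‖ₑ ^ 2)
      (fun n => ((h2.1.indicator (measurableSet_cube 0 _)).sub h2.1).enorm.pow_const 2)
      (fun n => Eventually.of_forall fun x => by
        by_cases hx : x ∈ cube 0 (n : ℝ) <;> simp [hx]) hfin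
      (Eventually.of_forall fun x => by
        obtain ⟨k, hk⟩ := exists_nat_gt (dist x 0)
        refine tendsto_const_nhds.congr' ?_
        filter_upwards [eventually_ge_atTop k] with n hn
        have hn' : (k : ℝ) ≤ n := by exact_mod_cast hn
        have hx : x ∈ cube 0 (n : ℝ) := ball_subset_cube _ _ (by rw [Metric.mem_ball]; linarith)
        simp [hx])
    simpa using this
  rw [Lp.tendsto_Lp_iff_tendsto_eLpNorm]
  have hsq := hgoal.ennrpow_const (1 / 2)
  rw [ENNReal.zero_rpow_of_pos (by norm_num)] at hsq
  refine hsq.congr fun n => ?_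
  have hae : ⇑(truncation (h.toLp f) n) - f =ᵐ[volume] (cube 0 (n : ℝ)).indicator f - f := by
    filter_upwards [MemLp.coeFn_toLp (memLp_truncation (h.toLp f) n), h.coeFn_toLp] with x h3 h4
    rw [Pi.sub_apply, Pi.sub_apply, truncation, h3]
    by_cases hx : x ∈ cube 0 (n : ℝ) <;> simp [hx, h4]
  rw [eLpNorm_congr_ae hae]
  have := eLpNorm_two_sq volume ((cube 0 (n : ℝ)).indicator f - f)
  simp only [Pi.sub_apply] at this
  rw [← this, ← ENNReal.rpow_natCast, ← ENNReal.rpow_mul]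
  norm_num

/-- For f in L² the truncations converge in L², so along a subsequence their images converge to Tf
almost everywhere; one point fixes the limit of the constants. -/
theorem IsBMOLimit.exists_eq_toLp_add {T : L2Plane →L[ℂ] L2Plane} {K : ℝ × ℝ → ℝ × ℝ → ℂ}
    {f s : ℝ × ℝ → ℂ} (h2 : MemLp f 2 volume) (h : MemLp f ∞ volume)
    (hs : IsBMOLimit T K (h.toLp f) s) : ∃ a, ∀ᵐ x, s x = T (h2.toLp f) x + a := by
  have h3 : Tendsto (fun n => T (truncation (h.toLp f) n)) atTop (𝓝 (T (h2.toLp f))) :=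
    (T.continuous.tendsto _).comp (tendsto_truncation h2 h)
  obtain ⟨φ, hφ, h4⟩ := (tendstoInMeasure_of_tendsto_Lp h3).exists_seq_tendsto_ae
  obtain ⟨x₀, -, h5, h6⟩ := exists_mem_of_ae (h4.and hs) 0 one_pos
  have h7 := (h6.comp hφ.tendsto_atTop).sub h5
  refine ⟨s x₀ - T (h2.toLp f) x₀, ?_⟩
  filter_upwards [h4, hs] with x h8 h9
  refine tendsto_nhds_unique (h9.comp hφ.tendsto_atTop) ((h8.add h7).congr fun n => ?_)
  simp only [Function.comp_apply]
  ring

theorem integral_sub_const_mul {u g : ℝ × ℝ → ℂ} (hug : Integrable fun x => u x * g x)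
    (hg : Integrable g) (hg0 : ∫ x, g x = 0) (b : ℂ) :
    ∫ x, (u x - b) * g x = ∫ x, u x * g x := by
  simp only [sub_mul]
  rw [integral_sub hug (hg.const_mul b), integral_const_mul, hg0, mul_zero, sub_zero]

/-- Since g has integral zero, the constants can be inserted or removed on both sides, and the claim
reduces to the normalized limit on one square containing the support of g. -/
theorem IsBMOLimit.tendsto_integral_mul {θ₁ θ₂ : ℝ} {K : ℝ × ℝ → ℝ × ℝ → ℂ}
    (hK : IsCZXKernel θ₁ θ₂ K) (hθ₁ : 0 < θ₁) (hθ₂ : 0 < θ₂) {T : L2Plane →L[ℂ] L2Plane}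
    (hT : IsAssociatedKernel T K) {D : ℝ≥0} (hD : HasHormanderBound K D) {f : LInftyPlane}
    {s : ℝ × ℝ → ℂ} (hs : IsBMOLimit T K f s) {g : ℝ × ℝ → ℂ} (hg : g ∈ cubeStep)
    (hg0 : ∫ x, g x = 0) :
    Tendsto (fun n : ℕ => ∫ x, T (truncation f n) x * g x) atTop (𝓝 (∫ x, s x * g x)) := by
  obtain ⟨k, M, hM⟩ := exists_bound_of_mem_cubeStep hg
  have hr : (0 : ℝ) < k + 1 := by positivity
  set r : ℝ := k + 1
  have hJ := measurableSet_cube 0 r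
  have hgi : Integrable g := memLp_one_iff_integrable.1 (memLp_of_mem_cubeStep hg 1)
  have hmul : ∀ {u : ℝ × ℝ → ℂ}, IntegrableOn u (cube 0 r) → Integrable fun x => u x * g x := by
    intro u hu
    refine ((hu.integrable_indicator hJ).mul_bdd hgi.1 (Eventually.of_forall fun x =>
      (hM x).1)).congr (Eventually.of_forall fun x => ?_)
    by_cases hx : x ∈ cube 0 r
    · simp [hx]
    · simp [(hM x).2 hx]
  have hloc := hmul (integrableOn_localExtension hK hθ₁ hθ₂ hT hD f 0 hr)
  have hTi : ∀ u : L2Plane, IntegrableOn u (cube 0 r) := fun u =>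
    integrableOn_of_memLp_two (Lp.memLp u) (volume_cube_ne_top _ _)
  obtain ⟨b, hb⟩ := hs.exists_eq_add hK hθ₁ hθ₂ hT hD 0 hr
  have hsg : ∫ x, s x * g x = ∫ x, localExtension T K f 0 r x * g x := by
    have e : (fun x => localExtension T K f 0 r x * g x) =ᵐ[volume] fun x => (s x - b) * g x := by
      filter_upwards [hb] with x hx
      by_cases hxJ : x ∈ cube 0 r
      · rw [hx hxJ, add_sub_cancel_right]
      · simp [(hM x).2 hxJ]
    rw [integral_congr_ae e, integral_sub_const_mul _ hgi hg0]
    refine (hloc.add (hgi.const_mul b)).congr ?_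
    filter_upwards [e] with x hx
    rw [Pi.add_apply, hx]
    ring
  have hTg : ∀ n : ℕ, ∫ x, (T (truncation f n) x - farConst K f 0 r n) * g x =
      ∫ x, T (truncation f n) x * g x := fun n =>
    integral_sub_const_mul (hmul (hTi _)) hgi hg0 _
  rw [hsg]
  simp only [← hTg]
  have hM0 : 0 ≤ M := (norm_nonneg _).trans (hM 0).1
  -- The near part of the image does not depend on n, and the far part is at most D‖f‖ by the
  -- Hörmander condition; this dominates for all large n.
  refine tendsto_integral_filter_of_dominated_convergence
    (fun x => (cube 0 r).indicator
      (fun x => (‖T ((memLp_near f 0 r).toLp _) x‖ + D * ‖f‖) * M) x)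
    (Eventually.of_forall fun n =>
      ((Lp.aestronglyMeasurable _).sub aestronglyMeasurable_const).mul hgi.1) ?_ ?_ ?_
  · filter_upwards [eventually_cube_subset 0 (3 * r)] with n hn
    filter_upwards [truncation_sub_farConst_ae_eq hK hθ₁ hθ₂ hT f hr hn] with x hx
    by_cases hxJ : x ∈ cube 0 r
    · rw [Set.indicator_of_mem hxJ, norm_mul, hx hxJ]
      refine mul_le_mul ((norm_add_le _ _).trans (add_le_add le_rfl ?_)) (hM x).1 (norm_nonneg _)
        (by positivity)
      have h1 := (enorm_integral_le_lintegral_enorm _).trans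
        (lintegral_kernel_sub_mul_le (hD 0 r x hxJ) f (A := cube 0 (n : ℝ) \ cube 0 (3 * r))
          fun y hy => hy.2)
      have h2 := ENNReal.toReal_mono (by finiteness) h1
      simpa using h2
    · rw [(hM x).2 hxJ, mul_zero, norm_zero, Set.indicator_of_notMem hxJ]
  · refine IntegrableOn.integrable_indicator ?_ hJ
    exact ((hTi _).norm.add (integrableOn_const (volume_cube_ne_top _ _))).mul_const M
  · filter_upwards [tendsto_truncation_sub_farConst hK hθ₁ hθ₂ hT hD f 0 hr] with x hx
    by_cases hxJ : x ∈ cube 0 r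
    · exact (hx hxJ).mul_const _
    · simp [(hM x).2 hxJ]

theorem extendsLinftyBMO_of_hasHormanderBound {θ₁ θ₂ : ℝ} {K : ℝ × ℝ → ℝ × ℝ → ℂ}
    (hK : IsCZXKernel θ₁ θ₂ K) (hθ₁ : 0 < θ₁) (hθ₂ : 0 < θ₂) {T : L2Plane →L[ℂ] L2Plane}
    (hT : IsAssociatedKernel T K) {D : ℝ≥0} (hD : HasHormanderBound K D) :
    ExtendsLinftyBMO T := by
  choose S hS using exists_isBMOLimit hK hθ₁ hθ₂ hT hD
  refine ⟨{ toFun := S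
            map_add' := fun f g => AEEqFun.ext ?_
            map_smul' := fun a f => AEEqFun.ext ?_ }, 2 * (3 * ‖T‖₊ + D), fun f => ⟨?_, ?_⟩,
    fun f h2 h => (hS _).exists_eq_toLp_add h2 h,
    fun f g hg hg0 => (hS f).tendsto_integral_mul hK hθ₁ hθ₂ hT hD hg hg0⟩
  · exact ((hS (f + g)).ae_eq ((hS f).add hK hθ₁ hθ₂ (hS g))).trans
      (AEEqFun.coeFn_add _ _).symm
  · exact ((hS (a • f)).ae_eq ((hS f).smul a)).trans (AEEqFun.coeFn_smul _ _).symm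
  · refine locallyIntegrable_of_forall_cube fun n => ?_
    obtain ⟨b, hb⟩ := (hS f).exists_eq_add hK hθ₁ hθ₂ hT hD 0 (Nat.cast_add_one_pos (α := ℝ) n)
    refine ((integrableOn_localExtension hK hθ₁ hθ₂ hT hD f 0
      (Nat.cast_add_one_pos (α := ℝ) n)).add
      (integrableOn_const (C := b) (volume_cube_ne_top _ _))).congr ?_
    rw [EventuallyEq, ae_restrict_iff' (measurableSet_cube _ _)]
    filter_upwards [hb] with x hx hxJ using (hx hxJ).symm
  · refine (bmoSeminorm_le_of_forall (C := (3 * ‖T‖ₑ + D) * ‖f‖ₑ) fun c r hr => ?_).trans ?_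
    · obtain ⟨b, hb⟩ := (hS f).exists_eq_add hK hθ₁ hθ₂ hT hD c hr
      exact ⟨localExtension T K f c r, b, integrableOn_localExtension hK hθ₁ hθ₂ hT hD f c hr, hb,
        lintegral_localExtension_le T hD f c hr⟩
    · rw [← mul_assoc]
      simp [enorm_eq_nnnorm]

theorem mainTheorem9 (θ₁ θ₂ : ℝ) (hθ₁ : 0 < θ₁ ∧ θ₁ ≤ 1) (hθ₂ : 0 < θ₂ ∧ θ₂ ≤ 1)
    (K : ℝ × ℝ → ℝ × ℝ → ℂ) (hK : IsCZXKernel θ₁ θ₂ K)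
    (T : Lp ℂ 2 (volume : Measure (ℝ × ℝ)) →L[ℂ] Lp ℂ 2 (volume : Measure (ℝ × ℝ)))
    (hT : IsAssociatedKernel T K) :
    ExtendsLinftyBMO T ∧ ExtendsWeakL1 T ∧
      (∀ (p : ℝ≥0∞) [Fact (1 ≤ p)], 1 < p → p < ∞ → ExtendsLp T p) ∧
      HormanderCondition K := by
  obtain ⟨T', hTT⟩ := exists_transpose T
  obtain ⟨B, hB⟩ := exists_hasOffDiagonalBound hK hθ₁.1 hθ₂.1 hT
  -- The transpose is associated with the swapped kernel, which satisfies the same estimates.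
  obtain ⟨B', hB'⟩ := exists_hasOffDiagonalBound hK.swap hθ₁.1 hθ₂.1 (hT.transpose hTT)
  obtain ⟨D, hD⟩ := hK.exists_hormander hθ₁.1 hθ₂.1
  obtain ⟨A, hA⟩ := exists_hasWeakType hB
  exact ⟨extendsLinftyBMO_of_hasHormanderBound hK hθ₁.1 hθ₂.1 hT hD,
    extendsWeakL1_of_hasWeakType hA,
    fun p _ hp hp' => extendsLp_of_hasOffDiagonalBound hTT hB hB' hp hp',
    hK.hormanderCondition hθ₁.1 hθ₂.1⟩
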